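/- Let $n \ge p$ and let $X \in \mathbb{R}^{n\times p}$ be a random matrix with independent entries $X_{ai} \sim \mathrm{N}(M_{ai},1)$, where $M \in \mathbb{R}^{n\times p}$. For an estimator $\hat M=\hat M(X)$ the matrix quadratic risk is $\mathrm{E}_M[(\hat M-M)^\top(\hat M-M)]$ (a $p\times p$ matrix). Let $X = U\,\mathrm{diag}(\sigma_1,\dots,\sigma_p)\,V^\top$ be a singular value decomposition, with $U^\top U = V^\top V = I_p$ and $\sigma_1\ge\dots\ge\sigma_p\ge 0$, and let $\lambda_1\ge\dots\ge\lambda_p$ be the eigenvalues of $X^\top X$, so that $\lambda_k=\sigma_k^2$. Let $c_1,\dots,c_p\ge 0$, where $n\ge p+2$ or $c_p=0$ (so that the risk below is finite), and consider the estimator $$\hat M = U\,\mathrm{diag}\Big(\sigma_1-\frac{c_1}{\sigma_1},\dots,\sigma_p-\frac{c_p}{\sigma_p}\Big)V^\top .$$ (i) The function $h(X)=-\frac12\sum_{k=1}^p c_k\log\lambda_k$ satisfies $h(QXR)=h(X)$ for all orthogonal $Q\in O(n)$, $R\in O(p)$. At every $X$ for which $\lambda_1,\dots,\lambda_p$ are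 distinct and positive, hence almost surely, the partial derivatives of $h$ exist and $\hat M = X+\widetilde\nabla h(X)$, where $(\widetilde\nabla h(X))_{ai}=\partial h(X)/\partial X_{ai}$. (ii) The expectations below exist, and $$\mathrm{E}_M[(\hat M-M)^\top(\hat M-M)] = nI_p+\mathrm{E}_M[VDV^\top],$$ where $D$ is the $p \times p$ diagonal matrix with $$D_{kk}=\frac{1}{\lambda_k}c_k(c_k-2n+4)-\frac{2}{\lambda_k}\sum_{l\ne k}\frac{c_k\lambda_l-c_l\lambda_k}{\lambda_k-\lambda_l}.$$ (iii) If $n\ge p+2$ and $c_k=n-p-1$ for all $k$, then $\hat M$ is the Efron–Morris estimator, $\hat M=X(I_p-(n-p-1)(X^\top X)^{-1})$ whenever $X^\top X$ is invertible, the matrix $\mathrm{E}_M[(X^\top X)^{-1}]$ exists, and $$\mathrm{E}_M[(\hat M-M)^\top(\hat M-M)]=nI_p-(n-p-1)^2\,\mathrm{E}_M[(X^\top X)^{-1}].$$ -/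

import Mathlib

open MeasureTheory ProbabilityTheory

open scoped Matrix

noncomputable section

/-- Partial derivatives of `f` at `X` with respect to all matrix entries exist. -/
def HasMatrixPartials {n p : ℕ} (f : Matrix (Fin n) (Fin p) ℝ → ℝ)
    (X : Matrix (Fin n) (Fin p) ℝ) : Prop :=
  ∀ a i, DifferentiableAt ℝ (fun t : ℝ => f (X + t • Matrix.single a i (1 : ℝ))) 0

/-- The matrix gradient: its `(a, i)` entry is the partial derivative of `f` with respect to
the entry `X a i`. -/
def matrixGradient {n p : ℕ} (f : Matrix (Fin n) (Fin p) ℝ → ℝ)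
    (X : Matrix (Fin n) (Fin p) ℝ) : Matrix (Fin n) (Fin p) ℝ :=
  Matrix.of fun a i => deriv (fun t : ℝ => f (X + t • Matrix.single a i (1 : ℝ))) 0

theorem gram_isHermitian {n p : ℕ} (X : Matrix (Fin n) (Fin p) ℝ) : (Xᵀ * X).IsHermitian := by
  simpa [Matrix.conjTranspose_eq_transpose_of_trivial] using
    Matrix.isHermitian_conjTranspose_mul_self X

/-- The eigenvalues of `Xᵀ X`, with multiplicity, in decreasing order. -/
def gramEigenvalue {n p : ℕ} (X : Matrix (Fin n) (Fin p) ℝ) (k : Fin p) : ℝ :=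
  (gram_isHermitian X).eigenvalues₀ (Fin.cast (Fintype.card_fin p).symm k)

/-- `X = U diag(σ) Vᵀ` is a (thin) singular value decomposition of `X`, with the singular values
in decreasing order. -/
structure IsSVD {n p : ℕ} (X U : Matrix (Fin n) (Fin p) ℝ) (σ : Fin p → ℝ)
    (V : Matrix (Fin p) (Fin p) ℝ) : Prop where
  left_orthonormal : Uᵀ * U = 1
  right_orthonormal : Vᵀ * V = 1
  antitone : Antitone σ
  nonneg : ∀ k, 0 ≤ σ k
  factorization : X = U * Matrix.diagonal σ * Vᵀ

/-- The singular value shrinkage of a matrix with singular value decomposition `(U, σ, V)`. -/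
def svShrink {n p : ℕ} (c : Fin p → ℝ) (U : Matrix (Fin n) (Fin p) ℝ) (σ : Fin p → ℝ)
    (V : Matrix (Fin p) (Fin p) ℝ) : Matrix (Fin n) (Fin p) ℝ :=
  U * Matrix.diagonal (fun k => σ k - c k / σ k) * Vᵀ

/-- `h(X) = -1/2 * ∑ k, c k * log (λ k)`. -/
def shrinkPotential {n p : ℕ} (c : Fin p → ℝ) (X : Matrix (Fin n) (Fin p) ℝ) : ℝ :=
  -(1 / 2) * ∑ k, c k * Real.log (gramEigenvalue X k)

/-- The diagonal matrix `D` of the risk formula, as a function of the eigenvalues `l`. -/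
def riskDiagonal {p : ℕ} (n : ℕ) (c l : Fin p → ℝ) : Matrix (Fin p) (Fin p) ℝ :=
  Matrix.diagonal fun k =>
    1 / l k * c k * (c k - 2 * n + 4) -
      2 / l k * ∑ j ∈ Finset.univ.erase k, (c k * l j - c j * l k) / (l k - l j)

/-- The entries of `X` are independent, the `(a, i)` entry being `N(M a i, 1)`. -/
def IsNormalMatrix {Ω : Type*} [MeasurableSpace Ω] {n p : ℕ} (P : Measure Ω)
    (M : Matrix (Fin n) (Fin p) ℝ) (X : Ω → Matrix (Fin n) (Fin p) ℝ) : Prop :=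
  (∀ a i, HasLaw (fun ω => X ω a i) (gaussianReal (M a i) 1) P) ∧
    iIndepFun (fun (q : Fin n × Fin p) ω => X ω q.1 q.2) P

/-- The matrix quadratic loss `(A - M)ᵀ (A - M)`. -/
def quadraticLoss {n p : ℕ} (M A : Matrix (Fin n) (Fin p) ℝ) : Matrix (Fin p) (Fin p) ℝ :=
  (A - M)ᵀ * (A - M)

/-- All entries of a random matrix are integrable. -/
def MatrixIntegrable {Ω : Type*} [MeasurableSpace Ω] {p : ℕ} (P : Measure Ω)
    (A : Ω → Matrix (Fin p) (Fin p) ℝ) : Prop :=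
  ∀ i j, Integrable (fun ω => A ω i j) P

/-- The entrywise expectation of a random matrix. -/
def matrixExpectation {Ω : Type*} [MeasurableSpace Ω] {p : ℕ} (P : Measure Ω)
    (A : Ω → Matrix (Fin p) (Fin p) ℝ) : Matrix (Fin p) (Fin p) ℝ :=
  Matrix.of fun i j => ∫ ω, A ω i j ∂P

end

/-! Write `Xᵀ * X = ∑ λ_k P_k` with spectral projections `P_k`. Where the eigenvalues are distinct
and positive, `Mhat = X - F` with `F = X ∑ (c_k / λ_k) P_k`, an expression free of the chosen SVD.
First-order perturbation theory gives `∂λ_k/∂X_{ai} = 2 (X P_k)_{ai}` (`hasDerivAt_gramEigenvalue`),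
hence `F = -∇h`. With the derivative of `P_k` (`hasDerivAt_gramProjection`) it also gives the matrix
divergence `∑_a ∂F_{aj}/∂X_{ai} = (∑ d_k P_k)_{ij}`, where `d_k` is `driftCoeff`
(`GramRegular.sum_shrinkFieldDeriv`).

Expanding the loss leaves `(X-M)ᵀ(X-M)`, with mean `n I`; `FᵀF = ∑ (c_k² / λ_k) P_k`; and two cross
terms. Stein's identity turns each cross term into `E ∑ d_k P_k`, and `D_kk = c_k² / λ_k - 2 d_k` is
algebra (`riskDiagonal_eq`).

The difficulty is that `F` is singular where eigenvalues collide or vanish. This set is null, being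
the zero set of a nonzero polynomial (`ae_gramRegular`), but neither Stein's identity nor
integrability follows from that alone. Therefore `F` is multiplied by a cutoff `s(b/ε)`, where the
barrier `b` vanishes exactly on the bad set and tends to zero at infinity. The cutoff field has
compact support, and the identity acquires an error carrying `q s'(q)`, `q = b/ε`, a factor bounded
uniformly in `ε` (`integral_cutoff_stein`).

Integrability is obtained from the same identity. For decreasing nonnegative `c` the traced error is
bounded below, and Young's inequality absorbs the cross term into the drift, so truncated drift
expectations are bounded and Fatou applies (`integrable_sum_driftCoeff`). The weights `p-1, …, 1, 0`
make every `1 / (λ_i - λ_j)` integrable, even for `n = p`; constant weights make `1 / λ_k`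
integrable for `n ≥ p + 2`. Arbitrary `c` then follows by dominated convergence as `ε → 0`
(`integral_cross`). -/

/-! ### Ordered eigenvalues of the Gram matrix -/

theorem gramEigenvalue_antitone {n p : ℕ} (X : Matrix (Fin n) (Fin p) ℝ) :
    Antitone (gramEigenvalue X) := fun _ _ h =>
  (gram_isHermitian X).eigenvalues₀_antitone h

/-- A sorted tuple is recovered from its multiset of values, and the polynomial records that
multiset as its roots. Every later identification of eigenvalues thus reduces to a characteristic
polynomial. -/
theorem antitone_eq_of_prod_X_sub_C_eq {p : ℕ} {f g : Fin p → ℝ} (hf : Antitone f)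
    (hg : Antitone g)
    (h : ∏ k, (Polynomial.X - Polynomial.C (f k)) = ∏ k, (Polynomial.X - Polynomial.C (g k))) :
    f = g := by
  have key : ∀ f : Fin p → ℝ, (∏ k, (Polynomial.X - Polynomial.C (f k))).roots
      = (List.ofFn f : Multiset ℝ) := by
    intro f
    rw [Polynomial.roots_prod]
    · simp [Fin.univ_val_map]
    · simp [Finset.prod_ne_zero_iff, Polynomial.X_sub_C_ne_zero]
  have h1 := key f
  rw [h, key g, Multiset.coe_eq_coe] at h1
  exact List.ofFn_injective (List.Perm.eq_of_sortedGE hf.sortedGE_ofFn hg.sortedGE_ofFn h1.symm)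

theorem gram_charpoly {n p : ℕ} (X : Matrix (Fin n) (Fin p) ℝ) :
    (Xᵀ * X).charpoly = ∏ k, (Polynomial.X - Polynomial.C (gramEigenvalue X k)) := by
  rw [(gram_isHermitian X).charpoly_eq]
  refine Fintype.prod_equiv
    ((Fintype.equivOfCardEq (Fintype.card_fin _)).symm.trans (finCongr (Fintype.card_fin p))) _ _ ?_
  intro i
  rfl

theorem gramEigenvalue_eq_of_charpoly {n p : ℕ} {X : Matrix (Fin n) (Fin p) ℝ} {f : Fin p → ℝ}
    (hf : Antitone f)
    (h : (Xᵀ * X).charpoly = ∏ k, (Polynomial.X - Polynomial.C (f k))) :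
    gramEigenvalue X = f :=
  antitone_eq_of_prod_X_sub_C_eq (gramEigenvalue_antitone X) hf (by rw [← gram_charpoly, h])

theorem charpoly_conj_diagonal {p : ℕ} {V : Matrix (Fin p) (Fin p) ℝ} (hV : Vᵀ * V = 1)
    (d : Fin p → ℝ) :
    (V * Matrix.diagonal d * Vᵀ).charpoly = ∏ k, (Polynomial.X - Polynomial.C (d k)) := by
  rw [Matrix.charpoly_mul_comm, ← mul_assoc, hV, one_mul, Matrix.charpoly_diagonal]

theorem IsSVD.gram_eq {n p : ℕ} {X U : Matrix (Fin n) (Fin p) ℝ} {σ : Fin p → ℝ}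
    {V : Matrix (Fin p) (Fin p) ℝ} (h : IsSVD X U σ V) :
    Xᵀ * X = V * Matrix.diagonal (fun k => σ k ^ 2) * Vᵀ := by
  have : Xᵀ = V * Matrix.diagonal σ * Uᵀ := by
    rw [h.factorization]; simp [Matrix.transpose_mul, Matrix.mul_assoc]
  rw [this]
  nth_rw 1 [h.factorization]
  calc V * Matrix.diagonal σ * Uᵀ * (U * Matrix.diagonal σ * Vᵀ)
      = V * (Matrix.diagonal σ * (Uᵀ * U) * Matrix.diagonal σ) * Vᵀ := by
        simp only [Matrix.mul_assoc]
    _ = _ := by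
        rw [h.left_orthonormal]
        simp [Matrix.diagonal_mul_diagonal, pow_two]

theorem IsSVD.gramEigenvalue_eq {n p : ℕ} {X U : Matrix (Fin n) (Fin p) ℝ} {σ : Fin p → ℝ}
    {V : Matrix (Fin p) (Fin p) ℝ} (h : IsSVD X U σ V) (k : Fin p) :
    gramEigenvalue X k = σ k ^ 2 := by
  have := gramEigenvalue_eq_of_charpoly (X := X) (f := fun k => σ k ^ 2)
    (fun i j hij => pow_le_pow_left₀ (h.nonneg j) (h.antitone hij) 2)
    (by rw [h.gram_eq, charpoly_conj_diagonal h.right_orthonormal])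
  rw [this]

theorem gramEigenvalue_orthogonal_mul {n p : ℕ} {Q : Matrix (Fin n) (Fin n) ℝ}
    (hQ : Q ∈ Matrix.orthogonalGroup (Fin n) ℝ) {R : Matrix (Fin p) (Fin p) ℝ}
    (hR : R ∈ Matrix.orthogonalGroup (Fin p) ℝ) (X : Matrix (Fin n) (Fin p) ℝ) :
    gramEigenvalue (Q * X * R) = gramEigenvalue X := by
  refine gramEigenvalue_eq_of_charpoly (gramEigenvalue_antitone X) ?_
  have hQ' : Qᵀ * Q = 1 := (Matrix.mem_orthogonalGroup_iff' _ _).1 hQ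
  have hR' : R * Rᵀ = 1 := (Matrix.mem_orthogonalGroup_iff _ _).1 hR
  have : (Q * X * R)ᵀ * (Q * X * R) = Rᵀ * (Xᵀ * (Qᵀ * Q) * X * R) := by
    simp only [Matrix.transpose_mul, Matrix.mul_assoc]
  rw [this, hQ', Matrix.charpoly_mul_comm, Matrix.mul_one,
    Matrix.mul_assoc _ R, hR', Matrix.mul_one, gram_charpoly]

theorem exists_gram_diagonalization {n p : ℕ} (X : Matrix (Fin n) (Fin p) ℝ) :
    ∃ V : Matrix (Fin p) (Fin p) ℝ, Vᵀ * V = 1 ∧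
      Xᵀ * X = V * Matrix.diagonal (gramEigenvalue X) * Vᵀ := by
  have hA := gram_isHermitian X
  -- The eigenvectors are indexed through an unspecified equivalence of `Fin p` with itself, whereas
  -- `gramEigenvalue` is sorted; permuting the columns by `e` reconciles the two.
  set e : Fin p ≃ Fin p :=
    ((Fintype.equivOfCardEq (Fintype.card_fin _)).symm.trans (finCongr (Fintype.card_fin p)))
    with he
  have hev : ∀ i, hA.eigenvalues i = gramEigenvalue X (e i) := fun i => rfl
  set V₀ : Matrix (Fin p) (Fin p) ℝ := (hA.eigenvectorUnitary : Matrix (Fin p) (Fin p) ℝ) with hV₀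
  have h1 : V₀ᵀ * V₀ = 1 := by
    have := (Matrix.mem_unitaryGroup_iff'.1 hA.eigenvectorUnitary.2)
    simpa [Matrix.star_eq_conjTranspose] using this
  have h2 : Xᵀ * X = V₀ * Matrix.diagonal hA.eigenvalues * V₀ᵀ := by
    have := hA.spectral_theorem
    rw [Unitary.conjStarAlgAut_apply] at this
    simpa [Matrix.star_eq_conjTranspose] using this
  refine ⟨V₀.submatrix id e.symm, ?_, ?_⟩
  · rw [Matrix.transpose_submatrix, ← Matrix.submatrix_mul _ _ _ id _ Function.bijective_id, h1]
    simp
  · rw [h2]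
    have : Matrix.diagonal (gramEigenvalue X)
        = (Matrix.diagonal hA.eigenvalues).submatrix e.symm e.symm := by
      rw [Matrix.submatrix_diagonal_equiv]
      congr 1
      ext k
      simp [hev]
    rw [this, Matrix.transpose_submatrix, ← Matrix.submatrix_mul _ _ _ _ _ e.symm.bijective,
      ← Matrix.submatrix_mul _ _ _ _ _ e.symm.bijective]
    simp

theorem gramEigenvalue_nonneg {n p : ℕ} (X : Matrix (Fin n) (Fin p) ℝ) (k : Fin p) :
    0 ≤ gramEigenvalue X k := by
  have hpsd : (Xᵀ * X).PosSemidef := by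
    simpa [Matrix.conjTranspose_eq_transpose_of_trivial] using
      Matrix.posSemidef_conjTranspose_mul_self X
  have := hpsd.eigenvalues_nonneg (Fintype.equivOfCardEq (Fintype.card_fin _)
    (Fin.cast (Fintype.card_fin p).symm k))
  simpa [Matrix.IsHermitian.eigenvalues, gramEigenvalue] using this

theorem sum_gramEigenvalue {n p : ℕ} (X : Matrix (Fin n) (Fin p) ℝ) :
    ∑ k, gramEigenvalue X k = ∑ a, ∑ i, X a i ^ 2 := by
  obtain ⟨V, hV, hX⟩ := exists_gram_diagonalization X
  have h1 : (Xᵀ * X).trace = ∑ k, gramEigenvalue X k := by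
    rw [hX, Matrix.trace_mul_comm, ← mul_assoc, hV, one_mul, Matrix.trace_diagonal]
  rw [← h1, Finset.sum_comm]
  simp [Matrix.trace, Matrix.mul_apply, pow_two]

/-! ### Continuity of the ordered eigenvalues -/

theorem continuous_gram {n p : ℕ} :
    Continuous fun X : Matrix (Fin n) (Fin p) ℝ => Xᵀ * X :=
  continuous_id.matrix_transpose.matrix_mul continuous_id

theorem eval_prod_gramEigenvalue {n p : ℕ} (X : Matrix (Fin n) (Fin p) ℝ) (x : ℝ) :
    ∏ k, (x - gramEigenvalue X k) = (x • (1 : Matrix (Fin p) (Fin p) ℝ) - Xᵀ * X).det := by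
  have := congrArg (Polynomial.eval x) (gram_charpoly X)
  rw [Matrix.eval_charpoly, Polynomial.eval_prod] at this
  simp only [Polynomial.eval_sub, Polynomial.eval_X, Polynomial.eval_C] at this
  rw [← this, Matrix.scalar_apply, Matrix.smul_one_eq_diagonal]

/-- Compactness argument: near `X` the eigenvalues stay in a box, and any cluster point is a sorted
tuple whose monic polynomial is the characteristic polynomial at `X`. Such a tuple is unique. -/
theorem continuous_gramEigenvalue {n p : ℕ} :
    Continuous fun X : Matrix (Fin n) (Fin p) ℝ => gramEigenvalue X := by
  rw [continuous_iff_continuousAt]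
  intro X
  set B : ℝ := (∑ a, ∑ i, X a i ^ 2) + 1 with hB
  have hcont : Continuous fun Y : Matrix (Fin n) (Fin p) ℝ => ∑ a, ∑ i, Y a i ^ 2 := by
    refine continuous_finsetSum _ fun a _ => continuous_finsetSum _ fun i _ => ?_
    exact (continuous_id.matrix_elem a i).pow 2
  -- Each eigenvalue is at most the trace, which is the sum of squared entries and hence locally
  -- bounded.
  have hev : ∀ᶠ Y in nhds X, gramEigenvalue Y ∈ Set.Icc (0 : Fin p → ℝ) (fun _ => B) := by
    have : ∀ᶠ Y in nhds X, (∑ a, ∑ i, Y a i ^ 2) < B :=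
      hcont.continuousAt.eventually_lt continuousAt_const (by simp [hB])
    filter_upwards [this] with Y hY
    refine ⟨fun k => gramEigenvalue_nonneg Y k, fun k => ?_⟩
    refine le_trans ?_ hY.le
    rw [← sum_gramEigenvalue]
    exact Finset.single_le_sum (f := gramEigenvalue Y) (fun i _ => gramEigenvalue_nonneg Y i)
      (Finset.mem_univ k)
  refine isCompact_Icc.tendsto_nhds_of_unique_mapClusterPt hev ?_
  intro f _ hf
  obtain ⟨U, hU, hUf⟩ := mapClusterPt_iff_ultrafilter.1 hf
  have hUid : Filter.Tendsto (fun Y : Matrix (Fin n) (Fin p) ℝ => Y) (U : Filter (Matrix (Fin n) (Fin p) ℝ)) (nhds X) := hU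
  have hfk : ∀ k, Filter.Tendsto (fun Y => gramEigenvalue Y k) (U : Filter (Matrix (Fin n) (Fin p) ℝ)) (nhds (f k)) :=
    fun k => (tendsto_pi_nhds.1 hUf) k
  have hanti : Antitone f := fun i j hij =>
    le_of_tendsto_of_tendsto' (hfk j) (hfk i) fun Y => gramEigenvalue_antitone Y hij
  refine (antitone_eq_of_prod_X_sub_C_eq hanti (gramEigenvalue_antitone X) ?_)
  refine Polynomial.funext fun x => ?_
  simp only [Polynomial.eval_prod, Polynomial.eval_sub, Polynomial.eval_X, Polynomial.eval_C]
  have h1 : Filter.Tendsto (fun Y => ∏ k, (x - gramEigenvalue Y k)) (U : Filter (Matrix (Fin n) (Fin p) ℝ))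
      (nhds (∏ k, (x - f k))) :=
    tendsto_finsetProd _ fun k _ => tendsto_const_nhds.sub (hfk k)
  have h2 : Filter.Tendsto (fun Y => ∏ k, (x - gramEigenvalue Y k)) (U : Filter (Matrix (Fin n) (Fin p) ℝ))
      (nhds (∏ k, (x - gramEigenvalue X k))) := by
    simp only [eval_prod_gramEigenvalue]
    have : Continuous fun Y : Matrix (Fin n) (Fin p) ℝ =>
        (x • (1 : Matrix (Fin p) (Fin p) ℝ) - Yᵀ * Y).det :=
      (continuous_const.sub continuous_gram).matrix_det
    exact (this.tendsto X).comp hUid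
  exact tendsto_nhds_unique h1 h2

theorem shrinkPotential_orthogonal_mul {n p : ℕ} (c : Fin p → ℝ) {Q : Matrix (Fin n) (Fin n) ℝ}
    (hQ : Q ∈ Matrix.orthogonalGroup (Fin n) ℝ) {R : Matrix (Fin p) (Fin p) ℝ}
    (hR : R ∈ Matrix.orthogonalGroup (Fin p) ℝ) (X : Matrix (Fin n) (Fin p) ℝ) :
    shrinkPotential c (Q * X * R) = shrinkPotential c X := by
  simp only [shrinkPotential, gramEigenvalue_orthogonal_mul hQ hR]

/-! ### Spectral projections -/

/-- The orthogonal projection onto the eigenspace of the `k`-th eigenvalue of `Xᵀ X`, when that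
eigenvalue is simple. -/
noncomputable def gramProjection {n p : ℕ} (X : Matrix (Fin n) (Fin p) ℝ) (k : Fin p) :
    Matrix (Fin p) (Fin p) ℝ :=
  (∏ j ∈ Finset.univ.erase k, (gramEigenvalue X k - gramEigenvalue X j))⁻¹ •
    (gramEigenvalue X k • (1 : Matrix (Fin p) (Fin p) ℝ) - Xᵀ * X).adjugate

/-- The adjugate of `V` is `det V • Vᵀ`, and the two determinant factors cancel because `(det V)² =
1`. The adjugate form of the projections matters because it avoids choosing eigenvectors, so
continuity and measurability can be read off. -/
theorem adjugate_conj_orthogonal {p : ℕ} {V : Matrix (Fin p) (Fin p) ℝ} (hV : Vᵀ * V = 1)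
    (A : Matrix (Fin p) (Fin p) ℝ) :
    (V * A * Vᵀ).adjugate = V * A.adjugate * Vᵀ := by
  have hV' : V * Vᵀ = 1 := mul_eq_one_comm.1 hV
  have hdet : V.det * V.det = 1 := by
    have := congrArg Matrix.det hV
    simpa [Matrix.det_mul] using this
  have h1 : V.adjugate = V.det • Vᵀ := by
    calc V.adjugate = V.adjugate * (V * Vᵀ) := by rw [hV', mul_one]
      _ = _ := by rw [← mul_assoc, Matrix.adjugate_mul]; simp
  rw [Matrix.adjugate_mul_distrib, Matrix.adjugate_mul_distrib, ← Matrix.adjugate_transpose, h1]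
  simp [smul_smul, hdet, mul_assoc]

section Projection

variable {n p : ℕ} {X : Matrix (Fin n) (Fin p) ℝ}

theorem gramProjection_eq {V : Matrix (Fin p) (Fin p) ℝ} (hV : Vᵀ * V = 1)
    (hX : Xᵀ * X = V * Matrix.diagonal (gramEigenvalue X) * Vᵀ)
    (hinj : Function.Injective (gramEigenvalue X)) (k : Fin p) :
    gramProjection X k = V * Matrix.diagonal (Pi.single k 1) * Vᵀ := by
  have hV' : V * Vᵀ = 1 := mul_eq_one_comm.1 hV
  have h1 : gramEigenvalue X k • (1 : Matrix (Fin p) (Fin p) ℝ) - Xᵀ * X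
      = V * Matrix.diagonal (fun j => gramEigenvalue X k - gramEigenvalue X j) * Vᵀ := by
    rw [← Matrix.diagonal_sub, Matrix.mul_sub, Matrix.sub_mul, ← hX,
      ← Matrix.smul_one_eq_diagonal]
    simp [hV']
  have hne : (∏ j ∈ Finset.univ.erase k, (gramEigenvalue X k - gramEigenvalue X j)) ≠ 0 := by
    refine Finset.prod_ne_zero_iff.2 fun j hj => sub_ne_zero.2 fun h => ?_
    exact (Finset.ne_of_mem_erase hj) (hinj h).symm
  rw [gramProjection, h1, adjugate_conj_orthogonal hV, Matrix.adjugate_diagonal]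
  -- For `i ≠ k` the product over `j ≠ i` contains the zero factor `j = k`; only the entry at `k`
  -- survives.
  have h2 : (Matrix.diagonal fun i => ∏ j ∈ Finset.univ.erase i,
      (gramEigenvalue X k - gramEigenvalue X j))
      = (∏ j ∈ Finset.univ.erase k, (gramEigenvalue X k - gramEigenvalue X j)) •
        Matrix.diagonal (Pi.single k (1 : ℝ)) := by
    rw [← Matrix.diagonal_smul]
    congr 1
    ext i
    by_cases hik : i = k
    · subst hik; simp
    · simp only [Pi.smul_apply, Pi.single_eq_of_ne hik, smul_zero]
      exact Finset.prod_eq_zero (Finset.mem_erase.2 ⟨Ne.symm hik, Finset.mem_univ k⟩)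
        (sub_self _)
  rw [h2, Matrix.mul_smul, Matrix.smul_mul, smul_smul, inv_mul_cancel₀ hne, one_smul]

theorem sum_smul_gramProjection {V : Matrix (Fin p) (Fin p) ℝ} (hV : Vᵀ * V = 1)
    (hX : Xᵀ * X = V * Matrix.diagonal (gramEigenvalue X) * Vᵀ)
    (hinj : Function.Injective (gramEigenvalue X)) (d : Fin p → ℝ) :
    ∑ k, d k • gramProjection X k = V * Matrix.diagonal d * Vᵀ := by
  have : Matrix.diagonal d = ∑ k, d k • Matrix.diagonal (Pi.single k (1 : ℝ)) := by
    ext i j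
    simp only [Matrix.sum_apply, Matrix.smul_apply, Matrix.diagonal_apply]
    by_cases h : i = j
    · subst h; simp [Pi.single_apply]
    · simp [h]
  rw [this, Matrix.mul_sum, Matrix.sum_mul]
  refine Finset.sum_congr rfl fun k _ => ?_
  rw [gramProjection_eq hV hX hinj, Matrix.mul_smul, Matrix.smul_mul]

theorem gramProjection_mul (hinj : Function.Injective (gramEigenvalue X)) (k l : Fin p) :
    gramProjection X k * gramProjection X l = if k = l then gramProjection X k else 0 := by
  obtain ⟨V, hV, hX⟩ := exists_gram_diagonalization X
  rw [gramProjection_eq hV hX hinj, gramProjection_eq hV hX hinj]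
  have : V * Matrix.diagonal (Pi.single k 1) * Vᵀ * (V * Matrix.diagonal (Pi.single l 1) * Vᵀ)
      = V * (Matrix.diagonal (Pi.single k 1) * (Vᵀ * V) * Matrix.diagonal (Pi.single l 1)) * Vᵀ := by
    simp only [Matrix.mul_assoc]
  rw [this, hV, Matrix.mul_one, Matrix.diagonal_mul_diagonal]
  by_cases h : k = l
  · subst h
    simp only [if_true]
    congr 3
    ext i
    by_cases hi : i = k
    · subst hi; simp
    · simp [hi]
  · rw [if_neg h]
    have : (fun i => (Pi.single k (1 : ℝ) : Fin p → ℝ) i * (Pi.single l (1 : ℝ) : Fin p → ℝ) i)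
        = 0 := by
      ext i
      by_cases hi : i = k
      · subst hi; simp [h]
      · simp [hi]
    rw [this]
    simp

theorem sum_gramProjection (hinj : Function.Injective (gramEigenvalue X)) :
    ∑ k, gramProjection X k = 1 := by
  obtain ⟨V, hV, hX⟩ := exists_gram_diagonalization X
  have := sum_smul_gramProjection hV hX hinj (fun _ => 1)
  simp only [one_smul, Matrix.diagonal_one, Matrix.mul_one] at this
  rw [this, mul_eq_one_comm.1 hV]

theorem gram_eq_sum (hinj : Function.Injective (gramEigenvalue X)) :
    Xᵀ * X = ∑ k, gramEigenvalue X k • gramProjection X k := by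
  obtain ⟨V, hV, hX⟩ := exists_gram_diagonalization X
  rw [sum_smul_gramProjection hV hX hinj, ← hX]

theorem gram_mul_gramProjection (hinj : Function.Injective (gramEigenvalue X)) (k : Fin p) :
    Xᵀ * X * gramProjection X k = gramEigenvalue X k • gramProjection X k := by
  rw [gram_eq_sum hinj, Finset.sum_mul]
  simp [gramProjection_mul hinj]

theorem gramProjection_mul_gram (hinj : Function.Injective (gramEigenvalue X)) (k : Fin p) :
    gramProjection X k * (Xᵀ * X) = gramEigenvalue X k • gramProjection X k := by
  rw [gram_eq_sum hinj, Finset.mul_sum]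
  simp [gramProjection_mul hinj]

theorem gramProjection_apply {V : Matrix (Fin p) (Fin p) ℝ} (hV : Vᵀ * V = 1)
    (hX : Xᵀ * X = V * Matrix.diagonal (gramEigenvalue X) * Vᵀ)
    (hinj : Function.Injective (gramEigenvalue X)) (k i j : Fin p) :
    gramProjection X k i j = V i k * V j k := by
  rw [gramProjection_eq hV hX hinj, Matrix.mul_apply]
  simp [Matrix.mul_diagonal, Pi.single_apply]

theorem transpose_gramProjection (hinj : Function.Injective (gramEigenvalue X)) (k : Fin p) :
    (gramProjection X k)ᵀ = gramProjection X k := by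
  obtain ⟨V, hV, hX⟩ := exists_gram_diagonalization X
  ext i j
  rw [Matrix.transpose_apply, gramProjection_apply hV hX hinj, gramProjection_apply hV hX hinj,
    mul_comm]

theorem trace_gramProjection (hinj : Function.Injective (gramEigenvalue X)) (k : Fin p) :
    (gramProjection X k).trace = 1 := by
  obtain ⟨V, hV, hX⟩ := exists_gram_diagonalization X
  rw [gramProjection_eq hV hX hinj, Matrix.trace_mul_comm, ← mul_assoc, hV, one_mul,
    Matrix.trace_diagonal]
  simp

/-- The projection has rank one, `P = v vᵀ`, so `P A P = (vᵀ A v) P`. -/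
theorem gramProjection_conj (hinj : Function.Injective (gramEigenvalue X)) (k : Fin p)
    (A : Matrix (Fin p) (Fin p) ℝ) :
    gramProjection X k * A * gramProjection X k
      = (gramProjection X k * A).trace • gramProjection X k := by
  obtain ⟨V, hV, hX⟩ := exists_gram_diagonalization X
  ext i j
  simp only [Matrix.mul_apply, gramProjection_apply hV hX hinj, Matrix.trace, Matrix.diag,
    Matrix.smul_apply, smul_eq_mul, Finset.sum_mul]
  refine Finset.sum_congr rfl fun l _ => Finset.sum_congr rfl fun m _ => ?_
  ring

/-- The entries are products of two coordinates of a unit vector. Integrability of a spectral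
function therefore only concerns its scalar coefficients. -/
theorem abs_gramProjection_le_one (hinj : Function.Injective (gramEigenvalue X)) (k i j : Fin p) :
    |gramProjection X k i j| ≤ 1 := by
  obtain ⟨V, hV, hX⟩ := exists_gram_diagonalization X
  rw [gramProjection_apply hV hX hinj]
  have h : ∀ i, V i k ^ 2 ≤ 1 := by
    intro i
    have h1 : (Vᵀ * V) k k = 1 := by rw [hV]; simp
    rw [Matrix.mul_apply] at h1
    rw [← h1, pow_two]
    exact Finset.single_le_sum (f := fun i => Vᵀ k i * V i k)
      (fun i _ => by simpa using mul_self_nonneg (V i k)) (Finset.mem_univ i)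
  rw [abs_le]
  constructor <;> nlinarith [h i, h j, sq_nonneg (V i k - V j k), sq_nonneg (V i k + V j k)]

theorem continuousAt_gramEigenvalue (X : Matrix (Fin n) (Fin p) ℝ) (k : Fin p) :
    ContinuousAt (fun Y : Matrix (Fin n) (Fin p) ℝ => gramEigenvalue Y k) X :=
  ((continuous_apply k).comp continuous_gramEigenvalue).continuousAt

theorem continuousAt_gramProjection (hinj : Function.Injective (gramEigenvalue X)) (k : Fin p) :
    ContinuousAt (fun Y : Matrix (Fin n) (Fin p) ℝ => gramProjection Y k) X := by
  have hc : ∀ k, Continuous (fun Y : Matrix (Fin n) (Fin p) ℝ => gramEigenvalue Y k) :=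
    fun k => (continuous_apply k).comp continuous_gramEigenvalue
  have h1 : ContinuousAt (fun Y : Matrix (Fin n) (Fin p) ℝ =>
      ∏ j ∈ Finset.univ.erase k, (gramEigenvalue Y k - gramEigenvalue Y j)) X :=
    (continuous_finsetProd _ fun j _ => (hc k).sub (hc j)).continuousAt
  have h2 : Continuous (fun Y : Matrix (Fin n) (Fin p) ℝ =>
      (gramEigenvalue Y k • (1 : Matrix (Fin p) (Fin p) ℝ) - Yᵀ * Y).adjugate) :=
    (((hc k).smul continuous_const).sub continuous_gram).matrix_adjugate
  refine (h1.inv₀ ?_).smul h2.continuousAt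
  refine Finset.prod_ne_zero_iff.2 fun j hj => sub_ne_zero.2 fun h => ?_
  exact (Finset.ne_of_mem_erase hj) (hinj h).symm

theorem eventually_injective_gramEigenvalue (hinj : Function.Injective (gramEigenvalue X)) :
    ∀ᶠ Y in nhds X, Function.Injective (gramEigenvalue Y) := by
  have h : ∀ᶠ Y in nhds X, ∀ k l : Fin p, k ≠ l → gramEigenvalue Y k ≠ gramEigenvalue Y l := by
    refine Filter.eventually_all.2 fun k => Filter.eventually_all.2 fun l => ?_
    by_cases hkl : k = l
    · simp [hkl]
    · filter_upwards [((continuousAt_gramEigenvalue X k).sub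
        (continuousAt_gramEigenvalue X l)).eventually_ne
        (sub_ne_zero.2 fun h => hkl (hinj h))] with Y hY _
      exact sub_ne_zero.1 hY
  filter_upwards [h] with Y hY k l hkl
  by_contra hne
  exact hY k l hne hkl

end Projection

/-! ### Perturbation of eigenvalues and projections along a coordinate line -/

/-- The derivative of `Xᵀ X` with respect to the entry `X a i`. -/
def gramDeriv {n p : ℕ} (X : Matrix (Fin n) (Fin p) ℝ) (a : Fin n) (i : Fin p) :
    Matrix (Fin p) (Fin p) ℝ :=
  Xᵀ * Matrix.single a i (1 : ℝ) + (Matrix.single a i (1 : ℝ))ᵀ * X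

section LineDeriv

variable {n p : ℕ} {X : Matrix (Fin n) (Fin p) ℝ}

theorem gram_add_smul_single_sub (X : Matrix (Fin n) (Fin p) ℝ) (a : Fin n) (i : Fin p) (t : ℝ) :
    (X + t • Matrix.single a i (1 : ℝ))ᵀ * (X + t • Matrix.single a i (1 : ℝ)) - Xᵀ * X
      = t • (gramDeriv X a i
        + t • ((Matrix.single a i (1 : ℝ))ᵀ * Matrix.single a i (1 : ℝ))) := by
  simp only [gramDeriv, Matrix.transpose_add, Matrix.transpose_smul, Matrix.add_mul,
    Matrix.mul_add, Matrix.smul_mul, Matrix.mul_smul, smul_add]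
  abel

theorem tendsto_add_smul_single (X : Matrix (Fin n) (Fin p) ℝ) (a : Fin n) (i : Fin p) :
    Filter.Tendsto (fun t : ℝ => X + t • Matrix.single a i (1 : ℝ)) (nhds 0) (nhds X) := by
  have : Continuous (fun t : ℝ => X + t • Matrix.single a i (1 : ℝ)) :=
    continuous_const.add (continuous_id.smul continuous_const)
  simpa using this.tendsto 0

theorem tendsto_gram_slope (X : Matrix (Fin n) (Fin p) ℝ) (a : Fin n) (i : Fin p) :
    Filter.Tendsto (fun t : ℝ => t⁻¹ • ((X + t • Matrix.single a i (1 : ℝ))ᵀ *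
      (X + t • Matrix.single a i (1 : ℝ)) - Xᵀ * X)) (nhdsWithin 0 {0}ᶜ)
      (nhds (gramDeriv X a i)) := by
  have h1 : Continuous (fun t : ℝ => gramDeriv X a i
        + t • ((Matrix.single a i (1 : ℝ))ᵀ * Matrix.single a i (1 : ℝ))) :=
    continuous_const.add (continuous_id.smul continuous_const)
  have h2 := (h1.tendsto 0).mono_left (nhdsWithin_le_nhds (s := {0}ᶜ))
  simp only [zero_smul, add_zero] at h2
  refine h2.congr' ?_
  filter_upwards [self_mem_nhdsWithin] with t ht
  rw [gram_add_smul_single_sub, smul_smul, inv_mul_cancel₀ ht, one_smul]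

/-- The source of all the derivatives: sandwiching the increment of the Gram matrix between an old
and a new projection yields an eigenvalue difference, exactly and without remainder. Continuity of
the projections then suffices to pass to the limit after division by `t`. -/
theorem gramProjection_mul_gram_sub_mul {Y : Matrix (Fin n) (Fin p) ℝ}
    (hX : Function.Injective (gramEigenvalue X)) (hY : Function.Injective (gramEigenvalue Y))
    (k l : Fin p) :
    gramProjection X k * (Yᵀ * Y - Xᵀ * X) * gramProjection Y l
      = (gramEigenvalue Y l - gramEigenvalue X k) •
        (gramProjection X k * gramProjection Y l) := by
  rw [Matrix.mul_sub, Matrix.sub_mul, gramProjection_mul_gram hX, Matrix.mul_assoc,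
    gram_mul_gramProjection hY, Matrix.mul_smul, Matrix.smul_mul, sub_smul]

theorem eventually_injective_line (hinj : Function.Injective (gramEigenvalue X)) (a : Fin n)
    (i : Fin p) : ∀ᶠ t : ℝ in nhds 0,
      Function.Injective (gramEigenvalue (X + t • Matrix.single a i (1 : ℝ))) :=
  (tendsto_add_smul_single X a i).eventually (eventually_injective_gramEigenvalue hinj)

theorem tendsto_gramProjection_line (hinj : Function.Injective (gramEigenvalue X)) (a : Fin n)
    (i k : Fin p) : Filter.Tendsto (fun t : ℝ =>
      gramProjection (X + t • Matrix.single a i (1 : ℝ)) k) (nhdsWithin 0 {0}ᶜ)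
      (nhds (gramProjection X k)) :=
  ((continuousAt_gramProjection hinj k).tendsto.comp (tendsto_add_smul_single X a i)).mono_left
    nhdsWithin_le_nhds

theorem tendsto_gramEigenvalue_line (X : Matrix (Fin n) (Fin p) ℝ) (a : Fin n)
    (i k : Fin p) : Filter.Tendsto (fun t : ℝ =>
      gramEigenvalue (X + t • Matrix.single a i (1 : ℝ)) k) (nhdsWithin 0 {0}ᶜ)
      (nhds (gramEigenvalue X k)) :=
  ((continuousAt_gramEigenvalue X k).tendsto.comp (tendsto_add_smul_single X a i)).mono_left
    nhdsWithin_le_nhds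

theorem tendsto_gramProjection_mul_slope_mul (hinj : Function.Injective (gramEigenvalue X))
    (a : Fin n) (i k l : Fin p) :
    Filter.Tendsto (fun t : ℝ => (t⁻¹ * (gramEigenvalue (X + t • Matrix.single a i (1 : ℝ)) l
        - gramEigenvalue X k)) • (gramProjection X k *
          gramProjection (X + t • Matrix.single a i (1 : ℝ)) l)) (nhdsWithin 0 {0}ᶜ)
      (nhds (gramProjection X k * gramDeriv X a i * gramProjection X l)) := by
  refine Filter.Tendsto.congr' ?_ ((tendsto_const_nhds.mul (tendsto_gram_slope X a i)).mul
    (tendsto_gramProjection_line hinj a i l))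
  filter_upwards [nhdsWithin_le_nhds (eventually_injective_line hinj a i)] with t ht
  rw [mul_smul, ← gramProjection_mul_gram_sub_mul hinj ht, Matrix.mul_smul, Matrix.smul_mul]

/-- For distinct indices the eigenvalue difference in the sandwich identity has a nonzero limit, so
it can be divided out. -/
theorem tendsto_gramProjection_mul_of_ne (hinj : Function.Injective (gramEigenvalue X))
    (a : Fin n) (i : Fin p) {k l : Fin p} (hkl : k ≠ l) :
    Filter.Tendsto (fun t : ℝ => t⁻¹ • (gramProjection X k *
          gramProjection (X + t • Matrix.single a i (1 : ℝ)) l)) (nhdsWithin 0 {0}ᶜ)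
      (nhds ((gramEigenvalue X l - gramEigenvalue X k)⁻¹ •
        (gramProjection X k * gramDeriv X a i * gramProjection X l))) := by
  have hne : gramEigenvalue X l - gramEigenvalue X k ≠ 0 :=
    sub_ne_zero.2 fun h => hkl (hinj h).symm
  have h1 : Filter.Tendsto (fun t : ℝ => gramEigenvalue (X + t • Matrix.single a i (1 : ℝ)) l
      - gramEigenvalue X k) (nhdsWithin 0 {0}ᶜ) (nhds (gramEigenvalue X l - gramEigenvalue X k)) :=
    (tendsto_gramEigenvalue_line X a i l).sub_const _
  refine Filter.Tendsto.congr' ?_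
    ((h1.inv₀ hne).smul (tendsto_gramProjection_mul_slope_mul hinj a i k l))
  filter_upwards [h1.eventually_ne hne] with t ht
  rw [smul_smul]
  congr 1
  field_simp

theorem trace_gramProjection_mul_gramDeriv (hinj : Function.Injective (gramEigenvalue X))
    (a : Fin n) (i k : Fin p) :
    (gramProjection X k * gramDeriv X a i).trace = 2 * (X * gramProjection X k) a i := by
  have h1 : (gramProjection X k * (Xᵀ * Matrix.single a i (1 : ℝ))).trace
      = (X * gramProjection X k) a i := by
    rw [← Matrix.mul_assoc, Matrix.trace_mul_single, ← transpose_gramProjection hinj,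
      ← Matrix.transpose_mul, transpose_gramProjection hinj]
    simp
  have h2 : (gramProjection X k * ((Matrix.single a i (1 : ℝ))ᵀ * X)).trace
      = (X * gramProjection X k) a i := by
    rw [← h1, ← Matrix.trace_transpose, Matrix.transpose_mul, Matrix.transpose_mul,
      transpose_gramProjection hinj, Matrix.trace_mul_comm]
    simp
  rw [gramDeriv, Matrix.mul_add, Matrix.trace_add, h1, h2]
  ring

/-- The sandwich identity with equal indices, after taking traces, gives the difference quotient
times `tr (P_k P_k(t))`. That trace tends to `1`, and dividing by it gives the derivative `tr (P_k
G')`. -/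
theorem hasDerivAt_gramEigenvalue (hinj : Function.Injective (gramEigenvalue X))
    (a : Fin n) (i k : Fin p) :
    HasDerivAt (fun t : ℝ => gramEigenvalue (X + t • Matrix.single a i (1 : ℝ)) k)
      (2 * (X * gramProjection X k) a i) 0 := by
  rw [hasDerivAt_iff_tendsto_slope]
  have hT : Filter.Tendsto (fun t : ℝ => (gramProjection X k *
      gramProjection (X + t • Matrix.single a i (1 : ℝ)) k).trace) (nhdsWithin 0 {0}ᶜ)
      (nhds 1) := by
    have hc : Continuous fun A : Matrix (Fin p) (Fin p) ℝ => A.trace :=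
      continuous_id.matrix_trace
    have := (hc.tendsto _).comp (tendsto_const_nhds.mul (tendsto_gramProjection_line hinj a i k)
      (a := gramProjection X k))
    simpa [gramProjection_mul hinj, trace_gramProjection hinj, Function.comp_def,
      -Matrix.smul_single] using this
  have hS : Filter.Tendsto (fun t : ℝ => (t⁻¹ *
      (gramEigenvalue (X + t • Matrix.single a i (1 : ℝ)) k - gramEigenvalue X k)) *
      (gramProjection X k * gramProjection (X + t • Matrix.single a i (1 : ℝ)) k).trace)
      (nhdsWithin 0 {0}ᶜ) (nhds (2 * (X * gramProjection X k) a i)) := by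
    have hc : Continuous fun A : Matrix (Fin p) (Fin p) ℝ => A.trace :=
      continuous_id.matrix_trace
    have := (hc.tendsto _).comp (tendsto_gramProjection_mul_slope_mul hinj a i k k)
    rw [gramProjection_conj hinj, Matrix.trace_smul, trace_gramProjection hinj,
      trace_gramProjection_mul_gramDeriv hinj] at this
    simpa [Function.comp_def, -Matrix.smul_single] using this
  have := hS.div hT one_ne_zero
  rw [div_one] at this
  refine this.congr' ?_
  filter_upwards [hT.eventually_ne one_ne_zero] with t ht
  simp only [slope_def_field, zero_smul, add_zero, sub_zero, Pi.div_apply]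
  rw [mul_div_assoc, div_self ht, mul_one, inv_mul_eq_div]

/-- Both families of projections sum to the identity, so `P_k(t) - P_k` splits into mixed products
`P_l P_k(t)` and `P_k P_l(t)` with `l ≠ k`, whose quotients by `t` have known limits. -/
theorem hasDerivAt_gramProjection (hinj : Function.Injective (gramEigenvalue X))
    (a : Fin n) (i k m j : Fin p) :
    HasDerivAt (fun t : ℝ => gramProjection (X + t • Matrix.single a i (1 : ℝ)) k m j)
      ((∑ l ∈ Finset.univ.erase k, (gramEigenvalue X k - gramEigenvalue X l)⁻¹ •
        (gramProjection X l * gramDeriv X a i * gramProjection X k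
          + gramProjection X k * gramDeriv X a i * gramProjection X l)) m j) 0 := by
  rw [hasDerivAt_iff_tendsto_slope]
  have h : Filter.Tendsto (fun t : ℝ => ∑ l ∈ Finset.univ.erase k,
      (t⁻¹ • (gramProjection X l * gramProjection (X + t • Matrix.single a i (1 : ℝ)) k)
        - t⁻¹ • (gramProjection X k * gramProjection (X + t • Matrix.single a i (1 : ℝ)) l)))
      (nhdsWithin 0 {0}ᶜ) (nhds (∑ l ∈ Finset.univ.erase k,
        ((gramEigenvalue X k - gramEigenvalue X l)⁻¹ •
        (gramProjection X l * gramDeriv X a i * gramProjection X k) -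
        (gramEigenvalue X l - gramEigenvalue X k)⁻¹ •
         (gramProjection X k * gramDeriv X a i * gramProjection X l)))) := by
    refine tendsto_finsetSum _ fun l hl => ?_
    have hlk := Finset.ne_of_mem_erase hl
    exact (tendsto_gramProjection_mul_of_ne hinj a i hlk).sub
      (tendsto_gramProjection_mul_of_ne hinj a i hlk.symm)
  have heq : (∑ l ∈ Finset.univ.erase k,
        ((gramEigenvalue X k - gramEigenvalue X l)⁻¹ •
        (gramProjection X l * gramDeriv X a i * gramProjection X k) -
        (gramEigenvalue X l - gramEigenvalue X k)⁻¹ •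
         (gramProjection X k * gramDeriv X a i * gramProjection X l)))
      = ∑ l ∈ Finset.univ.erase k, (gramEigenvalue X k - gramEigenvalue X l)⁻¹ •
        (gramProjection X l * gramDeriv X a i * gramProjection X k
          + gramProjection X k * gramDeriv X a i * gramProjection X l) := by
    refine Finset.sum_congr rfl fun l _ => ?_
    rw [← neg_sub (gramEigenvalue X k), inv_neg, neg_smul, sub_neg_eq_add, smul_add]
  rw [heq] at h
  have hc : Continuous fun A : Matrix (Fin p) (Fin p) ℝ => A m j :=
    continuous_id.matrix_elem m j
  refine ((hc.tendsto _).comp h).congr' ?_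
  filter_upwards [nhdsWithin_le_nhds (eventually_injective_line hinj a i)] with t ht
  set Y := X + t • Matrix.single a i (1 : ℝ) with hY
  have key : ∑ l ∈ Finset.univ.erase k, (gramProjection X l * gramProjection Y k
      - gramProjection X k * gramProjection Y l) = gramProjection Y k - gramProjection X k := by
    -- Over all `l` the two sums collapse by resolution of the identity; the omitted term `l = k` is
    -- zero.
    have h1 : ∑ l, (gramProjection X l * gramProjection Y k
      - gramProjection X k * gramProjection Y l) = gramProjection Y k - gramProjection X k := by
      rw [Finset.sum_sub_distrib, ← Finset.sum_mul, ← Finset.mul_sum, sum_gramProjection hinj,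
        sum_gramProjection ht, one_mul, mul_one]
    rw [← h1, ← Finset.add_sum_erase _ _ (Finset.mem_univ k)]
    simp
  have key' : ∑ l ∈ Finset.univ.erase k, (t⁻¹ • (gramProjection X l * gramProjection Y k)
      - t⁻¹ • (gramProjection X k * gramProjection Y l))
      = t⁻¹ • (gramProjection Y k - gramProjection X k) := by
    rw [← key, Finset.smul_sum]
    simp only [smul_sub]
  simp only [Function.comp_apply, slope_def_field, zero_smul, add_zero, sub_zero]
  rw [← hY, key', Matrix.smul_apply, Matrix.sub_apply, smul_eq_mul, inv_mul_eq_div]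

end LineDeriv

/-! ### The shrinkage field, its potential and its divergence -/

/-- The eigenvalues of `Xᵀ X` are distinct and positive. -/
def GramRegular {n p : ℕ} (X : Matrix (Fin n) (Fin p) ℝ) : Prop :=
  Function.Injective (gramEigenvalue X) ∧ ∀ k, 0 < gramEigenvalue X k

/-- The spectral function `∑ k, d k (λ₁, …, λₚ) P k` of `Xᵀ X`. -/
noncomputable def gramSpectral {n p : ℕ} (d : (Fin p → ℝ) → Fin p → ℝ)
    (X : Matrix (Fin n) (Fin p) ℝ) : Matrix (Fin p) (Fin p) ℝ :=
  ∑ k, d (gramEigenvalue X) k • gramProjection X k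

/-- The coefficients of the divergence of `X ↦ X * gramSpectral (c / λ) X`. -/
noncomputable def driftCoeff {p : ℕ} (n : ℕ) (c l : Fin p → ℝ) (k : Fin p) : ℝ :=
  ((n : ℝ) - p - 1) * (c k / l k) + ∑ j ∈ Finset.univ.erase k, (c k - c j) / (l k - l j)

theorem sum_sum_erase_comm {ι M : Type*} [Fintype ι] [DecidableEq ι] [AddCommMonoid M]
    (f : ι → ι → M) :
    ∑ k, ∑ l ∈ Finset.univ.erase k, f k l = ∑ k, ∑ l ∈ Finset.univ.erase k, f l k :=
  Finset.sum_comm' fun x y => by simp [eq_comm]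

/-- Each summand of `D` equals `l_k (c_k - c_j) / (l_k - l_j) - c_k`. The `p - 1` copies of `-c_k`
turn the constant `-2n + 4` into `-2 (n - p - 1)`. -/
theorem riskDiagonal_eq {p : ℕ} (n : ℕ) (c l : Fin p → ℝ) (hinj : Function.Injective l)
    (hpos : ∀ k, 0 < l k) :
    riskDiagonal n c l = Matrix.diagonal fun k => c k ^ 2 / l k - 2 * driftCoeff n c l k := by
  unfold riskDiagonal driftCoeff
  congr 1
  ext k
  have hk := (hpos k).ne'
  have h : ∀ j ∈ Finset.univ.erase k, (c k * l j - c j * l k) / (l k - l j)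
      = l k * ((c k - c j) / (l k - l j)) - c k := by
    intro j hj
    have : l k - l j ≠ 0 := sub_ne_zero.2 fun h => (Finset.ne_of_mem_erase hj) (hinj h).symm
    field_simp
    ring
  rw [Finset.sum_congr rfl h, Finset.sum_sub_distrib, ← Finset.mul_sum, Finset.sum_const,
    Finset.card_erase_of_mem (Finset.mem_univ k), Finset.card_univ, Fintype.card_fin,
    nsmul_eq_mul, Nat.cast_sub (by have := k.2; omega)]
  push_cast
  field_simp
  ring

section Regular

variable {n p : ℕ} {X : Matrix (Fin n) (Fin p) ℝ}

theorem gramSpectral_eq {V : Matrix (Fin p) (Fin p) ℝ} (hV : Vᵀ * V = 1)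
    (hX : Xᵀ * X = V * Matrix.diagonal (gramEigenvalue X) * Vᵀ)
    (hinj : Function.Injective (gramEigenvalue X)) (d : (Fin p → ℝ) → Fin p → ℝ) :
    gramSpectral d X = V * Matrix.diagonal (d (gramEigenvalue X)) * Vᵀ :=
  sum_smul_gramProjection hV hX hinj _

theorem IsSVD.gram_eq_gramEigenvalue {U : Matrix (Fin n) (Fin p) ℝ} {σ : Fin p → ℝ}
    {V : Matrix (Fin p) (Fin p) ℝ} (h : IsSVD X U σ V) :
    Xᵀ * X = V * Matrix.diagonal (gramEigenvalue X) * Vᵀ := by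
  rw [h.gram_eq]
  congr 3
  ext k
  rw [h.gramEigenvalue_eq]

theorem IsSVD.mul_conj_diagonal {U : Matrix (Fin n) (Fin p) ℝ} {σ : Fin p → ℝ}
    {V : Matrix (Fin p) (Fin p) ℝ} (h : IsSVD X U σ V) (d : Fin p → ℝ) :
    X * (V * Matrix.diagonal d * Vᵀ) = U * Matrix.diagonal (fun k => σ k * d k) * Vᵀ := by
  nth_rw 1 [h.factorization]
  calc U * Matrix.diagonal σ * Vᵀ * (V * Matrix.diagonal d * Vᵀ)
      = U * (Matrix.diagonal σ * (Vᵀ * V) * Matrix.diagonal d) * Vᵀ := by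
        simp only [Matrix.mul_assoc]
    _ = _ := by
      rw [h.right_orthonormal, Matrix.mul_one, Matrix.diagonal_mul_diagonal]

theorem IsSVD.svShrink_eq_sub {U : Matrix (Fin n) (Fin p) ℝ} {σ : Fin p → ℝ}
    {V : Matrix (Fin p) (Fin p) ℝ} (h : IsSVD X U σ V) (hpos : ∀ k, 0 < gramEigenvalue X k)
    (c : Fin p → ℝ) :
    svShrink c U σ V
      = X - X * (V * Matrix.diagonal (fun k => c k / gramEigenvalue X k) * Vᵀ) := by
  rw [h.mul_conj_diagonal, svShrink]
  nth_rw 1 [h.factorization]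
  rw [← Matrix.sub_mul, ← Matrix.mul_sub, Matrix.diagonal_sub]
  congr 4
  ext k
  have hk := hpos k
  rw [h.gramEigenvalue_eq] at hk ⊢
  have : σ k ≠ 0 := fun h0 => by simp [h0] at hk
  field_simp

/-- The right side does not mention `U`, `σ` or `V`: on regular matrices the estimator is
independent of the decomposition chosen. -/
theorem GramRegular.svShrink_eq (hX : GramRegular X) {U : Matrix (Fin n) (Fin p) ℝ}
    {σ : Fin p → ℝ} {V : Matrix (Fin p) (Fin p) ℝ} (h : IsSVD X U σ V) (c : Fin p → ℝ) :
    svShrink c U σ V = X - X * gramSpectral (fun l k => c k / l k) X := by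
  rw [h.svShrink_eq_sub hX.2,
    gramSpectral_eq h.right_orthonormal h.gram_eq_gramEigenvalue hX.1]

theorem mul_gramSpectral_apply (d : (Fin p → ℝ) → Fin p → ℝ) (X : Matrix (Fin n) (Fin p) ℝ)
    (a : Fin n) (j : Fin p) :
    (X * gramSpectral d X) a j
      = ∑ k, d (gramEigenvalue X) k * (X * gramProjection X k) a j := by
  rw [gramSpectral, Matrix.mul_sum, Matrix.sum_apply]
  simp

theorem GramRegular.hasDerivAt_shrinkPotential (hX : GramRegular X) (c : Fin p → ℝ) (a : Fin n)
    (i : Fin p) :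
    HasDerivAt (fun t : ℝ => shrinkPotential c (X + t • Matrix.single a i (1 : ℝ)))
      (-(X * gramSpectral (fun l k => c k / l k) X) a i) 0 := by
  have h : HasDerivAt (fun t : ℝ => -(1 / 2) * ∑ k, c k *
      Real.log (gramEigenvalue (X + t • Matrix.single a i (1 : ℝ)) k))
      (-(1 / 2) * ∑ k, c k * ((2 * (X * gramProjection X k) a i) / gramEigenvalue X k)) 0 := by
    refine HasDerivAt.const_mul _ (HasDerivAt.fun_sum fun k _ => HasDerivAt.const_mul _ ?_)
    have := (hasDerivAt_gramEigenvalue hX.1 a i k).log (by simpa using (hX.2 k).ne')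
    simpa using this
  convert h using 1
  · rfl
  rw [mul_gramSpectral_apply, Finset.mul_sum, ← Finset.sum_neg_distrib]
  refine Finset.sum_congr rfl fun k _ => ?_
  ring

theorem GramRegular.hasMatrixPartials_shrinkPotential (hX : GramRegular X) (c : Fin p → ℝ) :
    HasMatrixPartials (shrinkPotential c) X := fun a i =>
  (hX.hasDerivAt_shrinkPotential c a i).differentiableAt

theorem GramRegular.matrixGradient_shrinkPotential (hX : GramRegular X) (c : Fin p → ℝ) :
    matrixGradient (shrinkPotential c) X = -(X * gramSpectral (fun l k => c k / l k) X) := by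
  ext a i
  simpa [matrixGradient] using (hX.hasDerivAt_shrinkPotential c a i).deriv

/-- The derivative of `X ↦ gramSpectral (c / λ) X` with respect to the entry `X a i`. -/
noncomputable def shrinkSpectralDeriv (c : Fin p → ℝ) (X : Matrix (Fin n) (Fin p) ℝ) (a : Fin n)
    (i : Fin p) : Matrix (Fin p) (Fin p) ℝ :=
  ∑ k, ((-(c k * (2 * (X * gramProjection X k) a i) / gramEigenvalue X k ^ 2)) •
      gramProjection X k
    + (c k / gramEigenvalue X k) •
      ∑ l ∈ Finset.univ.erase k, (gramEigenvalue X k - gramEigenvalue X l)⁻¹ •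
        (gramProjection X l * gramDeriv X a i * gramProjection X k
          + gramProjection X k * gramDeriv X a i * gramProjection X l))

theorem GramRegular.hasDerivAt_gramSpectral (hX : GramRegular X) (c : Fin p → ℝ) (a : Fin n)
    (i m j : Fin p) :
    HasDerivAt (fun t : ℝ => gramSpectral (fun l k => c k / l k)
      (X + t • Matrix.single a i (1 : ℝ)) m j) (shrinkSpectralDeriv c X a i m j) 0 := by
  have h : HasDerivAt (fun t : ℝ => ∑ k, (c k /
      gramEigenvalue (X + t • Matrix.single a i (1 : ℝ)) k) *
      gramProjection (X + t • Matrix.single a i (1 : ℝ)) k m j)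
      (∑ k, ((-(c k * (2 * (X * gramProjection X k) a i) / gramEigenvalue X k ^ 2)) *
      gramProjection X k m j
    + (c k / gramEigenvalue X k) *
      (∑ l ∈ Finset.univ.erase k, (gramEigenvalue X k - gramEigenvalue X l)⁻¹ •
        (gramProjection X l * gramDeriv X a i * gramProjection X k
          + gramProjection X k * gramDeriv X a i * gramProjection X l)) m j)) 0 := by
    refine HasDerivAt.fun_sum fun k _ => ?_
    have h1 := (hasDerivAt_const (0 : ℝ) (c k)).fun_div (hasDerivAt_gramEigenvalue hX.1 a i k)
      (by simpa using (hX.2 k).ne')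
    have h2 := h1.fun_mul (hasDerivAt_gramProjection hX.1 a i k m j)
    simpa only [zero_smul, add_zero, zero_mul, zero_sub, neg_div] using h2
  convert h using 1
  · ext t
    rw [gramSpectral, Matrix.sum_apply]
    rfl
  · rw [shrinkSpectralDeriv, Matrix.sum_apply]
    rfl

/-- The derivative of the `(a, j)` entry of `X ↦ X * gramSpectral (c / λ) X` with respect to the
entry `X a i`. -/
noncomputable def shrinkFieldDeriv (c : Fin p → ℝ) (X : Matrix (Fin n) (Fin p) ℝ) (a : Fin n)
    (i j : Fin p) : ℝ :=
  gramSpectral (fun l k => c k / l k) X i j + (X * shrinkSpectralDeriv c X a i) a j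

theorem GramRegular.hasDerivAt_mul_gramSpectral (hX : GramRegular X) (c : Fin p → ℝ) (a : Fin n)
    (i j : Fin p) :
    HasDerivAt (fun t : ℝ => ((X + t • Matrix.single a i (1 : ℝ)) *
      gramSpectral (fun l k => c k / l k) (X + t • Matrix.single a i (1 : ℝ))) a j)
      (shrinkFieldDeriv c X a i j) 0 := by
  have h : HasDerivAt (fun t : ℝ => ∑ m, (X a m + t * Matrix.single a i (1 : ℝ) a m) *
      gramSpectral (fun l k => c k / l k) (X + t • Matrix.single a i (1 : ℝ)) m j)
      (∑ m, (Matrix.single a i (1 : ℝ) a m * gramSpectral (fun l k => c k / l k) X m j +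
        X a m * shrinkSpectralDeriv c X a i m j)) 0 := by
    refine HasDerivAt.fun_sum fun m _ => ?_
    have h1 : HasDerivAt (fun t : ℝ => X a m + t * Matrix.single a i (1 : ℝ) a m)
        (Matrix.single a i (1 : ℝ) a m) 0 := by
      simpa using ((hasDerivAt_id (0 : ℝ)).mul_const (Matrix.single a i (1 : ℝ) a m)).const_add
        (X a m)
    have h2 := h1.fun_mul (hX.hasDerivAt_gramSpectral c a i m j)
    simpa only [zero_smul, add_zero, zero_mul] using h2
  convert h using 1
  · rfl
  rw [Finset.sum_add_distrib, shrinkFieldDeriv, Matrix.mul_apply]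
  congr 1
  simp [Matrix.single_apply]

theorem mul_single_mul_apply {m : ℕ} (A : Matrix (Fin m) (Fin n) ℝ) (B : Matrix (Fin p) (Fin p) ℝ)
    (a : Fin n) (r : Fin m) (i j : Fin p) :
    (A * Matrix.single a i (1 : ℝ) * B) r j = A r a * B i j := by
  simp [Matrix.mul_apply, Matrix.single_apply, ite_and]

/-- The sum over rows is an entry of `P_l Xᵀ X P_k`, and distinct projections annihilate each other.
-/
theorem sum_mul_gramProjection_mul (hinj : Function.Injective (gramEigenvalue X))
    (k l i j : Fin p) :
    ∑ a, (X * gramProjection X l) a i * (X * gramProjection X k) a j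
      = if l = k then gramEigenvalue X k * gramProjection X k i j else 0 := by
  have h : ∑ a, (X * gramProjection X l) a i * (X * gramProjection X k) a j
      = ((X * gramProjection X l)ᵀ * (X * gramProjection X k)) i j := by
    rw [Matrix.mul_apply]
    rfl
  rw [h, Matrix.transpose_mul, transpose_gramProjection hinj, Matrix.mul_assoc,
    ← Matrix.mul_assoc Xᵀ, gram_mul_gramProjection hinj, Matrix.mul_smul, gramProjection_mul hinj]
  by_cases hlk : l = k
  · subst hlk; simp
  · simp [hlk]

/-- The two halves of the Gram derivative behave differently: one produces the trace of `X P_l Xᵀ`,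
which is `λ_l`, and the other the orthogonality relation above. -/
theorem sum_mul_gramProjection_gramDeriv (hinj : Function.Injective (gramEigenvalue X))
    (k l i j : Fin p) :
    ∑ a, (X * (gramProjection X l * gramDeriv X a i * gramProjection X k)) a j
      = gramEigenvalue X l * gramProjection X k i j
        + if l = k then gramEigenvalue X k * gramProjection X k i j else 0 := by
  have h : ∀ a, (X * (gramProjection X l * gramDeriv X a i * gramProjection X k)) a j
      = (X * gramProjection X l * Xᵀ) a a * gramProjection X k i j
        + (X * gramProjection X l) a i * (X * gramProjection X k) a j := by
    intro a
    have h1 : X * (gramProjection X l * gramDeriv X a i * gramProjection X k)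
        = X * gramProjection X l * Xᵀ * Matrix.single a i (1 : ℝ) * gramProjection X k
          + X * gramProjection X l * Matrix.single i a (1 : ℝ) * (X * gramProjection X k) := by
      simp only [gramDeriv, Matrix.mul_add, Matrix.add_mul, Matrix.mul_assoc,
        Matrix.transpose_single]
    have h2 : (X * gramProjection X l * Matrix.single i a (1 : ℝ) * (X * gramProjection X k)) a j
        = (X * gramProjection X l) a i * (X * gramProjection X k) a j := by
      generalize X * gramProjection X l = A
      generalize X * gramProjection X k = B
      simp [Matrix.mul_apply, Matrix.single_apply, ite_and]
    rw [h1, Matrix.add_apply, mul_single_mul_apply, h2]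
  have htr : ∑ a, (X * gramProjection X l * Xᵀ) a a = gramEigenvalue X l := by
    change (X * gramProjection X l * Xᵀ).trace = _
    rw [Matrix.trace_mul_comm, ← Matrix.mul_assoc, gram_mul_gramProjection hinj,
      Matrix.trace_smul, trace_gramProjection hinj]
    simp
  rw [Finset.sum_congr rfl fun a _ => h a, Finset.sum_add_distrib, ← Finset.sum_mul, htr,
    sum_mul_gramProjection_mul hinj]

/-- Collecting the coefficient of `P_k`: differentiating the factor `X` gives `n c_k / λ_k`,
differentiating `1 / λ_k` gives `-2 c_k / λ_k`, and the moving projections give `(c_k - c_l) / (λ_k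
- λ_l) - c_k / λ_k` for each `l ≠ k`. The count `n - 2 - (p - 1)` is the `n - p - 1` of
`driftCoeff`. -/
theorem GramRegular.sum_shrinkFieldDeriv (hX : GramRegular X) (c : Fin p → ℝ) (i j : Fin p) :
    ∑ a, shrinkFieldDeriv c X a i j = gramSpectral (driftCoeff n c) X i j := by
  have hinj := hX.1
  have hterm : ∀ k, ∀ l ∈ Finset.univ.erase k,
      ∑ a, (X * (gramProjection X l * gramDeriv X a i * gramProjection X k
          + gramProjection X k * gramDeriv X a i * gramProjection X l)) a j
      = gramEigenvalue X l * gramProjection X k i j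
        + gramEigenvalue X k * gramProjection X l i j := by
    intro k l hl
    have hlk := Finset.ne_of_mem_erase hl
    simp only [Matrix.mul_add, Matrix.add_apply, Finset.sum_add_distrib]
    rw [sum_mul_gramProjection_gramDeriv hinj, sum_mul_gramProjection_gramDeriv hinj,
      if_neg hlk, if_neg hlk.symm, add_zero, add_zero]
  have h1 : ∑ a, (X * shrinkSpectralDeriv c X a i) a j
      = ∑ k, (-(2 * c k / gramEigenvalue X k) * gramProjection X k i j
        + (c k / gramEigenvalue X k) * ∑ l ∈ Finset.univ.erase k,
          (gramEigenvalue X k - gramEigenvalue X l)⁻¹ *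
            (gramEigenvalue X l * gramProjection X k i j
              + gramEigenvalue X k * gramProjection X l i j)) := by
    simp only [shrinkSpectralDeriv, Matrix.mul_sum, Matrix.sum_apply, Matrix.mul_add,
      Matrix.mul_smul, Matrix.add_apply, Matrix.smul_apply, smul_eq_mul]
    rw [Finset.sum_comm]
    refine Finset.sum_congr rfl fun k _ => ?_
    rw [Finset.sum_add_distrib]
    congr 1
    · have h2 := sum_mul_gramProjection_mul hinj k k i j
      rw [if_pos rfl] at h2
      have hk := (hX.2 k).ne'
      calc ∑ a, -(c k * (2 * (X * gramProjection X k) a i) / gramEigenvalue X k ^ 2) *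
            (X * gramProjection X k) a j
          = -(2 * c k / gramEigenvalue X k ^ 2) *
            ∑ a, (X * gramProjection X k) a i * (X * gramProjection X k) a j := by
            rw [Finset.mul_sum]
            refine Finset.sum_congr rfl fun a _ => ?_
            ring
        _ = _ := by
          rw [h2]
          field_simp
    · rw [← Finset.mul_sum, Finset.sum_comm]
      congr 1
      refine Finset.sum_congr rfl fun l hl => ?_
      rw [← Finset.mul_sum, ← hterm k l hl]
      simp only [Matrix.mul_add, Matrix.add_apply]
  simp only [shrinkFieldDeriv, Finset.sum_add_distrib]
  rw [h1]
  simp only [gramSpectral, Matrix.sum_apply, Matrix.smul_apply, smul_eq_mul, Finset.sum_const,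
    Finset.card_univ, Fintype.card_fin, nsmul_eq_mul, Finset.sum_add_distrib]
  -- The part multiplying `P_l` is relabelled by exchanging `k` and `l`; then `λ_l / (λ_k (λ_k -
  -- λ_l)) = 1 / (λ_k - λ_l) - 1 / λ_k`.
  have h3 : ∑ k, (c k / gramEigenvalue X k) * ∑ l ∈ Finset.univ.erase k,
          (gramEigenvalue X k - gramEigenvalue X l)⁻¹ *
            (gramEigenvalue X l * gramProjection X k i j
              + gramEigenvalue X k * gramProjection X l i j)
      = ∑ k, (∑ l ∈ Finset.univ.erase k, ((c k - c l) / (gramEigenvalue X k - gramEigenvalue X l)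
        - c k / gramEigenvalue X k)) * gramProjection X k i j := by
    have h4 : ∑ k, (c k / gramEigenvalue X k) * ∑ l ∈ Finset.univ.erase k,
          (gramEigenvalue X k - gramEigenvalue X l)⁻¹ *
            (gramEigenvalue X l * gramProjection X k i j
              + gramEigenvalue X k * gramProjection X l i j)
        = ∑ k, ∑ l ∈ Finset.univ.erase k, (c k / gramEigenvalue X k) *
          (gramEigenvalue X k - gramEigenvalue X l)⁻¹ *
            gramEigenvalue X l * gramProjection X k i j
          + ∑ k, ∑ l ∈ Finset.univ.erase k, (c k / gramEigenvalue X k) *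
          (gramEigenvalue X k - gramEigenvalue X l)⁻¹ *
            gramEigenvalue X k * gramProjection X l i j := by
      rw [← Finset.sum_add_distrib]
      refine Finset.sum_congr rfl fun k _ => ?_
      rw [Finset.mul_sum, ← Finset.sum_add_distrib]
      refine Finset.sum_congr rfl fun l _ => ?_
      ring
    rw [h4, sum_sum_erase_comm (fun k l => (c k / gramEigenvalue X k) *
          (gramEigenvalue X k - gramEigenvalue X l)⁻¹ *
            gramEigenvalue X k * gramProjection X l i j), ← Finset.sum_add_distrib]
    refine Finset.sum_congr rfl fun k _ => ?_
    rw [Finset.sum_mul, ← Finset.sum_add_distrib]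
    refine Finset.sum_congr rfl fun l hl => ?_
    have hk := (hX.2 k).ne'
    have hl' := (hX.2 l).ne'
    have hne : gramEigenvalue X k - gramEigenvalue X l ≠ 0 :=
      sub_ne_zero.2 fun h => (Finset.ne_of_mem_erase hl) (hinj h).symm
    have hne' : gramEigenvalue X l - gramEigenvalue X k = -(gramEigenvalue X k - gramEigenvalue X l) := by
      ring
    rw [hne', inv_neg]
    field_simp
    ring
  rw [h3, Finset.mul_sum, ← Finset.sum_add_distrib, ← Finset.sum_add_distrib]
  refine Finset.sum_congr rfl fun k _ => ?_
  rw [driftCoeff, Finset.sum_sub_distrib, Finset.sum_const,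
    Finset.card_erase_of_mem (Finset.mem_univ k), Finset.card_univ, Fintype.card_fin,
    nsmul_eq_mul, Nat.cast_sub (by have := k.2; omega)]
  push_cast
  ring

end Regular

/-! ### A barrier vanishing on the singular set and at infinity -/

/-- A nonnegative continuous function, positive exactly at the regular matrices and vanishing at
infinity. -/
noncomputable def gramBarrier {n p : ℕ} (X : Matrix (Fin n) (Fin p) ℝ) : ℝ :=
  (∏ k, ∏ l ∈ Finset.univ.erase k, |gramEigenvalue X k - gramEigenvalue X l|) *
    (∏ k, gramEigenvalue X k) * Real.exp (-∑ k, gramEigenvalue X k)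

/-- The partial derivatives of the logarithm of `gramBarrier` in terms of the eigenvalues `l`. -/
noncomputable def barrierCoeff {p : ℕ} (l : Fin p → ℝ) (k : Fin p) : ℝ :=
  2 * ∑ j ∈ Finset.univ.erase k, 1 / (l k - l j) + 1 / l k - 1

section Barrier

variable {n p : ℕ} {X : Matrix (Fin n) (Fin p) ℝ}

theorem gramBarrier_nonneg (X : Matrix (Fin n) (Fin p) ℝ) : 0 ≤ gramBarrier X :=
  mul_nonneg (mul_nonneg (Finset.prod_nonneg fun _ _ => Finset.prod_nonneg fun _ _ => abs_nonneg _)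
    (Finset.prod_nonneg fun k _ => gramEigenvalue_nonneg X k)) (Real.exp_pos _).le

theorem gramBarrier_ne_zero_iff : gramBarrier X ≠ 0 ↔ GramRegular X := by
  unfold gramBarrier GramRegular
  rw [mul_ne_zero_iff, mul_ne_zero_iff, Finset.prod_ne_zero_iff, Finset.prod_ne_zero_iff]
  constructor
  · rintro ⟨⟨h1, h2⟩, -⟩
    refine ⟨fun k l hkl => ?_, fun k =>
      lt_of_le_of_ne (gramEigenvalue_nonneg X k) (h2 k (Finset.mem_univ k)).symm⟩
    by_contra hne
    exact (Finset.prod_ne_zero_iff.1 (h1 k (Finset.mem_univ k))) l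
      (Finset.mem_erase.2 ⟨Ne.symm hne, Finset.mem_univ l⟩) (by simp [hkl])
  · rintro ⟨h1, h2⟩
    refine ⟨⟨fun k _ => Finset.prod_ne_zero_iff.2 fun l hl => ?_, fun k _ => (h2 k).ne'⟩,
      (Real.exp_pos _).ne'⟩
    exact abs_ne_zero.2 (sub_ne_zero.2 fun h => (Finset.ne_of_mem_erase hl) (h1 h).symm)

theorem GramRegular.gramBarrier_pos (hX : GramRegular X) : 0 < gramBarrier X :=
  lt_of_le_of_ne (gramBarrier_nonneg X) (gramBarrier_ne_zero_iff.2 hX).symm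

theorem continuous_gramBarrier :
    Continuous fun X : Matrix (Fin n) (Fin p) ℝ => gramBarrier X := by
  have hc : ∀ k, Continuous (fun Y : Matrix (Fin n) (Fin p) ℝ => gramEigenvalue Y k) :=
    fun k => (continuous_apply k).comp continuous_gramEigenvalue
  unfold gramBarrier
  fun_prop

/-- Exponential form, from which the logarithmic derivative is read off. No absolute value is needed
inside because `Real.log` is even. -/
theorem GramRegular.gramBarrier_eq (hX : GramRegular X) :
    gramBarrier X = Real.exp (∑ k, ∑ l ∈ Finset.univ.erase k,
      Real.log (gramEigenvalue X k - gramEigenvalue X l) + ∑ k, Real.log (gramEigenvalue X k)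
        - ∑ k, gramEigenvalue X k) := by
  rw [sub_eq_add_neg, Real.exp_add, Real.exp_add, Real.exp_sum, Real.exp_sum, gramBarrier]
  congr 2
  · refine Finset.prod_congr rfl fun k _ => ?_
    rw [Real.exp_sum]
    refine Finset.prod_congr rfl fun l hl => ?_
    rw [← Real.log_abs, Real.exp_log]
    exact abs_pos.2 (sub_ne_zero.2 fun h => (Finset.ne_of_mem_erase hl) (hX.1 h).symm)
  · exact Finset.prod_congr rfl fun k _ => (Real.exp_log (hX.2 k)).symm

theorem isOpen_gramRegular : IsOpen {X : Matrix (Fin n) (Fin p) ℝ | GramRegular X} := by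
  simp only [← gramBarrier_ne_zero_iff]
  exact isOpen_ne_fun continuous_gramBarrier continuous_const

theorem GramRegular.hasDerivAt_gramBarrier (hX : GramRegular X) (a : Fin n) (i : Fin p) :
    HasDerivAt (fun t : ℝ => gramBarrier (X + t • Matrix.single a i (1 : ℝ)))
      (gramBarrier X * ∑ k, barrierCoeff (gramEigenvalue X) k *
        (2 * (X * gramProjection X k) a i)) 0 := by
  have hl := fun k => hasDerivAt_gramEigenvalue hX.1 a i k
  have hA : HasDerivAt (fun t : ℝ => ∑ k, ∑ l ∈ Finset.univ.erase k,
      Real.log (gramEigenvalue (X + t • Matrix.single a i (1 : ℝ)) k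
        - gramEigenvalue (X + t • Matrix.single a i (1 : ℝ)) l))
      (∑ k, ∑ l ∈ Finset.univ.erase k,
        (2 * (X * gramProjection X k) a i - 2 * (X * gramProjection X l) a i) /
        (gramEigenvalue X k - gramEigenvalue X l)) 0 := by
    refine HasDerivAt.fun_sum fun k _ => HasDerivAt.fun_sum fun l hlk => ?_
    have := ((hl k).fun_sub (hl l)).log
      (by simpa using (sub_ne_zero.2 fun h => (Finset.ne_of_mem_erase hlk) (hX.1 h).symm))
    simpa only [zero_smul, add_zero] using this
  have hB : HasDerivAt (fun t : ℝ => ∑ k,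
      Real.log (gramEigenvalue (X + t • Matrix.single a i (1 : ℝ)) k))
      (∑ k, 2 * (X * gramProjection X k) a i / gramEigenvalue X k) 0 := by
    refine HasDerivAt.fun_sum fun k _ => ?_
    have := (hl k).log (by simpa using (hX.2 k).ne')
    simpa only [zero_smul, add_zero] using this
  have hC : HasDerivAt (fun t : ℝ => ∑ k, gramEigenvalue (X + t • Matrix.single a i (1 : ℝ)) k)
      (∑ k, 2 * (X * gramProjection X k) a i) 0 := HasDerivAt.fun_sum fun k _ => hl k
  have h1 := ((hA.fun_add hB).fun_sub hC).exp
  have hev : (fun t : ℝ => gramBarrier (X + t • Matrix.single a i (1 : ℝ))) =ᶠ[nhds 0] fun t =>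
      Real.exp (∑ k, ∑ l ∈ Finset.univ.erase k,
      Real.log (gramEigenvalue (X + t • Matrix.single a i (1 : ℝ)) k
        - gramEigenvalue (X + t • Matrix.single a i (1 : ℝ)) l)
      + ∑ k, Real.log (gramEigenvalue (X + t • Matrix.single a i (1 : ℝ)) k)
        - ∑ k, gramEigenvalue (X + t • Matrix.single a i (1 : ℝ)) k) := by
    filter_upwards [(tendsto_add_smul_single X a i).eventually
      (isOpen_gramRegular.mem_nhds hX)] with t ht
    exact GramRegular.gramBarrier_eq ht
  refine (h1.congr_of_eventuallyEq hev).congr_deriv ?_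
  simp only [zero_smul, add_zero]
  rw [← hX.gramBarrier_eq]
  congr 1
  have h2 : ∑ k, ∑ l ∈ Finset.univ.erase k,
      (2 * (X * gramProjection X k) a i - 2 * (X * gramProjection X l) a i) /
        (gramEigenvalue X k - gramEigenvalue X l)
      = ∑ k, (2 * ∑ l ∈ Finset.univ.erase k, 1 / (gramEigenvalue X k - gramEigenvalue X l)) *
        (2 * (X * gramProjection X k) a i) := by
    have h3 : ∑ k, ∑ l ∈ Finset.univ.erase k,
      (2 * (X * gramProjection X k) a i - 2 * (X * gramProjection X l) a i) /
        (gramEigenvalue X k - gramEigenvalue X l)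
      = ∑ k, ∑ l ∈ Finset.univ.erase k,
        2 * (X * gramProjection X k) a i / (gramEigenvalue X k - gramEigenvalue X l)
        + ∑ k, ∑ l ∈ Finset.univ.erase k,
        -(2 * (X * gramProjection X l) a i / (gramEigenvalue X k - gramEigenvalue X l)) := by
      rw [← Finset.sum_add_distrib]
      refine Finset.sum_congr rfl fun k _ => ?_
      rw [← Finset.sum_add_distrib]
      refine Finset.sum_congr rfl fun l _ => ?_
      ring
    -- The product runs over ordered pairs, so each unordered pair counts twice; after relabelling,
    -- the two contributions add up to the factor `2` in `barrierCoeff`.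
    rw [h3, sum_sum_erase_comm (fun k l =>
      -(2 * (X * gramProjection X l) a i / (gramEigenvalue X k - gramEigenvalue X l))),
      ← Finset.sum_add_distrib]
    refine Finset.sum_congr rfl fun k _ => ?_
    rw [← Finset.sum_add_distrib, Finset.mul_sum, Finset.sum_mul]
    refine Finset.sum_congr rfl fun l _ => ?_
    rw [← neg_sub (gramEigenvalue X k), div_neg, neg_neg]
    ring
  rw [h2, ← Finset.sum_add_distrib, ← Finset.sum_sub_distrib]
  refine Finset.sum_congr rfl fun k _ => ?_
  rw [barrierCoeff]
  ring

/-- Every factor outside the exponential is at most `∑ λ_k`, and there are `p (p - 1) + p` of them.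
The exponential then beats the power, which makes the superlevel sets of the barrier bounded. -/
theorem gramBarrier_le (X : Matrix (Fin n) (Fin p) ℝ) :
    gramBarrier X ≤ (∑ k, gramEigenvalue X k) ^ (p * (p - 1) + p) *
      Real.exp (-∑ k, gramEigenvalue X k) := by
  have hle : ∀ k, gramEigenvalue X k ≤ ∑ k, gramEigenvalue X k := fun k =>
    Finset.single_le_sum (f := gramEigenvalue X) (fun i _ => gramEigenvalue_nonneg X i)
      (Finset.mem_univ k)
  have h0 := gramEigenvalue_nonneg X
  refine mul_le_mul_of_nonneg_right ?_ (Real.exp_pos _).le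
  rw [pow_add]
  refine mul_le_mul ?_ ?_ (Finset.prod_nonneg fun k _ => h0 k)
    (pow_nonneg (Finset.sum_nonneg fun k _ => h0 k) _)
  · calc ∏ k, ∏ l ∈ Finset.univ.erase k, |gramEigenvalue X k - gramEigenvalue X l|
        ≤ ∏ k : Fin p, ∏ l ∈ Finset.univ.erase k, ∑ k, gramEigenvalue X k := by
          refine Finset.prod_le_prod (fun _ _ => Finset.prod_nonneg fun _ _ => abs_nonneg _)
            fun k _ => Finset.prod_le_prod (fun _ _ => abs_nonneg _) fun l _ => ?_
          rw [abs_le]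
          constructor <;> linarith [h0 k, h0 l, hle k, hle l]
      _ = _ := by
        simp [Finset.prod_const, pow_mul, mul_comm p]
  · calc ∏ k, gramEigenvalue X k ≤ ∏ k : Fin p, ∑ k, gramEigenvalue X k :=
          Finset.prod_le_prod (fun k _ => h0 k) fun k _ => hle k
      _ = _ := by simp

theorem exists_sum_sq_le_of_le_gramBarrier (n p : ℕ) {ε : ℝ} (hε : 0 < ε) :
    ∃ R : ℝ, ∀ X : Matrix (Fin n) (Fin p) ℝ, ε ≤ gramBarrier X →
      ∑ a, ∑ i, X a i ^ 2 ≤ R := by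
  have h := Real.tendsto_pow_mul_exp_neg_atTop_nhds_zero (p * (p - 1) + p)
  obtain ⟨R, hR⟩ := Filter.eventually_atTop.1 (h.eventually_lt_const hε)
  refine ⟨R, fun X hX => ?_⟩
  by_contra! hlt
  rw [← sum_gramEigenvalue] at hlt
  exact absurd (hR _ hlt.le) (not_lt.2 (hX.trans (gramBarrier_le X)))

end Barrier

/-! ### The scalar cutoff profile -/

/-- A smooth monotone function, `0` on `(-∞, 1]` and `1` on `[2, ∞)`. -/
noncomputable def smoothStep (x : ℝ) : ℝ := Real.smoothTransition (x - 1)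

theorem contDiff_smoothStep : ContDiff ℝ 1 smoothStep := by
  have h : ContDiff ℝ 1 Real.smoothTransition := Real.smoothTransition.contDiff (n := 1)
  exact h.comp (contDiff_id.sub contDiff_const)

theorem smoothStep_of_le_one {x : ℝ} (hx : x ≤ 1) : smoothStep x = 0 :=
  Real.smoothTransition.zero_of_nonpos (by linarith)

theorem smoothStep_of_two_le {x : ℝ} (hx : 2 ≤ x) : smoothStep x = 1 :=
  Real.smoothTransition.one_of_one_le (by linarith)

theorem smoothStep_nonneg (x : ℝ) : 0 ≤ smoothStep x := Real.smoothTransition.nonneg _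

theorem smoothStep_le_one (x : ℝ) : smoothStep x ≤ 1 := Real.smoothTransition.le_one _

theorem deriv_smoothStep_nonneg (x : ℝ) : 0 ≤ deriv smoothStep x := by
  have : Monotone smoothStep := fun x y h => Real.smoothTransition.monotone (by linarith)
  exact this.deriv_nonneg

theorem continuous_deriv_smoothStep : Continuous (deriv smoothStep) :=
  contDiff_smoothStep.continuous_deriv le_rfl

theorem hasDerivAt_smoothStep (x : ℝ) : HasDerivAt smoothStep (deriv smoothStep x) x :=
  (contDiff_smoothStep.differentiable one_ne_zero x).hasDerivAt

theorem deriv_smoothStep_of_le_one {x : ℝ} (hx : x ≤ 1) : deriv smoothStep x = 0 := by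
  refine IsLocalMin.deriv_eq_zero (Filter.Eventually.of_forall fun y => ?_)
  rw [smoothStep_of_le_one hx]
  exact smoothStep_nonneg y

theorem deriv_smoothStep_of_two_le {x : ℝ} (hx : 2 ≤ x) : deriv smoothStep x = 0 := by
  refine IsLocalMax.deriv_eq_zero (Filter.Eventually.of_forall fun y => ?_)
  rw [smoothStep_of_two_le hx]
  exact smoothStep_le_one y

/-- The derivative is supported in `[1, 2]`. Since the derivative of the barrier is the barrier
times a logarithmic derivative, `x s'(x)` at `x = b/ε` is exactly what the chain rule produces, and
this bound is uniform in `ε`. -/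
theorem exists_mul_deriv_smoothStep_le :
    ∃ C : ℝ, 0 ≤ C ∧ ∀ x, 0 ≤ x → x * deriv smoothStep x ≤ C := by
  obtain ⟨C, hC⟩ := (isCompact_Icc (a := (0 : ℝ)) (b := 2)).exists_bound_of_continuousOn
    (f := fun x => x * deriv smoothStep x)
    (continuous_id.mul continuous_deriv_smoothStep).continuousOn
  have hC0 : 0 ≤ C := (norm_nonneg _).trans (hC 0 (by simp))
  refine ⟨C, hC0, fun x hx => ?_⟩
  by_cases h : x ≤ 2
  · exact (le_abs_self _).trans (hC x ⟨hx, h⟩)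
  · rw [deriv_smoothStep_of_two_le (not_le.1 h).le, mul_zero]
    exact hC0

/-! ### Gaussian product measure and Stein's identity for compact support -/

section Gaussian

variable {ι : Type*} [Fintype ι]

theorem pi_gaussianReal_eq_withDensity (m : ι → ℝ) :
    Measure.pi (fun i => gaussianReal (m i) 1)
      = (volume : Measure (ι → ℝ)).withDensity
        (fun x => ENNReal.ofReal (∏ i, gaussianPDFReal (m i) 1 (x i))) := by
  refine Measure.pi_eq fun s hs => ?_
  have hint : ∀ i, Integrable ((s i).indicator (gaussianPDFReal (m i) 1)) :=
    fun i => (integrable_gaussianPDFReal _ _).indicator (hs i)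
  have hnn : ∀ i x, 0 ≤ (s i).indicator (gaussianPDFReal (m i) 1) x := fun i x =>
    Set.indicator_nonneg (fun _ _ => gaussianPDFReal_nonneg _ _ _) x
  have hind : ∀ x : ι → ℝ, (Set.univ.pi s).indicator
      (fun x => ENNReal.ofReal (∏ i, gaussianPDFReal (m i) 1 (x i))) x
      = ENNReal.ofReal (∏ i, (s i).indicator (gaussianPDFReal (m i) 1) (x i)) := by
    intro x
    by_cases hx : x ∈ Set.univ.pi s
    · rw [Set.indicator_of_mem hx]
      congr 1
      refine Finset.prod_congr rfl fun i _ => ?_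
      rw [Set.indicator_of_mem (hx i (Set.mem_univ i))]
    · rw [Set.indicator_of_notMem hx]
      obtain ⟨i, hi⟩ : ∃ i, x i ∉ s i := by simpa [Set.mem_pi] using hx
      rw [Finset.prod_eq_zero (Finset.mem_univ i) (Set.indicator_of_notMem hi _)]
      simp
  rw [withDensity_apply _ (MeasurableSet.univ_pi hs),
    ← lintegral_indicator (MeasurableSet.univ_pi hs), lintegral_congr hind,
    volume_pi,
    ← ofReal_integral_eq_lintegral_ofReal (Integrable.fintype_prod hint)
      (ae_of_all _ fun x => Finset.prod_nonneg fun i _ => hnn i (x i)),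
    integral_fintype_prod_eq_prod,
    ENNReal.ofReal_prod_of_nonneg fun i _ => integral_nonneg (hnn i)]
  refine Finset.prod_congr rfl fun i _ => ?_
  rw [integral_indicator (hs i), gaussianReal_apply_eq_integral _ one_ne_zero]

theorem pi_gaussianReal_absolutelyContinuous (m : ι → ℝ) :
    Measure.pi (fun i => gaussianReal (m i) 1) ≪ (volume : Measure (ι → ℝ)) := by
  rw [pi_gaussianReal_eq_withDensity]
  exact withDensity_absolutelyContinuous _ _

theorem continuous_gaussianPDFReal (m : ℝ) : Continuous (gaussianPDFReal m 1) := by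
  unfold gaussianPDFReal
  fun_prop

theorem integral_pi_gaussianReal (m : ι → ℝ) (f : (ι → ℝ) → ℝ) :
    ∫ x, f x ∂(Measure.pi fun i => gaussianReal (m i) 1)
      = ∫ x, f x * ∏ i, gaussianPDFReal (m i) 1 (x i) := by
  have hc : Continuous fun x : ι → ℝ => ∏ i, gaussianPDFReal (m i) 1 (x i) :=
    continuous_finsetProd _ fun i _ => (continuous_gaussianPDFReal (m i)).comp (continuous_apply i)
  rw [pi_gaussianReal_eq_withDensity, integral_withDensity_eq_integral_toReal_smul
    (by exact hc.measurable.ennreal_ofReal) (ae_of_all _ fun _ => ENNReal.ofReal_lt_top)]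
  refine integral_congr_ae (ae_of_all _ fun x => ?_)
  simp only [smul_eq_mul]
  rw [ENNReal.toReal_ofReal (Finset.prod_nonneg fun i _ => gaussianPDFReal_nonneg _ _ _), mul_comm]

theorem hasLineDerivAt_prod_gaussianPDFReal [DecidableEq ι] (m : ι → ℝ) (q : ι) (x : ι → ℝ) :
    HasLineDerivAt ℝ (fun x : ι → ℝ => ∏ i, gaussianPDFReal (m i) 1 (x i))
      (-(x q - m q) * ∏ i, gaussianPDFReal (m i) 1 (x i)) x (Pi.single q 1) := by
  have hform : ∀ x : ι → ℝ, ∏ i, gaussianPDFReal (m i) 1 (x i)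
      = (∏ _i : ι, (√(2 * Real.pi * 1))⁻¹) * Real.exp (∑ i, -(x i - m i) ^ 2 / 2) := by
    intro x
    rw [Real.exp_sum, ← Finset.prod_mul_distrib]
    refine Finset.prod_congr rfl fun i _ => ?_
    simp [gaussianPDFReal]
  simp only [hform]
  have h1 : HasDerivAt (fun t : ℝ => ∑ i, -((x + t • (Pi.single q 1 : ι → ℝ)) i - m i) ^ 2 / 2)
      (∑ i, -(x i - m i) * (Pi.single q (1 : ℝ) : ι → ℝ) i) 0 := by
    refine HasDerivAt.fun_sum fun i _ => ?_
    have h2 : HasDerivAt (fun t : ℝ => x i + t * (Pi.single q (1 : ℝ) : ι → ℝ) i - m i)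
        ((Pi.single q (1 : ℝ) : ι → ℝ) i) 0 := by
      simpa using (((hasDerivAt_id (0 : ℝ)).mul_const ((Pi.single q (1 : ℝ) : ι → ℝ) i)).const_add
        (x i)).sub_const (m i)
    have h3 := ((h2.fun_pow 2).fun_neg).div_const 2
    refine h3.congr_deriv ?_
    simp
    ring
  have h2 := (h1.exp).const_mul (∏ _i : ι, (√(2 * Real.pi * 1))⁻¹)
  refine HasDerivAt.congr_deriv h2 ?_
  simp [Pi.single_apply]
  ring

/-- Stein's identity for compactly supported functions. -/
theorem integral_sub_mul_pi_gaussianReal [DecidableEq ι] (m : ι → ℝ) (q : ι)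
    {f f' : (ι → ℝ) → ℝ} (hf : Continuous f) (hfc : HasCompactSupport f) (hf' : Continuous f')
    (hfc' : HasCompactSupport f') (h : ∀ x, HasLineDerivAt ℝ f (f' x) x (Pi.single q 1)) :
    ∫ x, (x q - m q) * f x ∂(Measure.pi fun i => gaussianReal (m i) 1)
      = ∫ x, f' x ∂(Measure.pi fun i => gaussianReal (m i) 1) := by
  have hc : Continuous fun x : ι → ℝ => ∏ i, gaussianPDFReal (m i) 1 (x i) :=
    continuous_finsetProd _ fun i _ => (continuous_gaussianPDFReal (m i)).comp (continuous_apply i)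
  have hg' : Continuous fun x : ι → ℝ => -(x q - m q) * ∏ i, gaussianPDFReal (m i) 1 (x i) := by
    fun_prop
  -- Integration by parts against the density, whose derivative in direction `q` is `-(x q - m q)`
  -- times itself. Compact support supplies all three integrability conditions.
  have key := integral_bilinear_hasLineDerivAt_right_eq_neg_left_of_integrable
    (μ := (volume : Measure (ι → ℝ))) (B := ContinuousLinearMap.mul ℝ ℝ) (f := f) (f' := f')
    (g := fun x : ι → ℝ => ∏ i, gaussianPDFReal (m i) 1 (x i))
    (g' := fun x : ι → ℝ => -(x q - m q) * ∏ i, gaussianPDFReal (m i) 1 (x i))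
    (v := Pi.single q 1)
    ((hf'.mul hc).integrable_of_hasCompactSupport hfc'.mul_right)
    ((hf.mul hg').integrable_of_hasCompactSupport hfc.mul_right)
    ((hf.mul hc).integrable_of_hasCompactSupport hfc.mul_right)
    (fun x _ => h x) (fun x _ => hasLineDerivAt_prod_gaussianPDFReal m q x)
  simp only [ContinuousLinearMap.mul_apply'] at key
  rw [integral_pi_gaussianReal, integral_pi_gaussianReal, ← neg_inj, ← key, ← integral_neg]
  refine integral_congr_ae (ae_of_all _ fun x => ?_)
  simp only
  ring

end Gaussian

/-! ### Almost every matrix is regular -/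

section GenericRegular

theorem trace_gram_pow {n p : ℕ} (X : Matrix (Fin n) (Fin p) ℝ) (m : ℕ) :
    ((Xᵀ * X) ^ m).trace = ∑ k, gramEigenvalue X k ^ m := by
  obtain ⟨V, hV, hX⟩ := exists_gram_diagonalization X
  have h : ∀ m, (Xᵀ * X) ^ m = V * Matrix.diagonal (gramEigenvalue X) ^ m * Vᵀ := by
    intro m
    induction m with
    | zero => simp [mul_eq_one_comm.1 hV]
    | succ m ih =>
      rw [pow_succ, ih, pow_succ]
      nth_rw 1 [hX]
      calc V * Matrix.diagonal (gramEigenvalue X) ^ m * Vᵀ *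
            (V * Matrix.diagonal (gramEigenvalue X) * Vᵀ)
          = V * (Matrix.diagonal (gramEigenvalue X) ^ m * (Vᵀ * V) *
            Matrix.diagonal (gramEigenvalue X)) * Vᵀ := by simp only [Matrix.mul_assoc]
        _ = _ := by rw [hV, Matrix.mul_one]
  rw [h, Matrix.trace_mul_comm, ← mul_assoc, hV, one_mul, Matrix.diagonal_pow,
    Matrix.trace_diagonal]
  rfl

/-- A polynomial in the entries of a real matrix that vanishes exactly when the eigenvalues of
`Xᵀ X` are not distinct and positive: the discriminant times the determinant of `Xᵀ X`. -/
def gramDiscriminant {R : Type*} [CommRing R] {n p : ℕ} (X : Matrix (Fin n) (Fin p) R) : R :=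
  (Matrix.of fun i j : Fin p => ((Xᵀ * X) ^ ((i : ℕ) + (j : ℕ))).trace).det * (Xᵀ * X).det

/-- Applied to evaluation of polynomials in `t`, this shows that the discriminant along a line of
matrices is a polynomial in the parameter. -/
theorem map_gramDiscriminant {R S : Type*} [CommRing R] [CommRing S] (f : R →+* S) {n p : ℕ}
    (X : Matrix (Fin n) (Fin p) R) :
    f (gramDiscriminant X) = gramDiscriminant (X.map f) := by
  have h : f.mapMatrix (Xᵀ * X) = (X.map f)ᵀ * X.map f := by
    ext i j
    simp [Matrix.mul_apply]
  rw [gramDiscriminant, map_mul, RingHom.map_det, RingHom.map_det, h, gramDiscriminant]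
  congr 2
  ext i j
  have h2 := AddMonoidHom.map_trace f.toAddMonoidHom ((Xᵀ * X) ^ ((i : ℕ) + (j : ℕ)))
  simp only [RingHom.mapMatrix_apply, Matrix.map_apply, Matrix.of_apply]
  rw [← h, ← map_pow]
  exact h2

/-- The Hankel matrix of power sums `tr G^(i+j)` is `WᵀW` with `W` the Vandermonde matrix of the
eigenvalues, so its determinant detects coincidences; `det G` detects zero eigenvalues. -/
theorem gramDiscriminant_ne_zero_iff {n p : ℕ} {X : Matrix (Fin n) (Fin p) ℝ} :
    gramDiscriminant X ≠ 0 ↔ GramRegular X := by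
  have h1 : (Matrix.of fun i j : Fin p => ((Xᵀ * X) ^ ((i : ℕ) + (j : ℕ))).trace)
      = (Matrix.vandermonde (gramEigenvalue X))ᵀ * Matrix.vandermonde (gramEigenvalue X) := by
    ext i j
    rw [Matrix.vandermonde_transpose_mul_vandermonde, Matrix.of_apply, trace_gram_pow]
  have h2 : (Xᵀ * X).det = ∏ k, gramEigenvalue X k := by
    obtain ⟨V, hV, hX⟩ := exists_gram_diagonalization X
    rw [hX, Matrix.det_mul_comm, ← mul_assoc, hV, one_mul, Matrix.det_diagonal]
  rw [gramDiscriminant, h1, h2, Matrix.det_mul, Matrix.det_transpose, mul_ne_zero_iff,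
    mul_self_ne_zero, Matrix.det_vandermonde_ne_zero_iff, Finset.prod_ne_zero_iff]
  refine and_congr_right fun _ => ⟨fun h k => ?_, fun h k _ => (h k).ne'⟩
  exact lt_of_le_of_ne (gramEigenvalue_nonneg X k) (h k (Finset.mem_univ k)).symm

theorem gramEigenvalue_smul {n p : ℕ} (t : ℝ) (X : Matrix (Fin n) (Fin p) ℝ) :
    gramEigenvalue (t • X) = fun k => t ^ 2 * gramEigenvalue X k := by
  obtain ⟨V, hV, hX⟩ := exists_gram_diagonalization X
  refine gramEigenvalue_eq_of_charpoly
    (fun i j h => mul_le_mul_of_nonneg_left (gramEigenvalue_antitone X h) (sq_nonneg t)) ?_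
  rw [← charpoly_conj_diagonal hV]
  congr 1
  have : Matrix.diagonal (fun k => t ^ 2 * gramEigenvalue X k)
      = t ^ 2 • Matrix.diagonal (gramEigenvalue X) := by
    rw [← Matrix.diagonal_smul]; rfl
  have h2 : (t • X)ᵀ * (t • X) = t ^ 2 • (Xᵀ * X) := by
    rw [Matrix.transpose_smul, Matrix.smul_mul, Matrix.mul_smul, smul_smul, pow_two]
  rw [h2, this, Matrix.mul_smul, Matrix.smul_mul, ← hX]

theorem GramRegular.smul {n p : ℕ} {X : Matrix (Fin n) (Fin p) ℝ} (hX : GramRegular X) {t : ℝ}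
    (ht : t ≠ 0) : GramRegular (t • X) := by
  have ht2 : 0 < t ^ 2 := by positivity
  refine ⟨fun k l h => ?_, fun k => ?_⟩
  · rw [gramEigenvalue_smul] at h
    exact hX.1 (mul_left_cancel₀ ht2.ne' h)
  · rw [gramEigenvalue_smul]
    exact mul_pos ht2 (hX.2 k)

theorem exists_gramRegular {n p : ℕ} (hpn : p ≤ n) :
    ∃ X : Matrix (Fin n) (Fin p) ℝ, GramRegular X := by
  -- Singular values `p, p - 1, …, 1`: positive, distinct and already in decreasing order.
  set d : Fin p → ℝ := fun i => (p : ℝ) - i with hd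
  have hdpos : ∀ i, 0 < d i := fun i => by
    have : ((i : ℕ) : ℝ) < p := by exact_mod_cast i.2
    simp only [hd]; linarith
  set X : Matrix (Fin n) (Fin p) ℝ :=
    Matrix.of fun a i => if a = Fin.castLE hpn i then d i else 0 with hX
  have hgram : Xᵀ * X = Matrix.diagonal fun i => d i ^ 2 := by
    ext i j
    rw [Matrix.mul_apply, Matrix.diagonal_apply]
    simp only [hX, Matrix.transpose_apply, Matrix.of_apply, ite_mul, zero_mul,
      Finset.sum_ite_eq', Finset.mem_univ, if_true]
    by_cases h : i = j
    · subst h; simp [pow_two]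
    · simp [h, (Fin.castLE_injective hpn).eq_iff]
  have hev : gramEigenvalue X = fun i => d i ^ 2 := by
    refine gramEigenvalue_eq_of_charpoly (fun i j hij => ?_) ?_
    · refine pow_le_pow_left₀ (hdpos j).le ?_ 2
      have : ((i : ℕ) : ℝ) ≤ j := by exact_mod_cast hij
      simp only [hd]; linarith
    · rw [hgram, Matrix.charpoly_diagonal]
  refine ⟨X, fun i j hij => ?_, fun i => ?_⟩
  · rw [hev] at hij
    have h2 : d i = d j := (pow_left_inj₀ (hdpos i).le (hdpos j).le two_ne_zero).1 hij
    have h3 : ((i : ℕ) : ℝ) = j := by simp only [hd] at h2; linarith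
    exact Fin.ext (by exact_mod_cast h3)
  · rw [hev]; exact pow_pos (hdpos i) 2

/-- Along the line the discriminant is a polynomial in `t`, so it suffices that it is not
identically zero; its roots are then finitely many. -/
theorem ae_gramRegular_add_smul {n p : ℕ} {X : Matrix (Fin n) (Fin p) ℝ} (hX : GramRegular X)
    (Y : Matrix (Fin n) (Fin p) ℝ) : ∀ᵐ t : ℝ, GramRegular (Y + t • X) := by
  set Q : Polynomial ℝ := gramDiscriminant
    (Y.map Polynomial.C + (Polynomial.X : Polynomial ℝ) • X.map Polynomial.C) with hQ
  have heval : ∀ t, Q.eval t = gramDiscriminant (Y + t • X) := by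
    intro t
    have := map_gramDiscriminant (Polynomial.evalRingHom t)
      (Y.map Polynomial.C + (Polynomial.X : Polynomial ℝ) • X.map Polynomial.C)
    rw [Polynomial.coe_evalRingHom] at this
    rw [hQ, this]
    congr 1
    ext a i
    simp
    ring
  have hQ0 : Q ≠ 0 := by
    -- Regularity is open, so `X + s • Y` is regular for some small `s ≠ 0`; rescaling by `s⁻¹`
    -- gives a regular point on the line `Y + t • X`.
    have hcont : Continuous fun s : ℝ => X + s • Y :=
      continuous_const.add (continuous_id.smul continuous_const)
    have h1 : ∀ᶠ s in nhds (0 : ℝ), GramRegular (X + s • Y) := by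
      have h2 : Filter.Tendsto (fun s : ℝ => X + s • Y) (nhds 0) (nhds X) := by
        simpa using hcont.tendsto 0
      exact h2.eventually (isOpen_gramRegular.mem_nhds hX)
    obtain ⟨s, hs, hs0⟩ := ((h1.filter_mono nhdsWithin_le_nhds).and
      (self_mem_nhdsWithin : ({0}ᶜ : Set ℝ) ∈ nhdsWithin 0 {0}ᶜ)).exists
    have hs0' : s ≠ 0 := hs0
    have h3 := hs.smul (inv_ne_zero hs0')
    rw [smul_add, smul_smul, inv_mul_cancel₀ hs0', one_smul, add_comm] at h3
    intro h0
    exact gramDiscriminant_ne_zero_iff.2 h3 (by rw [← heval, h0, Polynomial.eval_zero])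
  have hfin : {t : ℝ | Q.eval t = 0}.Finite := by
    refine Q.roots.toFinset.finite_toSet.subset fun t ht => ?_
    simpa [hQ0, Polynomial.IsRoot] using ht
  have := hfin.countable.ae_notMem (volume : Measure ℝ)
  filter_upwards [this] with t ht
  refine gramDiscriminant_ne_zero_iff.1 ?_
  rw [← heval]
  exact ht

/-- The matrix with entries indexed by pairs. -/
def matrixOfPairs {n p : ℕ} (x : Fin n × Fin p → ℝ) : Matrix (Fin n) (Fin p) ℝ :=
  Matrix.of fun a i => x (a, i)

theorem continuous_matrixOfPairs {n p : ℕ} :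
    Continuous (matrixOfPairs : (Fin n × Fin p → ℝ) → Matrix (Fin n) (Fin p) ℝ) :=
  continuous_matrix fun a i => continuous_apply (a, i)

theorem matrixOfPairs_add_smul {n p : ℕ} (x y : Fin n × Fin p → ℝ) (t : ℝ) :
    matrixOfPairs (x + t • y) = matrixOfPairs x + t • matrixOfPairs y := rfl

theorem matrixOfPairs_single {n p : ℕ} (a : Fin n) (i : Fin p) :
    matrixOfPairs (Pi.single (a, i) 1) = Matrix.single a i (1 : ℝ) := by
  ext b j
  simp [matrixOfPairs, Matrix.single_apply, Pi.single_apply, eq_comm]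

theorem ae_gramRegular {n p : ℕ} (hpn : p ≤ n) :
    ∀ᵐ x : Fin n × Fin p → ℝ, GramRegular (matrixOfPairs x) := by
  obtain ⟨X, hX⟩ := exists_gramRegular hpn
  set x₀ : Fin n × Fin p → ℝ := fun q => X q.1 q.2 with hx₀
  have hx : matrixOfPairs x₀ = X := rfl
  have hs : MeasurableSet {x : Fin n × Fin p → ℝ | GramRegular (matrixOfPairs x)} :=
    (isOpen_gramRegular.preimage continuous_matrixOfPairs).measurableSet
  -- Fubini along the direction of one regular matrix: a measurable set that is conull on every
  -- parallel line is conull.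
  refine ae_mem_of_ae_add_linearMap_mem (LinearMap.toSpanSingleton ℝ _ x₀)
    (volume : Measure ℝ) volume hs fun y => ?_
  filter_upwards [ae_gramRegular_add_smul hX (matrixOfPairs y)] with t ht
  exact ht

end GenericRegular

/-! ### Stein's identity for the cutoff shrinkage field -/

section Cutoff

variable {n p : ℕ} {X : Matrix (Fin n) (Fin p) ℝ}

theorem ContinuousAt.matrix_mul' {α : Type*} [TopologicalSpace α] {l m r : ℕ}
    {A : α → Matrix (Fin l) (Fin m) ℝ} {B : α → Matrix (Fin m) (Fin r) ℝ} {x : α}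
    (hA : ContinuousAt A x) (hB : ContinuousAt B x) :
    ContinuousAt (fun y => A y * B y) x := by
  have h : Continuous fun q : Matrix (Fin l) (Fin m) ℝ × Matrix (Fin m) (Fin r) ℝ => q.1 * q.2 :=
    continuous_fst.matrix_mul continuous_snd
  exact ContinuousAt.comp (f := fun y => (A y, B y)) h.continuousAt (hA.prodMk hB)

theorem ContinuousAt.matrix_apply {α : Type*} [TopologicalSpace α] {l m : ℕ}
    {A : α → Matrix (Fin l) (Fin m) ℝ} {x : α} (hA : ContinuousAt A x) (i : Fin l) (j : Fin m) :
    ContinuousAt (fun y => A y i j) x :=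
  ((continuous_id.matrix_elem i j).continuousAt (x := A x)).comp hA

theorem GramRegular.sub_ne_zero (hX : GramRegular X) {k l : Fin p}
    (h : l ∈ Finset.univ.erase k) : gramEigenvalue X k - gramEigenvalue X l ≠ 0 :=
  _root_.sub_ne_zero.2 fun h' => (Finset.ne_of_mem_erase h) (hX.1 h').symm

theorem continuousAt_gramSpectral (hX : GramRegular X) {d : (Fin p → ℝ) → Fin p → ℝ}
    (hd : ∀ k, ContinuousAt (fun Y : Matrix (Fin n) (Fin p) ℝ => d (gramEigenvalue Y) k) X) :
    ContinuousAt (fun Y : Matrix (Fin n) (Fin p) ℝ => gramSpectral d Y) X :=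
  tendsto_finsetSum _ fun k _ => (hd k).smul (continuousAt_gramProjection hX.1 k)

theorem GramRegular.continuousAt_div (hX : GramRegular X) (c : Fin p → ℝ) (k : Fin p) :
    ContinuousAt (fun Y : Matrix (Fin n) (Fin p) ℝ => c k / gramEigenvalue Y k) X :=
  continuousAt_const.div (continuousAt_gramEigenvalue X k) (hX.2 k).ne'

theorem GramRegular.continuousAt_driftCoeff (hX : GramRegular X) (N : ℕ) (c : Fin p → ℝ)
    (k : Fin p) :
    ContinuousAt (fun Y : Matrix (Fin n) (Fin p) ℝ => driftCoeff N c (gramEigenvalue Y) k) X := by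
  refine ContinuousAt.add (continuousAt_const.mul (hX.continuousAt_div c k))
    (tendsto_finsetSum _ fun l hl => ?_)
  exact ContinuousAt.div continuousAt_const
    ((continuousAt_gramEigenvalue X k).sub (continuousAt_gramEigenvalue X l)) (hX.sub_ne_zero hl)

theorem GramRegular.continuousAt_barrierCoeff (hX : GramRegular X) (k : Fin p) :
    ContinuousAt (fun Y : Matrix (Fin n) (Fin p) ℝ => barrierCoeff (gramEigenvalue Y) k) X := by
  refine ContinuousAt.sub (ContinuousAt.add (continuousAt_const.mul
    (tendsto_finsetSum _ fun l hl => ?_)) ?_) continuousAt_const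
  · exact ContinuousAt.div continuousAt_const
      ((continuousAt_gramEigenvalue X k).sub (continuousAt_gramEigenvalue X l)) (hX.sub_ne_zero hl)
  · exact ContinuousAt.div continuousAt_const (continuousAt_gramEigenvalue X k) (hX.2 k).ne'

theorem continuousAt_mul_gramProjection_apply (hX : GramRegular X) (k : Fin p) (a : Fin n)
    (i : Fin p) :
    ContinuousAt (fun Y : Matrix (Fin n) (Fin p) ℝ => (Y * gramProjection Y k) a i) X :=
  (continuousAt_id.matrix_mul' (continuousAt_gramProjection hX.1 k)).matrix_apply a i

theorem GramRegular.continuousAt_shrinkFieldDeriv (hX : GramRegular X) (c : Fin p → ℝ)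
    (a : Fin n) (i j : Fin p) :
    ContinuousAt (fun Y : Matrix (Fin n) (Fin p) ℝ => shrinkFieldDeriv c Y a i j) X := by
  have hP := fun k => continuousAt_gramProjection (X := X) hX.1 k
  have hl := fun k => continuousAt_gramEigenvalue X k
  have hD : ContinuousAt (fun Y : Matrix (Fin n) (Fin p) ℝ => gramDeriv Y a i) X := by
    refine Continuous.continuousAt ?_
    exact (continuous_id.matrix_transpose.matrix_mul continuous_const).add
      (continuous_const.matrix_mul continuous_id)
  refine ContinuousAt.add
    ((continuousAt_gramSpectral hX fun k => hX.continuousAt_div c k).matrix_apply i j) ?_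
  refine ContinuousAt.matrix_apply (continuousAt_id.matrix_mul' ?_) a j
  refine tendsto_finsetSum _ fun k _ => ContinuousAt.add ?_ ?_
  · refine ContinuousAt.smul (ContinuousAt.neg (ContinuousAt.div ?_ ((hl k).pow 2) ?_)) (hP k)
    · exact continuousAt_const.mul
        (continuousAt_const.mul (continuousAt_mul_gramProjection_apply hX k a i))
    · exact pow_ne_zero 2 (hX.2 k).ne'
  · refine ContinuousAt.smul (hX.continuousAt_div c k) (tendsto_finsetSum _ fun l hlk => ?_)
    refine ContinuousAt.smul (((hl k).sub (hl l)).inv₀ (hX.sub_ne_zero hlk)) ?_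
    exact (((hP l).mul hD).mul (hP k)).add (((hP k).mul hD).mul (hP l))

theorem gramBarrier_of_not_regular (hX : ¬ GramRegular X) : gramBarrier X = 0 := by
  by_contra h
  exact hX (gramBarrier_ne_zero_iff.1 h)

theorem isCompact_le_gramBarrier (n p : ℕ) {ε : ℝ} (hε : 0 < ε) :
    IsCompact {x : Fin n × Fin p → ℝ | ε ≤ gramBarrier (matrixOfPairs x)} := by
  refine Metric.isCompact_of_isClosed_isBounded
    (isClosed_le continuous_const (continuous_gramBarrier.comp continuous_matrixOfPairs)) ?_
  obtain ⟨R, hR⟩ := exists_sum_sq_le_of_le_gramBarrier n p hε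
  refine (Metric.isBounded_iff_subset_closedBall (0 : Fin n × Fin p → ℝ)).2 ⟨√R, fun x hx => ?_⟩
  rw [mem_closedBall_zero_iff, pi_norm_le_iff_of_nonneg (Real.sqrt_nonneg _)]
  rintro ⟨a, i⟩
  refine Real.abs_le_sqrt (le_trans ?_ (hR _ hx))
  refine le_trans ?_ (Finset.single_le_sum (f := fun a => ∑ i, matrixOfPairs x a i ^ 2)
    (fun a _ => Finset.sum_nonneg fun i _ => sq_nonneg _) (Finset.mem_univ a))
  exact Finset.single_le_sum (f := fun i => matrixOfPairs x a i ^ 2)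
    (fun i _ => sq_nonneg _) (Finset.mem_univ i)

variable {w : ℝ → ℝ} {ε : ℝ} {g : Matrix (Fin n) (Fin p) ℝ → ℝ}

theorem cutoff_eq_zero (hw0 : ∀ x ≤ 1, w x = 0) (hε : 0 < ε) {X : Matrix (Fin n) (Fin p) ℝ}
    (hX : gramBarrier X ≤ ε) : w (gramBarrier X / ε) = 0 :=
  hw0 _ ((div_le_one hε).2 hX)

/-- Near an irregular matrix the barrier is below `ε` and the product is identically zero, so
continuity of `g` is needed only at regular matrices. In particular the arbitrary values of `g` on
the singular set play no role. -/
theorem continuous_cutoff_mul (hw : Continuous w) (hw0 : ∀ x ≤ 1, w x = 0) (hε : 0 < ε)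
    (hg : ∀ X, GramRegular X → ContinuousAt g X) :
    Continuous fun x : Fin n × Fin p → ℝ =>
      w (gramBarrier (matrixOfPairs x) / ε) * g (matrixOfPairs x) := by
  have h : Continuous fun X : Matrix (Fin n) (Fin p) ℝ => w (gramBarrier X / ε) * g X := by
    rw [continuous_iff_continuousAt]
    intro X
    by_cases hX : GramRegular X
    · exact ((hw.comp (continuous_gramBarrier.div_const ε)).continuousAt).mul (hg X hX)
    · have hev : (fun _ : Matrix (Fin n) (Fin p) ℝ => (0 : ℝ)) =ᶠ[nhds X]
          fun X => w (gramBarrier X / ε) * g X := by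
        have h1 : ∀ᶠ Y in nhds X, gramBarrier Y < ε :=
          continuous_gramBarrier.continuousAt.eventually_lt continuousAt_const
            (by rw [gramBarrier_of_not_regular hX]; exact hε)
        filter_upwards [h1] with Y hY
        rw [cutoff_eq_zero hw0 hε hY.le, zero_mul]
      exact continuousAt_const.congr hev
  exact h.comp continuous_matrixOfPairs

theorem hasCompactSupport_cutoff_mul (hw0 : ∀ x ≤ 1, w x = 0) (hε : 0 < ε)
    (g : Matrix (Fin n) (Fin p) ℝ → ℝ) :
    HasCompactSupport fun x : Fin n × Fin p → ℝ =>
      w (gramBarrier (matrixOfPairs x) / ε) * g (matrixOfPairs x) := by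
  refine HasCompactSupport.intro (isCompact_le_gramBarrier n p hε) fun x hx => ?_
  rw [cutoff_eq_zero hw0 hε (not_le.1 hx).le, zero_mul]

theorem integrable_cutoff_mul (hw : Continuous w) (hw0 : ∀ x ≤ 1, w x = 0) (hε : 0 < ε)
    (hg : ∀ X, GramRegular X → ContinuousAt g X) (μ : Measure (Fin n × Fin p → ℝ))
    [IsFiniteMeasureOnCompacts μ] :
    Integrable (fun x : Fin n × Fin p → ℝ =>
      w (gramBarrier (matrixOfPairs x) / ε) * g (matrixOfPairs x)) μ :=
  (continuous_cutoff_mul hw hw0 hε hg).integrable_of_hasCompactSupport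
    (hasCompactSupport_cutoff_mul hw0 hε g)

/-- The law of a normal matrix with mean `M`. -/
noncomputable def normalMatrixLaw (M : Matrix (Fin n) (Fin p) ℝ) :
    Measure (Fin n × Fin p → ℝ) :=
  Measure.pi fun q => gaussianReal (M q.1 q.2) 1

instance (M : Matrix (Fin n) (Fin p) ℝ) : IsProbabilityMeasure (normalMatrixLaw M) := by
  unfold normalMatrixLaw
  infer_instance

theorem continuousAt_mul_gramSpectral_apply (hX : GramRegular X) (c : Fin p → ℝ) (a : Fin n)
    (j : Fin p) : ContinuousAt (fun Y : Matrix (Fin n) (Fin p) ℝ =>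
      (Y * gramSpectral (fun l k => c k / l k) Y) a j) X :=
  (continuousAt_id.matrix_mul'
    (continuousAt_gramSpectral hX fun k => hX.continuousAt_div c k)).matrix_apply a j

/-- The derivative of the cutoff factor with respect to the entry `X a i`, divided by the scalar
cutoff factor. -/
noncomputable def barrierLogDeriv (X : Matrix (Fin n) (Fin p) ℝ) (a : Fin n) (i : Fin p) : ℝ :=
  ∑ k, barrierCoeff (gramEigenvalue X) k * (2 * (X * gramProjection X k) a i)

theorem GramRegular.continuousAt_barrierLogDeriv (hX : GramRegular X) (a : Fin n) (i : Fin p) :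
    ContinuousAt (fun Y : Matrix (Fin n) (Fin p) ℝ => barrierLogDeriv Y a i) X :=
  tendsto_finsetSum _ fun k _ => (hX.continuousAt_barrierCoeff k).mul
    (continuousAt_const.mul (continuousAt_mul_gramProjection_apply hX k a i))

/-- Orthogonality of the projections keeps only the diagonal terms, and the resulting `λ_k` cancels
the denominator of the field. -/
theorem sum_barrierLogDeriv_mul (hX : GramRegular X) (c : Fin p → ℝ) (i j : Fin p) :
    ∑ a, barrierLogDeriv X a i * (X * gramSpectral (fun l k => c k / l k) X) a j
      = 2 * gramSpectral (fun l k => barrierCoeff l k * c k) X i j := by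
  simp only [barrierLogDeriv, mul_gramSpectral_apply, Finset.sum_mul_sum]
  rw [Finset.sum_comm]
  simp only [gramSpectral, Matrix.sum_apply, Matrix.smul_apply, smul_eq_mul]
  rw [Finset.mul_sum]
  refine Finset.sum_congr rfl fun k _ => ?_
  rw [Finset.sum_comm]
  have h : ∀ l, ∑ a, barrierCoeff (gramEigenvalue X) k * (2 * (X * gramProjection X k) a i) *
      (c l / gramEigenvalue X l * (X * gramProjection X l) a j)
      = barrierCoeff (gramEigenvalue X) k * 2 * (c l / gramEigenvalue X l) *
        if k = l then gramEigenvalue X l * gramProjection X l i j else 0 := by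
    intro l
    rw [← sum_mul_gramProjection_mul hX.1 l k i j, Finset.mul_sum]
    refine Finset.sum_congr rfl fun a _ => ?_
    ring
  rw [Finset.sum_congr rfl fun l _ => h l]
  simp only [mul_ite, mul_zero, Finset.sum_ite_eq, Finset.mem_univ, if_true]
  have := (hX.2 k).ne'
  field_simp

theorem hasLineDerivAt_cutoff_field (hε : 0 < ε) (c : Fin p → ℝ) (a : Fin n) (i j : Fin p)
    (x : Fin n × Fin p → ℝ) :
    HasLineDerivAt ℝ (fun x : Fin n × Fin p → ℝ => smoothStep (gramBarrier (matrixOfPairs x) / ε) *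
        (matrixOfPairs x * gramSpectral (fun l k => c k / l k) (matrixOfPairs x)) a j)
      (smoothStep (gramBarrier (matrixOfPairs x) / ε) * shrinkFieldDeriv c (matrixOfPairs x) a i j +
        (gramBarrier (matrixOfPairs x) / ε * deriv smoothStep (gramBarrier (matrixOfPairs x) / ε)) *
          (barrierLogDeriv (matrixOfPairs x) a i *
            (matrixOfPairs x * gramSpectral (fun l k => c k / l k) (matrixOfPairs x)) a j))
      x (Pi.single (a, i) 1) := by
  unfold HasLineDerivAt
  simp only [matrixOfPairs_add_smul, matrixOfPairs_single]
  generalize matrixOfPairs x = X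
  by_cases hX : GramRegular X
  · have h1 := (hX.hasDerivAt_gramBarrier a i).div_const ε
    have h2 : HasDerivAt smoothStep (deriv smoothStep (gramBarrier X / ε))
        ((fun t : ℝ => gramBarrier (X + t • Matrix.single a i (1 : ℝ)) / ε) 0) := by
      simpa only [zero_smul, add_zero] using hasDerivAt_smoothStep (gramBarrier X / ε)
    have h3 := (h2.comp 0 h1).fun_mul (hX.hasDerivAt_mul_gramSpectral c a i j)
    refine h3.congr_deriv ?_
    simp only [zero_smul, add_zero, Function.comp_apply, barrierLogDeriv]
    ring
  -- At an irregular matrix the field vanishes on a neighbourhood along the line, and the proposed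
  -- derivative is zero because `b = 0`.
  · have hb := gramBarrier_of_not_regular hX
    have hev : ∀ᶠ t : ℝ in nhds 0, gramBarrier (X + t • Matrix.single a i (1 : ℝ)) < ε :=
      (tendsto_add_smul_single X a i).eventually
        (continuous_gramBarrier.continuousAt.eventually_lt continuousAt_const (by rw [hb]; exact hε))
    have h0 : smoothStep (gramBarrier X / ε) = 0 :=
      cutoff_eq_zero (fun x => smoothStep_of_le_one) hε (by rw [hb]; exact hε.le)
    rw [h0, hb]
    simp only [zero_mul, zero_div, add_zero]
    refine (hasDerivAt_const (0 : ℝ) (0 : ℝ)).congr_of_eventuallyEq ?_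
    filter_upwards [hev] with t ht
    rw [cutoff_eq_zero (fun x => smoothStep_of_le_one) hε ht.le, zero_mul]

theorem continuous_mul_deriv_smoothStep : Continuous fun x => x * deriv smoothStep x :=
  continuous_id.mul continuous_deriv_smoothStep

theorem mul_deriv_smoothStep_of_le_one : ∀ x ≤ (1 : ℝ), x * deriv smoothStep x = 0 :=
  fun x hx => by rw [deriv_smoothStep_of_le_one hx, mul_zero]

theorem continuousAt_barrierLogDeriv_mul (hX : GramRegular X) (c : Fin p → ℝ) (a : Fin n)
    (i j : Fin p) : ContinuousAt (fun Y : Matrix (Fin n) (Fin p) ℝ => barrierLogDeriv Y a i *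
      (Y * gramSpectral (fun l k => c k / l k) Y) a j) X :=
  (hX.continuousAt_barrierLogDeriv a i).mul (continuousAt_mul_gramSpectral_apply hX c a j)

theorem transpose_mul_apply_eq_sum (A B : Matrix (Fin n) (Fin p) ℝ) (i j : Fin p) :
    (Aᵀ * B) i j = ∑ a, A a i * B a j := by
  rw [Matrix.mul_apply]
  rfl

theorem integral_cutoff_stein_entry (M : Matrix (Fin n) (Fin p) ℝ) (hε : 0 < ε) (c : Fin p → ℝ)
    (a : Fin n) (i j : Fin p) :
    ∫ x, (x (a, i) - M a i) * (smoothStep (gramBarrier (matrixOfPairs x) / ε) *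
        (matrixOfPairs x * gramSpectral (fun l k => c k / l k) (matrixOfPairs x)) a j)
          ∂normalMatrixLaw M
      = ∫ x, smoothStep (gramBarrier (matrixOfPairs x) / ε) *
          shrinkFieldDeriv c (matrixOfPairs x) a i j ∂normalMatrixLaw M
        + ∫ x, (gramBarrier (matrixOfPairs x) / ε *
          deriv smoothStep (gramBarrier (matrixOfPairs x) / ε)) *
          (barrierLogDeriv (matrixOfPairs x) a i *
            (matrixOfPairs x * gramSpectral (fun l k => c k / l k) (matrixOfPairs x)) a j)
          ∂normalMatrixLaw M := by
  have hs0 : ∀ x ≤ (1 : ℝ), smoothStep x = 0 := fun x => smoothStep_of_le_one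
  have hsc : Continuous smoothStep := contDiff_smoothStep.continuous
  have hF := fun (X : Matrix (Fin n) (Fin p) ℝ) (hX : GramRegular X) =>
    continuousAt_mul_gramSpectral_apply hX c a j
  have hB := fun (X : Matrix (Fin n) (Fin p) ℝ) (hX : GramRegular X) =>
    continuousAt_barrierLogDeriv_mul hX c a i j
  have hD := fun (X : Matrix (Fin n) (Fin p) ℝ) (hX : GramRegular X) =>
    hX.continuousAt_shrinkFieldDeriv c a i j
  rw [← integral_add (integrable_cutoff_mul hsc hs0 hε hD (normalMatrixLaw M))
    (integrable_cutoff_mul continuous_mul_deriv_smoothStep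
    mul_deriv_smoothStep_of_le_one hε hB (normalMatrixLaw M))]
  exact integral_sub_mul_pi_gaussianReal
    (fun q : Fin n × Fin p => M q.1 q.2) (a, i)
    (continuous_cutoff_mul hsc hs0 hε hF)
    (hasCompactSupport_cutoff_mul hs0 hε (fun Y => (Y * gramSpectral (fun l k => c k / l k) Y) a j))
    ((continuous_cutoff_mul hsc hs0 hε hD).add (continuous_cutoff_mul
      continuous_mul_deriv_smoothStep mul_deriv_smoothStep_of_le_one hε hB))
    ((hasCompactSupport_cutoff_mul hs0 hε (fun Y => shrinkFieldDeriv c Y a i j)).add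
      (hasCompactSupport_cutoff_mul mul_deriv_smoothStep_of_le_one hε (fun Y => barrierLogDeriv Y a i *
        (Y * gramSpectral (fun l k => c k / l k) Y) a j)))
    (hasLineDerivAt_cutoff_field hε c a i j)

/-- Stein's identity for the shrinkage field, cut off away from the irregular matrices. -/
theorem integral_cutoff_stein (M : Matrix (Fin n) (Fin p) ℝ) (hε : 0 < ε) (c : Fin p → ℝ)
    (i j : Fin p) :
    ∫ x, smoothStep (gramBarrier (matrixOfPairs x) / ε) * ((matrixOfPairs x - M)ᵀ *
        (matrixOfPairs x * gramSpectral (fun l k => c k / l k) (matrixOfPairs x))) i j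
          ∂normalMatrixLaw M
      = ∫ x, smoothStep (gramBarrier (matrixOfPairs x) / ε) *
          gramSpectral (driftCoeff n c) (matrixOfPairs x) i j ∂normalMatrixLaw M
        + ∫ x, (gramBarrier (matrixOfPairs x) / ε *
          deriv smoothStep (gramBarrier (matrixOfPairs x) / ε)) *
          (2 * gramSpectral (fun l k => barrierCoeff l k * c k) (matrixOfPairs x) i j)
          ∂normalMatrixLaw M := by
  have hs0 : ∀ x ≤ (1 : ℝ), smoothStep x = 0 := fun x => smoothStep_of_le_one
  have hsc : Continuous smoothStep := contDiff_smoothStep.continuous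
  have hF := fun (a : Fin n) (X : Matrix (Fin n) (Fin p) ℝ) (hX : GramRegular X) =>
    continuousAt_mul_gramSpectral_apply hX c a j
  have hB := fun (a : Fin n) (X : Matrix (Fin n) (Fin p) ℝ) (hX : GramRegular X) =>
    continuousAt_barrierLogDeriv_mul hX c a i j
  have hD := fun (a : Fin n) (X : Matrix (Fin n) (Fin p) ℝ) (hX : GramRegular X) =>
    hX.continuousAt_shrinkFieldDeriv c a i j
  have hint1 : ∀ a, Integrable (fun x : Fin n × Fin p → ℝ => (x (a, i) - M a i) *
      (smoothStep (gramBarrier (matrixOfPairs x) / ε) *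
        (matrixOfPairs x * gramSpectral (fun l k => c k / l k) (matrixOfPairs x)) a j))
      (normalMatrixLaw M) := by
    intro a
    refine Continuous.integrable_of_hasCompactSupport
      (((continuous_apply (a, i)).sub continuous_const).mul
        (continuous_cutoff_mul hsc hs0 hε (hF a))) ?_
    exact (hasCompactSupport_cutoff_mul hs0 hε
      (fun Y => (Y * gramSpectral (fun l k => c k / l k) Y) a j)).mul_left
  have hint2 := fun a => integrable_cutoff_mul hsc hs0 hε (hD a) (normalMatrixLaw M)
  have hint3 := fun a => integrable_cutoff_mul continuous_mul_deriv_smoothStep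
    mul_deriv_smoothStep_of_le_one hε (hB a) (normalMatrixLaw M)
  have e1 : ∀ x : Fin n × Fin p → ℝ, smoothStep (gramBarrier (matrixOfPairs x) / ε) *
      ((matrixOfPairs x - M)ᵀ *
        (matrixOfPairs x * gramSpectral (fun l k => c k / l k) (matrixOfPairs x))) i j
      = ∑ a, (x (a, i) - M a i) * (smoothStep (gramBarrier (matrixOfPairs x) / ε) *
        (matrixOfPairs x * gramSpectral (fun l k => c k / l k) (matrixOfPairs x)) a j) := by
    intro x
    rw [transpose_mul_apply_eq_sum, Finset.mul_sum]
    exact Finset.sum_congr rfl fun a _ => mul_left_comm _ _ _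
  have e2 : ∀ x : Fin n × Fin p → ℝ, smoothStep (gramBarrier (matrixOfPairs x) / ε) *
          gramSpectral (driftCoeff n c) (matrixOfPairs x) i j
      = ∑ a, smoothStep (gramBarrier (matrixOfPairs x) / ε) *
          shrinkFieldDeriv c (matrixOfPairs x) a i j := by
    intro x
    rw [← Finset.mul_sum]
    -- The divergence formula is available only at regular matrices; elsewhere both sides carry the
    -- vanishing cutoff.
    by_cases hX : GramRegular (matrixOfPairs x)
    · rw [hX.sum_shrinkFieldDeriv]
    · rw [gramBarrier_of_not_regular hX, zero_div, hs0 0 zero_le_one, zero_mul, zero_mul]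
  have e3 : ∀ x : Fin n × Fin p → ℝ, (gramBarrier (matrixOfPairs x) / ε *
          deriv smoothStep (gramBarrier (matrixOfPairs x) / ε)) *
          (2 * gramSpectral (fun l k => barrierCoeff l k * c k) (matrixOfPairs x) i j)
      = ∑ a, (gramBarrier (matrixOfPairs x) / ε *
          deriv smoothStep (gramBarrier (matrixOfPairs x) / ε)) *
          (barrierLogDeriv (matrixOfPairs x) a i *
            (matrixOfPairs x * gramSpectral (fun l k => c k / l k) (matrixOfPairs x)) a j) := by
    intro x
    rw [← Finset.mul_sum]
    by_cases hX : GramRegular (matrixOfPairs x)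
    · rw [sum_barrierLogDeriv_mul hX]
    · rw [gramBarrier_of_not_regular hX, zero_div, zero_mul, zero_mul, zero_mul]
  simp_rw [e1, e2, e3]
  rw [integral_finsetSum _ fun a _ => hint1 a, integral_finsetSum _ fun a _ => hint2 a,
    integral_finsetSum _ fun a _ => hint3 a, ← Finset.sum_add_distrib]
  exact Finset.sum_congr rfl fun a _ => integral_cutoff_stein_entry M hε c a i j

end Cutoff

/-! ### Inequalities for the drift and the barrier error -/

section DriftBounds

variable {p : ℕ}

theorem Antitone.div_sub_nonneg {c l : Fin p → ℝ} (hc : Antitone c) (hl : StrictAnti l)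
    (k j : Fin p) : 0 ≤ (c k - c j) / (l k - l j) := by
  rcases le_total k j with h | h
  · exact div_nonneg (sub_nonneg.2 (hc h)) (sub_nonneg.2 (hl.antitone h))
  · exact div_nonneg_of_nonpos (sub_nonpos.2 (hc h)) (sub_nonpos.2 (hl.antitone h))

/-- Symmetrizing in the pair `(k, j)` turns `2 c_k / (l_k - l_j)` into `(c_k - c_j) / (l_k - l_j)`,
nonnegative since `c` and `l` are ordered alike. Only the exponential factor of the barrier
contributes negatively, namely `-∑ c_k`. -/
theorem neg_sum_le_sum_barrierCoeff_mul {c l : Fin p → ℝ} (hc : Antitone c) (hc0 : ∀ k, 0 ≤ c k)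
    (hl : StrictAnti l) (hl0 : ∀ k, 0 < l k) :
    -∑ k, c k ≤ ∑ k, barrierCoeff l k * c k := by
  have h1 : ∑ k, barrierCoeff l k * c k
      = ∑ k, ∑ j ∈ Finset.univ.erase k, 2 * c k / (l k - l j) + ∑ k, c k / l k - ∑ k, c k := by
    rw [← Finset.sum_add_distrib, ← Finset.sum_sub_distrib]
    refine Finset.sum_congr rfl fun k _ => ?_
    rw [barrierCoeff, sub_mul, add_mul, Finset.mul_sum, Finset.sum_mul, one_mul, one_div_mul_eq_div]
    congr 2
    refine Finset.sum_congr rfl fun j _ => ?_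
    ring
  have h2 : ∑ k, ∑ j ∈ Finset.univ.erase k, 2 * c k / (l k - l j)
      = ∑ k, ∑ j ∈ Finset.univ.erase k, (c k - c j) / (l k - l j) := by
    have h3 : ∑ k, ∑ j ∈ Finset.univ.erase k, 2 * c k / (l k - l j)
        = ∑ k, ∑ j ∈ Finset.univ.erase k, c k / (l k - l j)
          + ∑ k, ∑ j ∈ Finset.univ.erase k, c k / (l k - l j) := by
      simp only [← Finset.sum_add_distrib]
      refine Finset.sum_congr rfl fun k _ => Finset.sum_congr rfl fun j _ => ?_
      ring
    rw [h3]
    nth_rw 2 [sum_sum_erase_comm]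
    simp only [← Finset.sum_add_distrib]
    refine Finset.sum_congr rfl fun k _ => Finset.sum_congr rfl fun j _ => ?_
    rw [← neg_sub (l k), div_neg]
    ring
  have h4 : 0 ≤ ∑ k, ∑ j ∈ Finset.univ.erase k, (c k - c j) / (l k - l j) :=
    Finset.sum_nonneg fun k _ => Finset.sum_nonneg fun j _ => hc.div_sub_nonneg hl k j
  have h5 : 0 ≤ ∑ k, c k / l k := Finset.sum_nonneg fun k _ => div_nonneg (hc0 k) (hl0 k).le
  rw [h1, h2]
  linarith

/-- The decreasing sequence `p - 1, …, 1, 0`. -/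
def descendingWeight (k : Fin p) : ℝ := (p : ℝ) - 1 - k

theorem descendingWeight_antitone : Antitone (descendingWeight (p := p)) := fun i j h => by
  have : ((i : ℕ) : ℝ) ≤ j := by exact_mod_cast h
  simp only [descendingWeight]
  linarith

theorem descendingWeight_nonneg (k : Fin p) : 0 ≤ descendingWeight k := by
  have : ((k : ℕ) : ℝ) + 1 ≤ p := by exact_mod_cast k.2
  simp only [descendingWeight]
  linarith

theorem descendingWeight_le (k : Fin p) : descendingWeight k ≤ p + 1 := by
  have : (0 : ℝ) ≤ ((k : ℕ) : ℝ) := Nat.cast_nonneg _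
  simp only [descendingWeight]
  linarith

/-- The coefficient `n - p - 1` may be as low as `-1`. The resulting loss `w_j / l_j` is paid by the
summand of the last index `z`, where `w_z = 0` and `w_j / (l_j - l_z) ≥ w_j / l_j`; the summand of
`i` remains available. -/
theorem driftCoeff_descendingWeight_ge {n : ℕ} (hpn : p ≤ n) {l : Fin p → ℝ} (hl : StrictAnti l)
    (hl0 : ∀ k, 0 < l k) {i j : Fin p} (hij : i < j) :
    (descendingWeight i - descendingWeight j) / (l i - l j)
      ≤ driftCoeff n descendingWeight l j := by
  have hnn : ((p : ℕ) : ℝ) ≤ n := by exact_mod_cast hpn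
  have hq := fun a b => descendingWeight_antitone.div_sub_nonneg hl a b
  have hsymm : (descendingWeight i - descendingWeight j) / (l i - l j)
      = (descendingWeight j - descendingWeight i) / (l j - l i) := by
    rw [← neg_sub (descendingWeight j), ← neg_sub (l j), neg_div_neg_eq]
  have h0 : -(descendingWeight j / l j) ≤ ((n : ℝ) - p - 1) * (descendingWeight j / l j) := by
    have := div_nonneg (descendingWeight_nonneg j) (hl0 j).le
    nlinarith
  rw [driftCoeff, hsymm]
  have hi : i ∈ Finset.univ.erase j := Finset.mem_erase.2 ⟨hij.ne, Finset.mem_univ i⟩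
  rw [← Finset.add_sum_erase _ _ hi]
  suffices h : descendingWeight j / l j ≤ ∑ m ∈ (Finset.univ.erase j).erase i,
      (descendingWeight j - descendingWeight m) / (l j - l m) by linarith
  -- If `j` is itself the last index its weight is zero and there is nothing to pay.
  by_cases hj : (j : ℕ) + 1 = p
  · have : descendingWeight j = 0 := by
      have : ((j : ℕ) : ℝ) + 1 = p := by exact_mod_cast hj
      simp only [descendingWeight]
      linarith
    exact le_trans (le_of_eq (by rw [this, zero_div])) (Finset.sum_nonneg fun m _ => hq j m)
  · have hj2 := j.2
    set z : Fin p := ⟨p - 1, by omega⟩ with hz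
    have hjz : j < z := by rw [Fin.lt_def]; simp only [hz]; omega
    have hwz : descendingWeight z = 0 := by
      simp only [descendingWeight, hz]
      rw [Nat.cast_sub (by omega)]
      push_cast
      ring
    have hz_mem : z ∈ (Finset.univ.erase j).erase i :=
      Finset.mem_erase.2 ⟨(hij.trans hjz).ne', Finset.mem_erase.2 ⟨hjz.ne', Finset.mem_univ z⟩⟩
    refine le_trans ?_ (Finset.single_le_sum
      (f := fun m => (descendingWeight j - descendingWeight m) / (l j - l m))
      (fun m _ => hq j m) hz_mem)
    simp only [hwz, sub_zero]
    exact div_le_div_of_nonneg_left (descendingWeight_nonneg j) (sub_pos.2 (hl hjz))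
      (by linarith [hl0 z])

theorem driftCoeff_descendingWeight_nonneg {n : ℕ} (hpn : p ≤ n) {l : Fin p → ℝ}
    (hl : StrictAnti l) (hl0 : ∀ k, 0 < l k) (j : Fin p) :
    0 ≤ driftCoeff n descendingWeight l j := by
  have hnn : ((p : ℕ) : ℝ) ≤ n := by exact_mod_cast hpn
  have hj2 := j.2
  by_cases hj : 0 < (j : ℕ)
  · have hij : (⟨0, by omega⟩ : Fin p) < j := by rw [Fin.lt_def]; exact hj
    exact (descendingWeight_antitone.div_sub_nonneg hl _ _).trans
      (driftCoeff_descendingWeight_ge hpn hl hl0 hij)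
  · have hq := fun a b => descendingWeight_antitone.div_sub_nonneg hl a b
    have hj0 : (j : ℕ) = 0 := by omega
    have h0 : -(descendingWeight j / l j) ≤ ((n : ℝ) - p - 1) * (descendingWeight j / l j) := by
      have := div_nonneg (descendingWeight_nonneg j) (hl0 j).le
      nlinarith
    rw [driftCoeff]
    suffices h : descendingWeight j / l j ≤ ∑ m ∈ Finset.univ.erase j,
      (descendingWeight j - descendingWeight m) / (l j - l m) by linarith
    set z : Fin p := ⟨p - 1, by omega⟩ with hz
    have hwz : descendingWeight z = 0 := by
      simp only [descendingWeight, hz]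
      rw [Nat.cast_sub (by omega)]
      push_cast
      ring
    rcases eq_or_ne z j with hzj | hzj
    · exact le_trans (le_of_eq (by rw [← hzj, hwz, zero_div]))
        (Finset.sum_nonneg fun m _ => hq j m)
    · have hjz : j < z := by
        rw [Fin.lt_def]
        have : (z : ℕ) ≠ j := fun h => hzj (Fin.ext h)
        omega
      refine le_trans ?_ (Finset.single_le_sum
        (f := fun m => (descendingWeight j - descendingWeight m) / (l j - l m))
        (fun m _ => hq j m) (Finset.mem_erase.2 ⟨hzj, Finset.mem_univ z⟩))
      simp only [hwz, sub_zero]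
      exact div_le_div_of_nonneg_left (descendingWeight_nonneg j) (sub_pos.2 (hl hjz))
        (by linarith [hl0 z])

/-- The descending weights have gaps at least `1`, so integrability of the total drift controls
every reciprocal eigenvalue gap. -/
theorem one_div_sub_le_sum_driftCoeff {n : ℕ} (hpn : p ≤ n) {l : Fin p → ℝ} (hl : StrictAnti l)
    (hl0 : ∀ k, 0 < l k) {i j : Fin p} (hij : i < j) :
    1 / (l i - l j) ≤ ∑ k, driftCoeff n descendingWeight l k := by
  refine le_trans ?_ (Finset.single_le_sum (f := driftCoeff n descendingWeight l)
    (fun k _ => driftCoeff_descendingWeight_nonneg hpn hl hl0 k) (Finset.mem_univ j))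
  refine le_trans ?_ (driftCoeff_descendingWeight_ge hpn hl hl0 hij)
  refine div_le_div_of_nonneg_right ?_ (sub_pos.2 (hl hij)).le
  have : ((i : ℕ) : ℝ) + 1 ≤ j := by exact_mod_cast hij
  simp only [descendingWeight]
  linarith

/-- The coercivity hypothesis of the a priori bound. The drift at the last index alone is enough:
its summands are `w_k / (l_k - l_z) ≥ w_k / l_k`, and `w_k ≤ p + 1` absorbs the second factor `w_k`.
-/
theorem sum_sq_div_le_sum_driftCoeff {n : ℕ} (hpn : p ≤ n) {l : Fin p → ℝ} (hl : StrictAnti l)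
    (hl0 : ∀ k, 0 < l k) :
    1 / ((p : ℝ) + 1) * ∑ k, descendingWeight k ^ 2 / l k
      ≤ ∑ k, driftCoeff n descendingWeight l k := by
  rcases Nat.eq_zero_or_pos p with hp | hp
  · subst hp; simp
  set z : Fin p := ⟨p - 1, by omega⟩ with hz
  have hwz : descendingWeight z = 0 := by
    simp only [descendingWeight, hz]
    rw [Nat.cast_sub (by omega)]
    push_cast
    ring
  refine le_trans ?_ (Finset.single_le_sum (f := driftCoeff n descendingWeight l)
    (fun k _ => driftCoeff_descendingWeight_nonneg hpn hl hl0 k) (Finset.mem_univ z))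
  rw [driftCoeff, hwz, zero_div, mul_zero, zero_add, ← Finset.add_sum_erase _ _ (Finset.mem_univ z),
    hwz]
  have hp1 : (0 : ℝ) < p + 1 := by positivity
  rw [mul_add, Finset.mul_sum]
  simp only [ne_eq, OfNat.ofNat_ne_zero, not_false_eq_true, zero_pow, zero_div, mul_zero, zero_add]
  refine Finset.sum_le_sum fun k hk => ?_
  have hkz : k < z := by
    rw [Fin.lt_def]
    have h1 : (k : ℕ) ≠ z := fun h => (Finset.ne_of_mem_erase hk) (Fin.ext h)
    have := k.2
    simp only [hz] at h1 ⊢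
    omega
  have hpos : 0 < l k - l z := sub_pos.2 (hl hkz)
  calc 1 / ((p : ℝ) + 1) * (descendingWeight k ^ 2 / l k)
      = descendingWeight k / l k * (descendingWeight k / ((p : ℝ) + 1)) := by ring
    _ ≤ descendingWeight k / l k * 1 := by
        refine mul_le_mul_of_nonneg_left ?_
          (div_nonneg (descendingWeight_nonneg k) (hl0 k).le)
        rw [div_le_one hp1]
        exact descendingWeight_le k
    _ ≤ descendingWeight k / (l k - l z) := by
        rw [mul_one]
        exact div_le_div_of_nonneg_left (descendingWeight_nonneg k) hpos (by linarith [hl0 z])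
    _ = (0 - descendingWeight k) / (l z - l k) := by
        rw [← neg_sub (l k), div_neg, zero_sub, neg_div, neg_neg]

end DriftBounds

/-! ### Measurability and Gaussian moments -/

section Moments

variable {n p : ℕ} (M : Matrix (Fin n) (Fin p) ℝ)

theorem ae_gramRegular_normalMatrixLaw (hpn : p ≤ n) :
    ∀ᵐ x ∂normalMatrixLaw M, GramRegular (matrixOfPairs x) :=
  (pi_gaussianReal_absolutelyContinuous fun q : Fin n × Fin p => M q.1 q.2) (ae_gramRegular hpn)

theorem continuous_gramEigenvalue_matrixOfPairs (k : Fin p) :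
    Continuous fun x : Fin n × Fin p → ℝ => gramEigenvalue (matrixOfPairs x) k :=
  ((continuous_apply k).comp continuous_gramEigenvalue).comp continuous_matrixOfPairs

/-- The adjugate formula is measurable on the whole space, including irregular matrices, because
inversion with `0⁻¹ = 0` is measurable. -/
theorem measurable_gramProjection_apply (k i j : Fin p) :
    Measurable fun x : Fin n × Fin p → ℝ => gramProjection (matrixOfPairs x) k i j := by
  have hc := fun k => continuous_gramEigenvalue_matrixOfPairs (n := n) (p := p) k
  have h1 : Continuous fun x : Fin n × Fin p → ℝ => ∏ j ∈ Finset.univ.erase k,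
      (gramEigenvalue (matrixOfPairs x) k - gramEigenvalue (matrixOfPairs x) j) :=
    continuous_finsetProd _ fun j _ => (hc k).sub (hc j)
  have h2 : Continuous fun x : Fin n × Fin p → ℝ =>
      (gramEigenvalue (matrixOfPairs x) k • (1 : Matrix (Fin p) (Fin p) ℝ) -
        (matrixOfPairs x)ᵀ * matrixOfPairs x).adjugate :=
    (((hc k).smul continuous_const).sub
      (continuous_gram.comp continuous_matrixOfPairs)).matrix_adjugate
  exact h1.measurable.inv.mul (h2.matrix_elem i j).measurable

theorem measurable_gramSpectral_apply {d : (Fin p → ℝ) → Fin p → ℝ}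
    (hd : ∀ k, Measurable fun l => d l k) (i j : Fin p) :
    Measurable fun x : Fin n × Fin p → ℝ => gramSpectral d (matrixOfPairs x) i j := by
  simp only [gramSpectral, Matrix.sum_apply, Matrix.smul_apply, smul_eq_mul]
  refine Finset.measurable_fun_sum _ fun k _ => Measurable.mul ?_
    (measurable_gramProjection_apply k i j)
  exact (hd k).comp (measurable_pi_lambda _ fun k =>
    (continuous_gramEigenvalue_matrixOfPairs k).measurable)

theorem measurable_driftCoeff (N : ℕ) (c : Fin p → ℝ) (k : Fin p) :
    Measurable fun l : Fin p → ℝ => driftCoeff N c l k := by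
  unfold driftCoeff
  fun_prop

theorem measurable_comp_gramEigenvalue {d : (Fin p → ℝ) → ℝ} (hd : Measurable d) :
    Measurable fun x : Fin n × Fin p → ℝ => d (gramEigenvalue (matrixOfPairs x)) :=
  hd.comp (measurable_pi_lambda _ fun k => (continuous_gramEigenvalue_matrixOfPairs k).measurable)

theorem integrable_gramSpectral_apply (hpn : p ≤ n) {d : (Fin p → ℝ) → Fin p → ℝ}
    (hd : ∀ k, Integrable (fun x => d (gramEigenvalue (matrixOfPairs x)) k) (normalMatrixLaw M))
    (i j : Fin p) :
    Integrable (fun x => gramSpectral d (matrixOfPairs x) i j) (normalMatrixLaw M) := by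
  simp only [gramSpectral, Matrix.sum_apply, Matrix.smul_apply, smul_eq_mul]
  refine integrable_finsetSum _ fun k _ => ?_
  refine (hd k).mul_bdd (c := 1) (measurable_gramProjection_apply k i j).aestronglyMeasurable ?_
  filter_upwards [ae_gramRegular_normalMatrixLaw M hpn] with x hx
  exact abs_gramProjection_le_one hx.1 k i j

theorem memLp_sub_normalMatrixLaw (a : Fin n) (i : Fin p) :
    MemLp (fun x : Fin n × Fin p → ℝ => x (a, i) - M a i) 2 (normalMatrixLaw M) := by
  have h : MemLp (fun y : ℝ => y - M a i) 2 (gaussianReal (M a i) 1) :=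
    (memLp_id_gaussianReal 2).sub (memLp_const _)
  exact h.comp_measurePreserving
    (measurePreserving_eval (fun q : Fin n × Fin p => gaussianReal (M q.1 q.2) 1) (a, i))

theorem integral_comp_eval_normalMatrixLaw (a : Fin n) (i : Fin p) {g : ℝ → ℝ}
    (hg : Measurable g) :
    ∫ x, g (x (a, i)) ∂normalMatrixLaw M = ∫ y, g y ∂gaussianReal (M a i) 1 := by
  have h := measurePreserving_eval (fun q : Fin n × Fin p => gaussianReal (M q.1 q.2) 1) (a, i)
  have h2 := integral_map (μ := normalMatrixLaw M) h.measurable.aemeasurable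
    (f := g) hg.aestronglyMeasurable
  rw [← h2]
  congr 1
  exact h.map_eq

theorem integral_sub_gaussianReal (m : ℝ) : ∫ y, (y - m) ∂gaussianReal m 1 = 0 := by
  have h : Integrable (fun y : ℝ => y) (gaussianReal m 1) :=
    (memLp_id_gaussianReal 1).integrable le_rfl
  rw [integral_sub h (integrable_const _)]
  simp

theorem integral_sub_mul_sub_gaussianReal (m : ℝ) :
    ∫ y, (y - m) * (y - m) ∂gaussianReal m 1 = 1 := by
  have h := variance_fun_id_gaussianReal (μ := m) (v := 1)
  rw [variance_eq_integral (by fun_prop)] at h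
  simpa [pow_two] using h

theorem integral_sub_mul_sub_normalMatrixLaw (a : Fin n) (i j : Fin p) :
    ∫ x, (x (a, i) - M a i) * (x (a, j) - M a j) ∂normalMatrixLaw M = if i = j then 1 else 0 := by
  by_cases hij : i = j
  · subst hij
    rw [if_pos rfl, integral_comp_eval_normalMatrixLaw M a i
      (g := fun y => (y - M a i) * (y - M a i)) (by fun_prop), integral_sub_mul_sub_gaussianReal]
  · rw [if_neg hij]
    have hind : iIndepFun (fun (q : Fin n × Fin p) (x : Fin n × Fin p → ℝ) => x q - M q.1 q.2)
        (normalMatrixLaw M) :=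
      iIndepFun_pi (μ := fun q : Fin n × Fin p => gaussianReal (M q.1 q.2) 1)
        (X := fun q y => y - M q.1 q.2) fun q => by fun_prop
    have h2 := hind.indepFun (i := (a, i)) (j := (a, j)) (by simpa using hij)
    have h3 := h2.integral_fun_mul_eq_mul_integral
      (memLp_sub_normalMatrixLaw M a i).aestronglyMeasurable
      (memLp_sub_normalMatrixLaw M a j).aestronglyMeasurable
    rw [h3, integral_comp_eval_normalMatrixLaw M a i (g := fun y => y - M a i) (by fun_prop),
      integral_sub_gaussianReal, zero_mul]

end Moments

/-! ### A priori bound on the drift -/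

section APriori

variable {n p : ℕ} {X : Matrix (Fin n) (Fin p) ℝ}

theorem GramRegular.strictAnti (hX : GramRegular X) : StrictAnti (gramEigenvalue X) :=
  (gramEigenvalue_antitone X).strictAnti_of_injective hX.1

theorem trace_gramSpectral (hX : GramRegular X) (d : (Fin p → ℝ) → Fin p → ℝ) :
    (gramSpectral d X).trace = ∑ k, d (gramEigenvalue X) k := by
  rw [gramSpectral, Matrix.trace_sum]
  refine Finset.sum_congr rfl fun k _ => ?_
  rw [Matrix.trace_smul, trace_gramProjection hX.1, smul_eq_mul, mul_one]

theorem transpose_mul_self_shrinkField (hX : GramRegular X) (c : Fin p → ℝ) :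
    (X * gramSpectral (fun l k => c k / l k) X)ᵀ * (X * gramSpectral (fun l k => c k / l k) X)
      = gramSpectral (fun l k => c k ^ 2 / l k) X := by
  obtain ⟨V, hV, hW⟩ := exists_gram_diagonalization X
  rw [gramSpectral_eq hV hW hX.1, gramSpectral_eq hV hW hX.1]
  set d := fun k => c k / gramEigenvalue X k with hd
  have h1 : (V * Matrix.diagonal d * Vᵀ)ᵀ = V * Matrix.diagonal d * Vᵀ := by
    simp [Matrix.transpose_mul, Matrix.mul_assoc]
  calc (X * (V * Matrix.diagonal d * Vᵀ))ᵀ * (X * (V * Matrix.diagonal d * Vᵀ))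
      = V * Matrix.diagonal d * Vᵀ * (Xᵀ * X) * (V * Matrix.diagonal d * Vᵀ) := by
        rw [Matrix.transpose_mul, h1]
        simp only [Matrix.mul_assoc]
    _ = V * (Matrix.diagonal d * (Vᵀ * V) * Matrix.diagonal (gramEigenvalue X) * (Vᵀ * V)
        * Matrix.diagonal d) * Vᵀ := by
        rw [hW]
        simp only [Matrix.mul_assoc]
    _ = V * Matrix.diagonal (fun k => c k ^ 2 / gramEigenvalue X k) * Vᵀ := by
        rw [hV, Matrix.mul_one, Matrix.mul_one, Matrix.diagonal_mul_diagonal,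
          Matrix.diagonal_mul_diagonal]
        congr 3
        ext k
        have := (hX.2 k).ne'
        simp only [hd]
        field_simp

theorem sum_sq_shrinkField (hX : GramRegular X) (c : Fin p → ℝ) :
    ∑ i, ∑ a, (X * gramSpectral (fun l k => c k / l k) X) a i ^ 2
      = ∑ k, c k ^ 2 / gramEigenvalue X k := by
  rw [← trace_gramSpectral hX (fun l k => c k ^ 2 / l k), ← transpose_mul_self_shrinkField hX]
  refine Finset.sum_congr rfl fun i _ => ?_
  rw [Matrix.diag_apply, transpose_mul_apply_eq_sum]
  refine Finset.sum_congr rfl fun a _ => ?_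
  rw [pow_two]

theorem continuousAt_cross (M : Matrix (Fin n) (Fin p) ℝ) (hX : GramRegular X) (c : Fin p → ℝ)
    (i j : Fin p) : ContinuousAt (fun Y : Matrix (Fin n) (Fin p) ℝ =>
      ((Y - M)ᵀ * (Y * gramSpectral (fun l k => c k / l k) Y)) i j) X := by
  refine ContinuousAt.matrix_apply (ContinuousAt.matrix_mul' ?_ (continuousAt_id.matrix_mul'
    (continuousAt_gramSpectral hX fun k => hX.continuousAt_div c k))) i j
  exact (continuous_id.sub continuous_const).matrix_transpose.continuousAt

theorem integral_cutoff_stein_trace (M : Matrix (Fin n) (Fin p) ℝ) {ε : ℝ} (hε : 0 < ε)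
    (c : Fin p → ℝ) :
    ∫ x, smoothStep (gramBarrier (matrixOfPairs x) / ε) * ∑ i, ((matrixOfPairs x - M)ᵀ *
        (matrixOfPairs x * gramSpectral (fun l k => c k / l k) (matrixOfPairs x))) i i
          ∂normalMatrixLaw M
      = ∫ x, smoothStep (gramBarrier (matrixOfPairs x) / ε) *
          ∑ k, driftCoeff n c (gramEigenvalue (matrixOfPairs x)) k ∂normalMatrixLaw M
        + ∫ x, (gramBarrier (matrixOfPairs x) / ε *
          deriv smoothStep (gramBarrier (matrixOfPairs x) / ε)) *
          (2 * ∑ k, barrierCoeff (gramEigenvalue (matrixOfPairs x)) k * c k)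
          ∂normalMatrixLaw M := by
  have hs0 : ∀ x ≤ (1 : ℝ), smoothStep x = 0 := fun x => smoothStep_of_le_one
  have hsc : Continuous smoothStep := contDiff_smoothStep.continuous
  have hC := fun i => integrable_cutoff_mul hsc hs0 hε
    (g := fun Y : Matrix (Fin n) (Fin p) ℝ =>
      ((Y - M)ᵀ * (Y * gramSpectral (fun l k => c k / l k) Y)) i i)
    (fun Y hY => continuousAt_cross M hY c i i) (normalMatrixLaw M)
  have hD := fun i => integrable_cutoff_mul hsc hs0 hε
    (g := fun Y : Matrix (Fin n) (Fin p) ℝ => gramSpectral (driftCoeff n c) Y i i)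
    (fun Y hY => (continuousAt_gramSpectral hY
      fun k => hY.continuousAt_driftCoeff n c k).matrix_apply i i) (normalMatrixLaw M)
  have hB := fun i => integrable_cutoff_mul continuous_mul_deriv_smoothStep
    mul_deriv_smoothStep_of_le_one hε
    (g := fun Y : Matrix (Fin n) (Fin p) ℝ =>
      2 * gramSpectral (fun l k => barrierCoeff l k * c k) Y i i)
    (fun Y hY => continuousAt_const.mul ((continuousAt_gramSpectral hY
      fun k => (hY.continuousAt_barrierCoeff k).mul continuousAt_const).matrix_apply i i))
      (normalMatrixLaw M)
  have e2 : ∀ x : Fin n × Fin p → ℝ, smoothStep (gramBarrier (matrixOfPairs x) / ε) *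
          ∑ k, driftCoeff n c (gramEigenvalue (matrixOfPairs x)) k
      = ∑ i, smoothStep (gramBarrier (matrixOfPairs x) / ε) *
          gramSpectral (driftCoeff n c) (matrixOfPairs x) i i := by
    intro x
    rw [← Finset.mul_sum]
    by_cases hX : GramRegular (matrixOfPairs x)
    · rw [← trace_gramSpectral hX]
      rfl
    · rw [gramBarrier_of_not_regular hX, zero_div, hs0 0 zero_le_one, zero_mul, zero_mul]
  have e3 : ∀ x : Fin n × Fin p → ℝ, (gramBarrier (matrixOfPairs x) / ε *
          deriv smoothStep (gramBarrier (matrixOfPairs x) / ε)) *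
          (2 * ∑ k, barrierCoeff (gramEigenvalue (matrixOfPairs x)) k * c k)
      = ∑ i, (gramBarrier (matrixOfPairs x) / ε *
          deriv smoothStep (gramBarrier (matrixOfPairs x) / ε)) *
          (2 * gramSpectral (fun l k => barrierCoeff l k * c k) (matrixOfPairs x) i i) := by
    intro x
    rw [← Finset.mul_sum, ← Finset.mul_sum]
    by_cases hX : GramRegular (matrixOfPairs x)
    · rw [← trace_gramSpectral hX (fun l k => barrierCoeff l k * c k)]
      rfl
    · rw [gramBarrier_of_not_regular hX, zero_div, zero_mul, zero_mul, zero_mul]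
  have e1 : ∀ x : Fin n × Fin p → ℝ, smoothStep (gramBarrier (matrixOfPairs x) / ε) *
      ∑ i, ((matrixOfPairs x - M)ᵀ *
        (matrixOfPairs x * gramSpectral (fun l k => c k / l k) (matrixOfPairs x))) i i
      = ∑ i, smoothStep (gramBarrier (matrixOfPairs x) / ε) * ((matrixOfPairs x - M)ᵀ *
        (matrixOfPairs x * gramSpectral (fun l k => c k / l k) (matrixOfPairs x))) i i :=
    fun x => Finset.mul_sum _ _ _
  simp_rw [e1, e2, e3]
  rw [integral_finsetSum _ fun i _ => hC i, integral_finsetSum _ fun i _ => hD i,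
    integral_finsetSum _ fun i _ => hB i, ← Finset.sum_add_distrib]
  exact Finset.sum_congr rfl fun i _ => integral_cutoff_stein M hε c i i

theorem integrable_sum_sq_sub (M : Matrix (Fin n) (Fin p) ℝ) :
    Integrable (fun x : Fin n × Fin p → ℝ => ∑ i, ∑ a, (x (a, i) - M a i) ^ 2)
      (normalMatrixLaw M) :=
  integrable_finsetSum _ fun i _ => integrable_finsetSum _ fun a _ =>
    (memLp_sub_normalMatrixLaw M a i).integrable_sq

/-- Young's inequality entrywise. The parameter `δ` is chosen later so that the second term is at
most half of the drift. -/
theorem cross_trace_le (M : Matrix (Fin n) (Fin p) ℝ) (x : Fin n × Fin p → ℝ)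
    (hX : GramRegular (matrixOfPairs x)) (c : Fin p → ℝ) {δ : ℝ} (hδ : 0 < δ) :
    ∑ i, ((matrixOfPairs x - M)ᵀ *
        (matrixOfPairs x * gramSpectral (fun l k => c k / l k) (matrixOfPairs x))) i i
      ≤ 1 / (2 * δ) * ∑ i, ∑ a, (x (a, i) - M a i) ^ 2
        + δ / 2 * ∑ k, c k ^ 2 / gramEigenvalue (matrixOfPairs x) k := by
  rw [← sum_sq_shrinkField hX, Finset.mul_sum, Finset.mul_sum, ← Finset.sum_add_distrib]
  refine Finset.sum_le_sum fun i _ => ?_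
  rw [transpose_mul_apply_eq_sum, Finset.mul_sum, Finset.mul_sum, ← Finset.sum_add_distrib]
  refine Finset.sum_le_sum fun a _ => ?_
  have h : (matrixOfPairs x - M) a i = x (a, i) - M a i := rfl
  rw [h]
  generalize x (a, i) - M a i = u
  generalize (matrixOfPairs x * gramSpectral (fun l k => c k / l k) (matrixOfPairs x)) a i = v
  have h2 : 1 / (2 * δ) * u ^ 2 + δ / 2 * v ^ 2 - u * v = (u - δ * v) ^ 2 / (2 * δ) := by
    field_simp
    ring
  have h3 : 0 ≤ (u - δ * v) ^ 2 / (2 * δ) := by positivity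
  linarith

/-- A uniform bound on the truncated expectation of the divergence. -/
theorem exists_integral_cutoff_drift_le (M : Matrix (Fin n) (Fin p) ℝ) {c : Fin p → ℝ}
    (hc : Antitone c) (hc0 : ∀ k, 0 ≤ c k) {δ : ℝ} (hδ : 0 < δ)
    (hdrift : ∀ l : Fin p → ℝ, StrictAnti l → (∀ k, 0 < l k) →
      δ * ∑ k, c k ^ 2 / l k ≤ ∑ k, driftCoeff n c l k) :
    ∃ K : ℝ, ∀ ε > 0, ∫ x, smoothStep (gramBarrier (matrixOfPairs x) / ε) *
      ∑ k, driftCoeff n c (gramEigenvalue (matrixOfPairs x)) k ∂normalMatrixLaw M ≤ K := by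
  obtain ⟨C, hC0, hC⟩ := exists_mul_deriv_smoothStep_le
  have hs0 : ∀ x ≤ (1 : ℝ), smoothStep x = 0 := fun x => smoothStep_of_le_one
  have hsc : Continuous smoothStep := contDiff_smoothStep.continuous
  set A : ℝ := ∫ x, 1 / (2 * δ) * ∑ i, ∑ a, (x (a, i) - M a i) ^ 2 ∂normalMatrixLaw M with hA
  -- If `I` is the truncated drift integral, Stein's identity and the two bounds below give `I ≤ A +
  -- I / 2 + 2 C ∑ c_k`. Since `I` is finite thanks to the cutoff, it can be absorbed on the left.
  refine ⟨2 * (A + 2 * C * ∑ k, c k), fun ε hε => ?_⟩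
  have hstein := integral_cutoff_stein_trace M hε c
  have hI1 := integrable_cutoff_mul hsc hs0 hε
    (g := fun Y : Matrix (Fin n) (Fin p) ℝ => ∑ k, driftCoeff n c (gramEigenvalue Y) k)
    (fun Y hY => tendsto_finsetSum _ fun k _ => hY.continuousAt_driftCoeff n c k)
    (normalMatrixLaw M)
  have hI2 := integrable_cutoff_mul hsc hs0 hε
    (g := fun Y : Matrix (Fin n) (Fin p) ℝ =>
      ∑ i, ((Y - M)ᵀ * (Y * gramSpectral (fun l k => c k / l k) Y)) i i)
    (fun Y hY => tendsto_finsetSum _ fun i _ => continuousAt_cross M hY c i i)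
    (normalMatrixLaw M)
  have hI3 := integrable_cutoff_mul continuous_mul_deriv_smoothStep
    mul_deriv_smoothStep_of_le_one hε
    (g := fun Y : Matrix (Fin n) (Fin p) ℝ => 2 * ∑ k, barrierCoeff (gramEigenvalue Y) k * c k)
    (fun Y hY => continuousAt_const.mul (tendsto_finsetSum _ fun k _ =>
      (hY.continuousAt_barrierCoeff k).mul continuousAt_const)) (normalMatrixLaw M)
  have hub : ∫ x, smoothStep (gramBarrier (matrixOfPairs x) / ε) * ∑ i, ((matrixOfPairs x - M)ᵀ *
        (matrixOfPairs x * gramSpectral (fun l k => c k / l k) (matrixOfPairs x))) i i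
          ∂normalMatrixLaw M
      ≤ A + 1 / 2 * ∫ x, smoothStep (gramBarrier (matrixOfPairs x) / ε) *
      ∑ k, driftCoeff n c (gramEigenvalue (matrixOfPairs x)) k ∂normalMatrixLaw M := by
    rw [hA, ← integral_const_mul, ← integral_add ((integrable_sum_sq_sub M).const_mul _)
      (hI1.const_mul _)]
    refine integral_mono hI2 (((integrable_sum_sq_sub M).const_mul _).add (hI1.const_mul _))
      fun x => ?_
    have hS : 0 ≤ 1 / (2 * δ) * ∑ i, ∑ a, (x (a, i) - M a i) ^ 2 := by positivity
    by_cases hX : GramRegular (matrixOfPairs x)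
    · have h1 := cross_trace_le M x hX c hδ
      have h2 := hdrift _ hX.strictAnti hX.2
      have h3 := smoothStep_nonneg (gramBarrier (matrixOfPairs x) / ε)
      have h4 := smoothStep_le_one (gramBarrier (matrixOfPairs x) / ε)
      have h5 := mul_le_mul_of_nonneg_left h1 h3
      have h6 := mul_le_mul_of_nonneg_left h2 h3
      have h7 := mul_le_mul_of_nonneg_right h4 hS
      simp only
      nlinarith
    · simp only [gramBarrier_of_not_regular hX, zero_div, hs0 0 zero_le_one, zero_mul, mul_zero,
        add_zero]
      exact hS
  have hlb : -(2 * C * ∑ k, c k) ≤ ∫ x, (gramBarrier (matrixOfPairs x) / ε *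
          deriv smoothStep (gramBarrier (matrixOfPairs x) / ε)) *
          (2 * ∑ k, barrierCoeff (gramEigenvalue (matrixOfPairs x)) k * c k)
          ∂normalMatrixLaw M := by
    have h0 : ∫ _x, -(2 * C * ∑ k, c k) ∂normalMatrixLaw M = -(2 * C * ∑ k, c k) := by simp
    rw [← h0]
    have hsum : 0 ≤ ∑ k, c k := Finset.sum_nonneg fun k _ => hc0 k
    refine integral_mono (integrable_const _) hI3 fun x => ?_
    by_cases hX : GramRegular (matrixOfPairs x)
    · have h1 := neg_sum_le_sum_barrierCoeff_mul hc hc0 hX.strictAnti hX.2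
      have hq : 0 ≤ gramBarrier (matrixOfPairs x) / ε := div_nonneg (gramBarrier_nonneg _) hε.le
      have h2 := hC _ hq
      have h3 := mul_nonneg hq (deriv_smoothStep_nonneg (gramBarrier (matrixOfPairs x) / ε))
      have h4 := mul_le_mul_of_nonneg_left h1 h3
      have h5 := mul_le_mul_of_nonneg_right h2 hsum
      simp only
      nlinarith
    · simp only [gramBarrier_of_not_regular hX, zero_div, zero_mul]
      have := mul_nonneg hC0 hsum
      linarith
  linarith

/-- With `ε = 1 / (N + 1)`, a regular matrix eventually lies where the cutoff is identically `1`, so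
the convergence statements that follow are eventual equalities. -/
theorem tendsto_barrier_div (hX : GramRegular X) :
    Filter.Tendsto (fun N : ℕ => gramBarrier X / (1 / ((N : ℝ) + 1))) Filter.atTop
      Filter.atTop := by
  have h : Filter.Tendsto (fun N : ℕ => gramBarrier X * ((N : ℝ) + 1)) Filter.atTop
      Filter.atTop :=
    (Filter.tendsto_atTop_add_const_right _ _ tendsto_natCast_atTop_atTop).const_mul_atTop
      hX.gramBarrier_pos
  refine h.congr fun N => ?_
  rw [div_div_eq_mul_div, div_one]

theorem tendsto_smoothStep_barrier (hX : GramRegular X) :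
    Filter.Tendsto (fun N : ℕ => smoothStep (gramBarrier X / (1 / ((N : ℝ) + 1)))) Filter.atTop
      (nhds 1) := by
  refine tendsto_const_nhds.congr' ?_
  filter_upwards [(tendsto_barrier_div hX).eventually_ge_atTop 2] with N hN
  exact (smoothStep_of_two_le hN).symm

theorem tendsto_mul_deriv_smoothStep_barrier (hX : GramRegular X) :
    Filter.Tendsto (fun N : ℕ => gramBarrier X / (1 / ((N : ℝ) + 1)) *
      deriv smoothStep (gramBarrier X / (1 / ((N : ℝ) + 1)))) Filter.atTop (nhds 0) := by
  refine tendsto_const_nhds.congr' ?_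
  filter_upwards [(tendsto_barrier_div hX).eventually_ge_atTop 2] with N hN
  rw [deriv_smoothStep_of_two_le hN, mul_zero]

theorem integrable_sum_driftCoeff (hpn : p ≤ n) (M : Matrix (Fin n) (Fin p) ℝ) {c : Fin p → ℝ}
    (hc : Antitone c) (hc0 : ∀ k, 0 ≤ c k) {δ : ℝ} (hδ : 0 < δ)
    (hdrift : ∀ l : Fin p → ℝ, StrictAnti l → (∀ k, 0 < l k) →
      δ * ∑ k, c k ^ 2 / l k ≤ ∑ k, driftCoeff n c l k) :
    Integrable (fun x => ∑ k, driftCoeff n c (gramEigenvalue (matrixOfPairs x)) k)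
      (normalMatrixLaw M) := by
  obtain ⟨K, hK⟩ := exists_integral_cutoff_drift_le M hc hc0 hδ hdrift
  have hs0 : ∀ x ≤ (1 : ℝ), smoothStep x = 0 := fun x => smoothStep_of_le_one
  have hsc : Continuous smoothStep := contDiff_smoothStep.continuous
  have hNpos : ∀ N : ℕ, (0 : ℝ) < 1 / ((N : ℝ) + 1) := fun N => by positivity
  have hI := fun N : ℕ => integrable_cutoff_mul hsc hs0 (hNpos N)
    (g := fun Y : Matrix (Fin n) (Fin p) ℝ => ∑ k, driftCoeff n c (gramEigenvalue Y) k)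
    (fun Y hY => tendsto_finsetSum _ fun k _ => hY.continuousAt_driftCoeff n c k)
    (normalMatrixLaw M)
  have hnn : ∀ (N : ℕ) (x : Fin n × Fin p → ℝ),
      0 ≤ smoothStep (gramBarrier (matrixOfPairs x) / (1 / ((N : ℝ) + 1))) *
        ∑ k, driftCoeff n c (gramEigenvalue (matrixOfPairs x)) k := by
    intro N x
    by_cases hX : GramRegular (matrixOfPairs x)
    · refine mul_nonneg (smoothStep_nonneg _) (le_trans ?_ (hdrift _ hX.strictAnti hX.2))
      exact mul_nonneg hδ.le (Finset.sum_nonneg fun k _ => div_nonneg (sq_nonneg _) (hX.2 k).le)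
    · rw [gramBarrier_of_not_regular hX, zero_div, hs0 0 zero_le_one, zero_mul]
  have hmeas : AEStronglyMeasurable
      (fun x => ∑ k, driftCoeff n c (gramEigenvalue (matrixOfPairs x)) k) (normalMatrixLaw M) :=
    (Finset.measurable_fun_sum _ fun k _ =>
      measurable_comp_gramEigenvalue (measurable_driftCoeff n c k)).aestronglyMeasurable
  rw [← memLp_one_iff_integrable]
  refine ⟨hmeas, lt_of_le_of_lt ?_ (ENNReal.ofReal_lt_top (r := K))⟩
  -- Fatou's lemma: the truncated drifts are nonnegative, converge almost everywhere and have `L¹`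
  -- norms at most `K`.
  refine Lp.eLpNorm_le_of_ae_tendsto (u := Filter.atTop)
    (f := fun (N : ℕ) x => smoothStep (gramBarrier (matrixOfPairs x) / (1 / ((N : ℝ) + 1))) *
        ∑ k, driftCoeff n c (gramEigenvalue (matrixOfPairs x)) k)
    (Filter.Eventually.of_forall fun N => ?_) (fun N => (hI N).aestronglyMeasurable) ?_
  · rw [eLpNorm_one_eq_lintegral_enorm]
    have h1 : ∀ x : Fin n × Fin p → ℝ,
        ‖smoothStep (gramBarrier (matrixOfPairs x) / (1 / ((N : ℝ) + 1))) *
        ∑ k, driftCoeff n c (gramEigenvalue (matrixOfPairs x)) k‖ₑ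
        = ENNReal.ofReal (smoothStep (gramBarrier (matrixOfPairs x) / (1 / ((N : ℝ) + 1))) *
        ∑ k, driftCoeff n c (gramEigenvalue (matrixOfPairs x)) k) := fun x =>
      Real.enorm_of_nonneg (hnn N x)
    simp_rw [h1]
    rw [← ofReal_integral_eq_lintegral_ofReal (hI N) (ae_of_all _ (hnn N))]
    exact ENNReal.ofReal_le_ofReal (hK _ (hNpos N))
  · filter_upwards [ae_gramRegular_normalMatrixLaw M hpn] with x hx
    simpa using (tendsto_smoothStep_barrier hx).mul_const
      (∑ k, driftCoeff n c (gramEigenvalue (matrixOfPairs x)) k)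

end APriori

/-! ### Integrability and the limiting Stein identity -/

section Integrability

variable {n p : ℕ} (M : Matrix (Fin n) (Fin p) ℝ)

theorem integrable_one_div_sub_of_lt (hpn : p ≤ n) {i j : Fin p} (hij : i < j) :
    Integrable (fun x => 1 / (gramEigenvalue (matrixOfPairs x) i
      - gramEigenvalue (matrixOfPairs x) j)) (normalMatrixLaw M) := by
  have h := integrable_sum_driftCoeff hpn M descendingWeight_antitone descendingWeight_nonneg
    (δ := 1 / ((p : ℝ) + 1)) (by positivity)
    (fun l hl hl0 => sum_sq_div_le_sum_driftCoeff hpn hl hl0)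
  refine h.mono' (measurable_comp_gramEigenvalue
    (d := fun l => 1 / (l i - l j)) (by fun_prop)).aestronglyMeasurable ?_
  filter_upwards [ae_gramRegular_normalMatrixLaw M hpn] with x hx
  rw [Real.norm_of_nonneg (one_div_nonneg.2 (sub_pos.2 (hx.strictAnti hij)).le)]
  exact one_div_sub_le_sum_driftCoeff hpn hx.strictAnti hx.2 hij

theorem integrable_one_div_sub (hpn : p ≤ n) {i j : Fin p} (hij : i ≠ j) :
    Integrable (fun x => 1 / (gramEigenvalue (matrixOfPairs x) i
      - gramEigenvalue (matrixOfPairs x) j)) (normalMatrixLaw M) := by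
  rcases lt_or_gt_of_ne hij with h | h
  · exact integrable_one_div_sub_of_lt M hpn h
  · refine (integrable_one_div_sub_of_lt M hpn h).neg.congr (ae_of_all _ fun x => ?_)
    simp only [Pi.neg_apply]
    rw [← neg_sub (gramEigenvalue (matrixOfPairs x) i), div_neg, neg_neg]

/-- With constant weights the gap terms vanish and the drift is `(n - p - 1) ∑ 1 / λ_k`, which
dominates `∑ 1 / λ_k` precisely because `n - p - 1 ≥ 1`. -/
theorem integrable_one_div_gramEigenvalue (hpn : p + 2 ≤ n) (k : Fin p) :
    Integrable (fun x => 1 / gramEigenvalue (matrixOfPairs x) k) (normalMatrixLaw M) := by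
  have hn : (p : ℝ) + 2 ≤ n := by exact_mod_cast hpn
  have hd : ∀ (l : Fin p → ℝ), (∀ k, 0 < l k) →
      ∑ k, 1 / l k ≤ ∑ k, driftCoeff n (fun _ => 1) l k := by
    intro l hl0
    refine Finset.sum_le_sum fun k _ => ?_
    have h0 : 0 < 1 / l k := one_div_pos.2 (hl0 k)
    simp only [driftCoeff, sub_self, zero_div, Finset.sum_const_zero, add_zero]
    nlinarith
  have h := integrable_sum_driftCoeff (by omega) M (c := fun _ => 1) antitone_const
    (fun _ => zero_le_one) (δ := 1) one_pos (fun l _ hl0 => by simpa using hd l hl0)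
  refine h.mono' (measurable_comp_gramEigenvalue
    (d := fun l => 1 / l k) (by fun_prop)).aestronglyMeasurable ?_
  filter_upwards [ae_gramRegular_normalMatrixLaw M (by omega)] with x hx
  rw [Real.norm_of_nonneg (one_div_nonneg.2 (hx.2 k).le)]
  refine le_trans ?_ (hd _ hx.2)
  exact Finset.single_le_sum (f := fun k => 1 / gramEigenvalue (matrixOfPairs x) k)
    (fun k _ => one_div_nonneg.2 (hx.2 k).le) (Finset.mem_univ k)

variable {c : Fin p → ℝ}

theorem integrable_div_gramEigenvalue (hpn : p ≤ n)
    (hrisk : p + 2 ≤ n ∨ ∀ k : Fin p, (k : ℕ) + 1 = p → c k = 0) (k : Fin p) :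
    Integrable (fun x => c k / gramEigenvalue (matrixOfPairs x) k) (normalMatrixLaw M) := by
  suffices h : c k = 0 ∨
      Integrable (fun x => 1 / gramEigenvalue (matrixOfPairs x) k) (normalMatrixLaw M) by
    rcases h with h | h
    · simp [h]
    · refine (h.const_mul (c k)).congr (ae_of_all _ fun x => ?_)
      simp only [mul_one_div]
  rcases hrisk with h | h
  · exact Or.inr (integrable_one_div_gramEigenvalue M h k)
  by_cases hk : (k : ℕ) + 1 = p
  · exact Or.inl (h k hk)
  right
  have hk2 := k.2
  -- For a non-last index no condition beyond `p ≤ n` is needed: `1 / λ_k ≤ 1 / (λ_k - λ_p)`, and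
  -- reciprocal gaps are integrable.
  have hkz : k < ⟨p - 1, by omega⟩ := by rw [Fin.lt_def]; simp only; omega
  refine (integrable_one_div_sub_of_lt M hpn hkz).mono' (measurable_comp_gramEigenvalue
    (d := fun l => 1 / l k) (by fun_prop)).aestronglyMeasurable ?_
  filter_upwards [ae_gramRegular_normalMatrixLaw M hpn] with x hx
  rw [Real.norm_of_nonneg (one_div_nonneg.2 (hx.2 k).le)]
  refine one_div_le_one_div_of_le (sub_pos.2 (hx.strictAnti hkz)) ?_
  linarith [hx.2 ⟨p - 1, by omega⟩]

theorem integrable_driftCoeff (hpn : p ≤ n)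
    (hrisk : p + 2 ≤ n ∨ ∀ k : Fin p, (k : ℕ) + 1 = p → c k = 0) (k : Fin p) :
    Integrable (fun x => driftCoeff n c (gramEigenvalue (matrixOfPairs x)) k)
      (normalMatrixLaw M) := by
  refine ((integrable_div_gramEigenvalue M hpn hrisk k).const_mul _).add
    (integrable_finsetSum _ fun j hj => ?_)
  refine ((integrable_one_div_sub M hpn (Finset.ne_of_mem_erase hj).symm).const_mul
    (c k - c j)).congr (ae_of_all _ fun x => ?_)
  simp only [mul_one_div]

theorem integrable_barrierCoeff_mul (hpn : p ≤ n)
    (hrisk : p + 2 ≤ n ∨ ∀ k : Fin p, (k : ℕ) + 1 = p → c k = 0) (k : Fin p) :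
    Integrable (fun x => barrierCoeff (gramEigenvalue (matrixOfPairs x)) k * c k)
      (normalMatrixLaw M) := by
  have h1 : Integrable (fun x => ∑ j ∈ Finset.univ.erase k,
      1 / (gramEigenvalue (matrixOfPairs x) k - gramEigenvalue (matrixOfPairs x) j))
      (normalMatrixLaw M) :=
    integrable_finsetSum _ fun j hj => integrable_one_div_sub M hpn (Finset.ne_of_mem_erase hj).symm
  refine (((h1.const_mul (2 * c k)).add (integrable_div_gramEigenvalue M hpn hrisk k)).sub
    (integrable_const (c k))).congr (ae_of_all _ fun x => ?_)
  simp only [barrierCoeff, Pi.add_apply, Pi.sub_apply]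
  ring

theorem integrable_sq_div_gramEigenvalue (hpn : p ≤ n)
    (hrisk : p + 2 ≤ n ∨ ∀ k : Fin p, (k : ℕ) + 1 = p → c k = 0) (k : Fin p) :
    Integrable (fun x => c k ^ 2 / gramEigenvalue (matrixOfPairs x) k) (normalMatrixLaw M) := by
  refine ((integrable_div_gramEigenvalue M hpn hrisk k).const_mul (c k)).congr
    (ae_of_all _ fun x => ?_)
  simp only
  ring

theorem measurable_cross (c : Fin p → ℝ) (i j : Fin p) :
    Measurable fun x : Fin n × Fin p → ℝ => ((matrixOfPairs x - M)ᵀ *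
      (matrixOfPairs x * gramSpectral (fun l k => c k / l k) (matrixOfPairs x))) i j := by
  simp only [transpose_mul_apply_eq_sum]
  refine Finset.measurable_fun_sum _ fun a _ => Measurable.mul ?_ ?_
  · have h : Measurable fun x : Fin n × Fin p → ℝ => x (a, i) - M a i := by fun_prop
    exact h
  · simp only [Matrix.mul_apply]
    refine Finset.measurable_fun_sum _ fun m _ => Measurable.mul (measurable_pi_apply (a, m)) ?_
    exact measurable_gramSpectral_apply (fun k => by fun_prop) m j

/-- Dominated through `|u v| ≤ u² + v²` by the squared noise plus `∑ c_k² / λ_k`, the squared norm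
of the field. -/
theorem integrable_cross (hpn : p ≤ n)
    (hrisk : p + 2 ≤ n ∨ ∀ k : Fin p, (k : ℕ) + 1 = p → c k = 0) (i j : Fin p) :
    Integrable (fun x => ((matrixOfPairs x - M)ᵀ *
      (matrixOfPairs x * gramSpectral (fun l k => c k / l k) (matrixOfPairs x))) i j)
      (normalMatrixLaw M) := by
  refine ((integrable_sum_sq_sub M).add (integrable_finsetSum Finset.univ fun k _ =>
    integrable_sq_div_gramEigenvalue M hpn hrisk k)).mono'
    (measurable_cross M c i j).aestronglyMeasurable ?_
  filter_upwards [ae_gramRegular_normalMatrixLaw M hpn] with x hx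
  simp only [Pi.add_apply]
  rw [← sum_sq_shrinkField hx, transpose_mul_apply_eq_sum, Real.norm_eq_abs]
  set G := matrixOfPairs x * gramSpectral (fun l k => c k / l k) (matrixOfPairs x) with hG
  have h1 : ∑ a, (x (a, i) - M a i) ^ 2 ≤ ∑ i, ∑ a, (x (a, i) - M a i) ^ 2 :=
    Finset.single_le_sum (f := fun i => ∑ a, (x (a, i) - M a i) ^ 2)
      (fun i _ => Finset.sum_nonneg fun a _ => sq_nonneg _) (Finset.mem_univ i)
  have h2 : ∑ a, G a j ^ 2 ≤ ∑ i, ∑ a, G a i ^ 2 :=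
    Finset.single_le_sum (f := fun i => ∑ a, G a i ^ 2)
      (fun i _ => Finset.sum_nonneg fun a _ => sq_nonneg _) (Finset.mem_univ j)
  refine le_trans ?_ (add_le_add h1 h2)
  rw [← Finset.sum_add_distrib]
  refine (Finset.abs_sum_le_sum_abs _ _).trans (Finset.sum_le_sum fun a _ => ?_)
  have h : (matrixOfPairs x - M) a i = x (a, i) - M a i := rfl
  rw [h]
  generalize x (a, i) - M a i = u
  generalize G a j = v
  rw [abs_le]
  constructor <;> nlinarith [sq_nonneg (u + v), sq_nonneg (u - v)]

/-- Stein's identity for the shrinkage field. -/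
theorem integral_cross (hpn : p ≤ n)
    (hrisk : p + 2 ≤ n ∨ ∀ k : Fin p, (k : ℕ) + 1 = p → c k = 0) (i j : Fin p) :
    ∫ x, ((matrixOfPairs x - M)ᵀ *
        (matrixOfPairs x * gramSpectral (fun l k => c k / l k) (matrixOfPairs x))) i j
          ∂normalMatrixLaw M
      = ∫ x, gramSpectral (driftCoeff n c) (matrixOfPairs x) i j ∂normalMatrixLaw M := by
  obtain ⟨C, hC0, hC⟩ := exists_mul_deriv_smoothStep_le
  have hreg := ae_gramRegular_normalMatrixLaw M hpn
  have hNpos : ∀ N : ℕ, (0 : ℝ) < 1 / ((N : ℝ) + 1) := fun N => by positivity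
  have hbar : Measurable fun x : Fin n × Fin p → ℝ => gramBarrier (matrixOfPairs x) :=
    (continuous_gramBarrier.comp continuous_matrixOfPairs).measurable
  have hs : ∀ N : ℕ, Measurable fun x : Fin n × Fin p → ℝ =>
      smoothStep (gramBarrier (matrixOfPairs x) / (1 / ((N : ℝ) + 1))) := fun N =>
    contDiff_smoothStep.continuous.measurable.comp (hbar.div_const _)
  have hs' : ∀ N : ℕ, Measurable fun x : Fin n × Fin p → ℝ =>
      gramBarrier (matrixOfPairs x) / (1 / ((N : ℝ) + 1)) *
        deriv smoothStep (gramBarrier (matrixOfPairs x) / (1 / ((N : ℝ) + 1))) := fun N =>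
    continuous_mul_deriv_smoothStep.measurable.comp (hbar.div_const _)
  have key : ∀ {g : (Fin n × Fin p → ℝ) → ℝ}, Integrable g (normalMatrixLaw M) →
      Filter.Tendsto (fun N : ℕ => ∫ x,
        smoothStep (gramBarrier (matrixOfPairs x) / (1 / ((N : ℝ) + 1))) * g x ∂normalMatrixLaw M)
        Filter.atTop (nhds (∫ x, g x ∂normalMatrixLaw M)) := by
    intro g hg
    refine tendsto_integral_of_dominated_convergence (fun x => ‖g x‖)
      (fun N => (hs N).aestronglyMeasurable.mul hg.1) hg.norm (fun N => ae_of_all _ fun x => ?_) ?_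
    · rw [norm_mul, Real.norm_of_nonneg (smoothStep_nonneg _)]
      exact mul_le_of_le_one_left (norm_nonneg _) (smoothStep_le_one _)
    · filter_upwards [hreg] with x hx
      simpa using (tendsto_smoothStep_barrier hx).mul_const (g x)
  -- The error factor is at most `C` and vanishes pointwise in the limit, so dominated convergence
  -- removes it.
  have key' : ∀ {g : (Fin n × Fin p → ℝ) → ℝ}, Integrable g (normalMatrixLaw M) →
      Filter.Tendsto (fun N : ℕ => ∫ x, gramBarrier (matrixOfPairs x) / (1 / ((N : ℝ) + 1)) *
        deriv smoothStep (gramBarrier (matrixOfPairs x) / (1 / ((N : ℝ) + 1))) * g x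
          ∂normalMatrixLaw M) Filter.atTop (nhds 0) := by
    intro g hg
    rw [← integral_zero (Fin n × Fin p → ℝ) ℝ (μ := normalMatrixLaw M)]
    refine tendsto_integral_of_dominated_convergence (fun x => C * ‖g x‖)
      (fun N => (hs' N).aestronglyMeasurable.mul hg.1) (hg.norm.const_mul C)
      (fun N => ae_of_all _ fun x => ?_) ?_
    · have hq : 0 ≤ gramBarrier (matrixOfPairs x) / (1 / ((N : ℝ) + 1)) :=
        div_nonneg (gramBarrier_nonneg _) (hNpos N).le
      rw [norm_mul, Real.norm_of_nonneg (mul_nonneg hq (deriv_smoothStep_nonneg _))]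
      exact mul_le_mul_of_nonneg_right (hC _ hq) (norm_nonneg _)
    · filter_upwards [hreg] with x hx
      simpa using (tendsto_mul_deriv_smoothStep_barrier hx).mul_const (g x)
  have h1 := key (integrable_cross M hpn hrisk i j)
  have h2 := key (integrable_gramSpectral_apply M hpn
    (fun k => integrable_driftCoeff M hpn hrisk k) i j)
  have h3 := key' ((integrable_gramSpectral_apply M hpn (d := fun l k => barrierCoeff l k * c k)
    (fun k => integrable_barrierCoeff_mul M hpn hrisk k) i j).const_mul 2)
  have h4 := h2.add h3
  rw [add_zero] at h4
  refine tendsto_nhds_unique h1 (h4.congr fun N => ?_)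
  exact (integral_cutoff_stein M (hNpos N) c i j).symm

end Integrability

/-! ### Assembling the risk -/

section Risk

variable {n p : ℕ}

theorem quadraticLoss_shrink {X : Matrix (Fin n) (Fin p) ℝ} (hX : GramRegular X)
    (M : Matrix (Fin n) (Fin p) ℝ) (c : Fin p → ℝ) (i j : Fin p) :
    quadraticLoss M (X - X * gramSpectral (fun l k => c k / l k) X) i j
      = ∑ a, (X a i - M a i) * (X a j - M a j)
        - ((X - M)ᵀ * (X * gramSpectral (fun l k => c k / l k) X)) i j
        - ((X - M)ᵀ * (X * gramSpectral (fun l k => c k / l k) X)) j i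
        + gramSpectral (fun l k => c k ^ 2 / l k) X i j := by
  rw [← transpose_mul_self_shrinkField hX, quadraticLoss]
  simp only [transpose_mul_apply_eq_sum, Matrix.sub_apply]
  rw [← Finset.sum_sub_distrib, ← Finset.sum_sub_distrib, ← Finset.sum_add_distrib]
  refine Finset.sum_congr rfl fun a _ => ?_
  ring

theorem conj_riskDiagonal_eq {X : Matrix (Fin n) (Fin p) ℝ} (hX : GramRegular X)
    {V : Matrix (Fin p) (Fin p) ℝ} (hV : Vᵀ * V = 1)
    (hW : Xᵀ * X = V * Matrix.diagonal (gramEigenvalue X) * Vᵀ) (c : Fin p → ℝ) (i j : Fin p) :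
    (V * riskDiagonal n c (gramEigenvalue X) * Vᵀ) i j
      = gramSpectral (fun l k => c k ^ 2 / l k) X i j
        - 2 * gramSpectral (driftCoeff n c) X i j := by
  rw [riskDiagonal_eq n c _ hX.1 hX.2,
    ← gramSpectral_eq hV hW hX.1 (fun l k => c k ^ 2 / l k - 2 * driftCoeff n c l k)]
  simp only [gramSpectral, Matrix.sum_apply, Matrix.smul_apply, smul_eq_mul]
  rw [Finset.mul_sum, ← Finset.sum_sub_distrib]
  refine Finset.sum_congr rfl fun k _ => ?_
  ring

theorem gramSpectral_apply_comm {X : Matrix (Fin n) (Fin p) ℝ} (hX : GramRegular X)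
    (d : (Fin p → ℝ) → Fin p → ℝ) (i j : Fin p) : gramSpectral d X i j = gramSpectral d X j i := by
  simp only [gramSpectral, Matrix.sum_apply, Matrix.smul_apply]
  refine Finset.sum_congr rfl fun k _ => ?_
  nth_rw 1 [← transpose_gramProjection hX.1]
  rfl

theorem inv_conj_diagonal {V : Matrix (Fin p) (Fin p) ℝ} (hV : Vᵀ * V = 1) {l : Fin p → ℝ}
    (hl : ∀ k, l k ≠ 0) :
    (V * Matrix.diagonal l * Vᵀ)⁻¹ = V * Matrix.diagonal (fun k => 1 / l k) * Vᵀ := by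
  refine Matrix.inv_eq_right_inv ?_
  calc V * Matrix.diagonal l * Vᵀ * (V * Matrix.diagonal (fun k => 1 / l k) * Vᵀ)
      = V * (Matrix.diagonal l * (Vᵀ * V) * Matrix.diagonal (fun k => 1 / l k)) * Vᵀ := by
        simp only [Matrix.mul_assoc]
    _ = 1 := by
        rw [hV, Matrix.mul_one, Matrix.diagonal_mul_diagonal]
        simp [hl, mul_eq_one_comm.1 hV]

theorem inv_gram_eq_gramSpectral {X : Matrix (Fin n) (Fin p) ℝ} (hX : GramRegular X) :
    (Xᵀ * X)⁻¹ = gramSpectral (fun l k => 1 / l k) X := by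
  obtain ⟨V, hV, hW⟩ := exists_gram_diagonalization X
  rw [gramSpectral_eq hV hW hX.1, hW, inv_conj_diagonal hV fun k => (hX.2 k).ne']

/-- Invertibility allows repeated eigenvalues, where `gramProjection` is not the spectral
projection, so the computation uses the diagonalization by `V` directly. -/
theorem IsSVD.svShrink_const {X U : Matrix (Fin n) (Fin p) ℝ} {σ : Fin p → ℝ}
    {V : Matrix (Fin p) (Fin p) ℝ} (h : IsSVD X U σ V) (hX : IsUnit (Xᵀ * X)) {c : Fin p → ℝ}
    {r : ℝ} (hc : ∀ k, c k = r) :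
    svShrink c U σ V = X * (1 - r • (Xᵀ * X)⁻¹) := by
  have hV := h.right_orthonormal
  have hW := h.gram_eq_gramEigenvalue
  have hdet : (Xᵀ * X).det = ∏ k, gramEigenvalue X k := by
    rw [hW, Matrix.det_mul_comm, ← mul_assoc, hV, one_mul, Matrix.det_diagonal]
  have hne : ∏ k, gramEigenvalue X k ≠ 0 := by
    rw [← hdet]
    exact ((Matrix.isUnit_iff_isUnit_det _).1 hX).ne_zero
  have hl : ∀ k, gramEigenvalue X k ≠ 0 := fun k =>
    Finset.prod_ne_zero_iff.1 hne k (Finset.mem_univ k)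
  rw [h.svShrink_eq_sub (fun k => lt_of_le_of_ne (gramEigenvalue_nonneg X k) (hl k).symm),
    Matrix.mul_sub, Matrix.mul_one, hW, inv_conj_diagonal hV hl, ← Matrix.smul_mul,
    ← Matrix.mul_smul, ← Matrix.diagonal_smul]
  congr 5
  ext k
  simp [hc, div_eq_mul_inv]

variable {Ω : Type*} [MeasurableSpace Ω] {P : Measure Ω} {M : Matrix (Fin n) (Fin p) ℝ}
  {X : Ω → Matrix (Fin n) (Fin p) ℝ}

theorem IsNormalMatrix.hasLaw (hX : IsNormalMatrix P M X) :
    HasLaw (fun ω (q : Fin n × Fin p) => X ω q.1 q.2) (normalMatrixLaw M) P :=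
  iIndepFun.hasLaw_pi (X := fun (q : Fin n × Fin p) ω => X ω q.1 q.2)
    (fun q => hX.1 q.1 q.2) hX.2

theorem IsNormalMatrix.ae_gramRegular (hX : IsNormalMatrix P M X) (hpn : p ≤ n) :
    ∀ᵐ ω ∂P, GramRegular (X ω) := by
  have h := ae_gramRegular_normalMatrixLaw M hpn
  rw [← hX.hasLaw.map_eq] at h
  exact ae_of_ae_map hX.hasLaw.aemeasurable h

theorem IsNormalMatrix.integrable_comp (hX : IsNormalMatrix P M X)
    {g : Matrix (Fin n) (Fin p) ℝ → ℝ}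
    (hg : Integrable (fun x => g (matrixOfPairs x)) (normalMatrixLaw M)) :
    Integrable (fun ω => g (X ω)) P := by
  rw [← hX.hasLaw.map_eq] at hg
  exact hg.comp_aemeasurable hX.hasLaw.aemeasurable

theorem IsNormalMatrix.integral_comp (hX : IsNormalMatrix P M X)
    {g : Matrix (Fin n) (Fin p) ℝ → ℝ}
    (hg : Integrable (fun x => g (matrixOfPairs x)) (normalMatrixLaw M)) :
    ∫ ω, g (X ω) ∂P = ∫ x, g (matrixOfPairs x) ∂normalMatrixLaw M :=
  hX.hasLaw.integral_comp hg.1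

theorem integrable_gram_centered (M : Matrix (Fin n) (Fin p) ℝ) (i j : Fin p) :
    Integrable (fun x => ∑ a, (matrixOfPairs x a i - M a i) * (matrixOfPairs x a j - M a j))
      (normalMatrixLaw M) :=
  integrable_finsetSum _ fun a _ =>
    (memLp_sub_normalMatrixLaw M a i).integrable_mul (memLp_sub_normalMatrixLaw M a j)

theorem integral_gram_centered (M : Matrix (Fin n) (Fin p) ℝ) (i j : Fin p) :
    ∫ x, ∑ a, (matrixOfPairs x a i - M a i) * (matrixOfPairs x a j - M a j) ∂normalMatrixLaw M
      = ((n : ℝ) • (1 : Matrix (Fin p) (Fin p) ℝ)) i j := by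
  refine (integral_finsetSum _ fun a _ =>
    (memLp_sub_normalMatrixLaw M a i).integrable_mul (memLp_sub_normalMatrixLaw M a j)).trans ?_
  refine (Finset.sum_congr rfl fun a _ => integral_sub_mul_sub_normalMatrixLaw M a i j).trans ?_
  simp [Matrix.one_apply]

variable {c : Fin p → ℝ}

theorem integrable_loss_terms (hpn : p ≤ n)
    (hrisk : p + 2 ≤ n ∨ ∀ k : Fin p, (k : ℕ) + 1 = p → c k = 0) (i j : Fin p) :
    Integrable (fun x => ∑ a, (matrixOfPairs x a i - M a i) * (matrixOfPairs x a j - M a j)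
      - ((matrixOfPairs x - M)ᵀ *
        (matrixOfPairs x * gramSpectral (fun l k => c k / l k) (matrixOfPairs x))) i j
      - ((matrixOfPairs x - M)ᵀ *
        (matrixOfPairs x * gramSpectral (fun l k => c k / l k) (matrixOfPairs x))) j i
      + gramSpectral (fun l k => c k ^ 2 / l k) (matrixOfPairs x) i j) (normalMatrixLaw M) :=
  (((integrable_gram_centered M i j).sub (integrable_cross M hpn hrisk i j)).sub
    (integrable_cross M hpn hrisk j i)).add
    (integrable_gramSpectral_apply M hpn
      (fun k => integrable_sq_div_gramEigenvalue M hpn hrisk k) i j)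

theorem integrable_risk_terms (hpn : p ≤ n)
    (hrisk : p + 2 ≤ n ∨ ∀ k : Fin p, (k : ℕ) + 1 = p → c k = 0) (i j : Fin p) :
    Integrable (fun x => gramSpectral (fun l k => c k ^ 2 / l k) (matrixOfPairs x) i j
        - 2 * gramSpectral (driftCoeff n c) (matrixOfPairs x) i j) (normalMatrixLaw M) :=
  (integrable_gramSpectral_apply M hpn
    (fun k => integrable_sq_div_gramEigenvalue M hpn hrisk k) i j).sub
    ((integrable_gramSpectral_apply M hpn
      (fun k => integrable_driftCoeff M hpn hrisk k) i j).const_mul 2)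

theorem integral_sub_sub_add {α : Type*} [MeasurableSpace α] {μ : Measure α}
    {f₁ f₂ f₃ f₄ : α → ℝ} (h₁ : Integrable f₁ μ) (h₂ : Integrable f₂ μ)
    (h₃ : Integrable f₃ μ) (h₄ : Integrable f₄ μ) :
    ∫ x, (f₁ x - f₂ x - f₃ x + f₄ x) ∂μ
      = ∫ x, f₁ x ∂μ - ∫ x, f₂ x ∂μ - ∫ x, f₃ x ∂μ + ∫ x, f₄ x ∂μ := by
  have h₁₂ : Integrable (fun x => f₁ x - f₂ x) μ := h₁.sub h₂
  have h₁₂₃ : Integrable (fun x => f₁ x - f₂ x - f₃ x) μ := h₁₂.sub h₃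
  rw [integral_add h₁₂₃ h₄, integral_sub h₁₂ h₃, integral_sub h₁ h₂]

theorem integral_loss_terms (hpn : p ≤ n)
    (hrisk : p + 2 ≤ n ∨ ∀ k : Fin p, (k : ℕ) + 1 = p → c k = 0) (i j : Fin p) :
    ∫ x, (∑ a, (matrixOfPairs x a i - M a i) * (matrixOfPairs x a j - M a j)
      - ((matrixOfPairs x - M)ᵀ *
        (matrixOfPairs x * gramSpectral (fun l k => c k / l k) (matrixOfPairs x))) i j
      - ((matrixOfPairs x - M)ᵀ *
        (matrixOfPairs x * gramSpectral (fun l k => c k / l k) (matrixOfPairs x))) j i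
      + gramSpectral (fun l k => c k ^ 2 / l k) (matrixOfPairs x) i j) ∂normalMatrixLaw M
      = ((n : ℝ) • (1 : Matrix (Fin p) (Fin p) ℝ)) i j
        + ∫ x, (gramSpectral (fun l k => c k ^ 2 / l k) (matrixOfPairs x) i j
        - 2 * gramSpectral (driftCoeff n c) (matrixOfPairs x) i j) ∂normalMatrixLaw M := by
  have h1 := integrable_gram_centered M i j
  have h2 := integrable_cross M hpn hrisk i j
  have h3 := integrable_cross M hpn hrisk j i
  have h4 := integrable_gramSpectral_apply M hpn (d := fun l k => c k ^ 2 / l k)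
    (fun k => integrable_sq_div_gramEigenvalue M hpn hrisk k) i j
  have h5 := integrable_gramSpectral_apply M hpn (d := driftCoeff n c)
      (fun k => integrable_driftCoeff M hpn hrisk k) i j
  -- The two cross terms are transposes of each other; symmetry of the spectral function merges them
  -- into twice the drift.
  have hsymm : ∫ x, gramSpectral (driftCoeff n c) (matrixOfPairs x) j i ∂normalMatrixLaw M
      = ∫ x, gramSpectral (driftCoeff n c) (matrixOfPairs x) i j ∂normalMatrixLaw M := by
    refine integral_congr_ae ?_
    filter_upwards [ae_gramRegular_normalMatrixLaw M hpn] with x hx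
    exact gramSpectral_apply_comm hx _ _ _
  refine (integral_sub_sub_add h1 h2 h3 h4).trans ?_
  rw [integral_sub h4 (h5.const_mul 2), integral_const_mul, integral_gram_centered,
    integral_cross M hpn hrisk, integral_cross M hpn hrisk, hsymm]
  ring

end Risk

/-! ### The main theorem -/

theorem theorem2 {Ω : Type*} [MeasurableSpace Ω] (P : Measure Ω) [IsProbabilityMeasure P]
    (n p : ℕ) (hpn : p ≤ n)
    (M : Matrix (Fin n) (Fin p) ℝ)
    (X : Ω → Matrix (Fin n) (Fin p) ℝ) (hX : IsNormalMatrix P M X)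
    (c : Fin p → ℝ) (hc : ∀ k, 0 ≤ c k)
    -- the estimator has finite risk: `n ≥ p + 2`, or the last coefficient vanishes
    (hrisk : p + 2 ≤ n ∨ ∀ k : Fin p, (k : ℕ) + 1 = p → c k = 0)
    -- an arbitrary choice of a singular value decomposition of every matrix
    (U : Matrix (Fin n) (Fin p) ℝ → Matrix (Fin n) (Fin p) ℝ)
    (σ : Matrix (Fin n) (Fin p) ℝ → Fin p → ℝ)
    (V : Matrix (Fin n) (Fin p) ℝ → Matrix (Fin p) (Fin p) ℝ)
    (hsvd : ∀ Y, IsSVD Y (U Y) (σ Y) (V Y))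
    (Mhat : Matrix (Fin n) (Fin p) ℝ → Matrix (Fin n) (Fin p) ℝ)
    (hMhat : ∀ Y, Mhat Y = svShrink c (U Y) (σ Y) (V Y)) :
    -- `h` is orthogonally invariant
    (∀ Q ∈ Matrix.orthogonalGroup (Fin n) ℝ, ∀ R ∈ Matrix.orthogonalGroup (Fin p) ℝ,
      ∀ Y : Matrix (Fin n) (Fin p) ℝ, shrinkPotential c (Q * Y * R) = shrinkPotential c Y) ∧
    -- the estimator is `Y + ∇h(Y)` wherever the eigenvalues are distinct and positive
    (∀ Y : Matrix (Fin n) (Fin p) ℝ,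
      Function.Injective (gramEigenvalue Y) → (∀ k, 0 < gramEigenvalue Y k) →
        HasMatrixPartials (shrinkPotential c) Y ∧
          Mhat Y = Y + matrixGradient (shrinkPotential c) Y) ∧
    -- and this is the case almost surely
    (∀ᵐ ω ∂P, Function.Injective (gramEigenvalue (X ω)) ∧ ∀ k, 0 < gramEigenvalue (X ω) k) ∧
    -- the matrix quadratic risk
    MatrixIntegrable P (fun ω => quadraticLoss M (Mhat (X ω))) ∧
    MatrixIntegrable P (fun ω =>
      V (X ω) * riskDiagonal n c (gramEigenvalue (X ω)) * (V (X ω))ᵀ) ∧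
    matrixExpectation P (fun ω => quadraticLoss M (Mhat (X ω))) =
      (n : ℝ) • (1 : Matrix (Fin p) (Fin p) ℝ) +
        matrixExpectation P (fun ω =>
          V (X ω) * riskDiagonal n c (gramEigenvalue (X ω)) * (V (X ω))ᵀ) ∧
    -- the Efron–Morris estimator
    (p + 2 ≤ n → (∀ k, c k = (n : ℝ) - p - 1) →
      (∀ Y : Matrix (Fin n) (Fin p) ℝ, IsUnit (Yᵀ * Y) →
        Mhat Y = Y * (1 - ((n : ℝ) - p - 1) • (Yᵀ * Y)⁻¹)) ∧
      MatrixIntegrable P (fun ω => ((X ω)ᵀ * X ω)⁻¹) ∧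
      matrixExpectation P (fun ω => quadraticLoss M (Mhat (X ω))) =
        (n : ℝ) • (1 : Matrix (Fin p) (Fin p) ℝ) -
          ((n : ℝ) - p - 1) ^ 2 • matrixExpectation P (fun ω => ((X ω)ᵀ * X ω)⁻¹)) := by
  have hsvdV : ∀ Y, (V Y)ᵀ * V Y = 1 := fun Y => (hsvd Y).right_orthonormal
  have hsvdW : ∀ Y, Yᵀ * Y = V Y * Matrix.diagonal (gramEigenvalue Y) * (V Y)ᵀ :=
    fun Y => (hsvd Y).gram_eq_gramEigenvalue
  have hreg := hX.ae_gramRegular hpn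
  -- Almost surely the loss is a function of `X` alone, free of the chosen decomposition. No
  -- measurability of `U`, `σ` or `V` is therefore required, since integrability transfers along
  -- almost sure equality.
  have hloss : ∀ i j, (fun ω => quadraticLoss M (Mhat (X ω)) i j) =ᵐ[P] fun ω =>
      ∑ a, (X ω a i - M a i) * (X ω a j - M a j)
        - ((X ω - M)ᵀ * (X ω * gramSpectral (fun l k => c k / l k) (X ω))) i j
        - ((X ω - M)ᵀ * (X ω * gramSpectral (fun l k => c k / l k) (X ω))) j i
        + gramSpectral (fun l k => c k ^ 2 / l k) (X ω) i j := by
    intro i j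
    filter_upwards [hreg] with ω hω
    rw [hMhat, hω.svShrink_eq (hsvd _), quadraticLoss_shrink hω]
  have hD : ∀ i j, (fun ω => (V (X ω) * riskDiagonal n c (gramEigenvalue (X ω)) *
      (V (X ω))ᵀ) i j) =ᵐ[P] fun ω => gramSpectral (fun l k => c k ^ 2 / l k) (X ω) i j
        - 2 * gramSpectral (driftCoeff n c) (X ω) i j := by
    intro i j
    filter_upwards [hreg] with ω hω
    rw [conj_riskDiagonal_eq hω (hsvdV _) (hsvdW _)]
  have hlossI := fun i j => hX.integrable_comp (g := fun Y =>
      ∑ a, (Y a i - M a i) * (Y a j - M a j)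
        - ((Y - M)ᵀ * (Y * gramSpectral (fun l k => c k / l k) Y)) i j
        - ((Y - M)ᵀ * (Y * gramSpectral (fun l k => c k / l k) Y)) j i
        + gramSpectral (fun l k => c k ^ 2 / l k) Y i j) (integrable_loss_terms hpn hrisk i j)
  have hDI := fun i j => hX.integrable_comp (g := fun Y =>
      gramSpectral (fun l k => c k ^ 2 / l k) Y i j - 2 * gramSpectral (driftCoeff n c) Y i j)
      (integrable_risk_terms hpn hrisk i j)
  have hmain : matrixExpectation P (fun ω => quadraticLoss M (Mhat (X ω))) =
      (n : ℝ) • (1 : Matrix (Fin p) (Fin p) ℝ) +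
        matrixExpectation P (fun ω =>
          V (X ω) * riskDiagonal n c (gramEigenvalue (X ω)) * (V (X ω))ᵀ) := by
    ext i j
    rw [Matrix.add_apply]
    change ∫ ω, quadraticLoss M (Mhat (X ω)) i j ∂P = _ + ∫ ω, (V (X ω) *
      riskDiagonal n c (gramEigenvalue (X ω)) * (V (X ω))ᵀ) i j ∂P
    rw [integral_congr_ae (hloss i j), integral_congr_ae (hD i j),
      hX.integral_comp (g := fun Y =>
        ∑ a, (Y a i - M a i) * (Y a j - M a j)
        - ((Y - M)ᵀ * (Y * gramSpectral (fun l k => c k / l k) Y)) i j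
        - ((Y - M)ᵀ * (Y * gramSpectral (fun l k => c k / l k) Y)) j i
        + gramSpectral (fun l k => c k ^ 2 / l k) Y i j) (integrable_loss_terms hpn hrisk i j),
      hX.integral_comp (g := fun Y =>
        gramSpectral (fun l k => c k ^ 2 / l k) Y i j - 2 * gramSpectral (driftCoeff n c) Y i j)
        (integrable_risk_terms hpn hrisk i j)]
    exact integral_loss_terms hpn hrisk i j
  refine ⟨fun Q hQ R hR Y => shrinkPotential_orthogonal_mul c hQ hR Y, ?_, hreg, ?_, ?_, hmain, ?_⟩
  · intro Y hinj hpos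
    have hY : GramRegular Y := ⟨hinj, hpos⟩
    refine ⟨hY.hasMatrixPartials_shrinkPotential c, ?_⟩
    rw [hMhat, hY.svShrink_eq (hsvd Y), hY.matrixGradient_shrinkPotential, sub_eq_add_neg]
  · exact fun i j => (hlossI i j).congr (hloss i j).symm
  · exact fun i j => (hDI i j).congr (hD i j).symm
  · intro hpn2 hcc
    have hinv : ∀ i j, (fun ω => ((X ω)ᵀ * X ω)⁻¹ i j) =ᵐ[P] fun ω =>
        gramSpectral (fun l k => 1 / l k) (X ω) i j := by
      intro i j
      filter_upwards [hreg] with ω hω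
      rw [inv_gram_eq_gramSpectral hω]
    refine ⟨fun Y hY => by rw [hMhat, (hsvd Y).svShrink_const hY hcc], fun i j => ?_, ?_⟩
    · exact (hX.integrable_comp (g := fun Y => gramSpectral (fun l k => 1 / l k) Y i j)
        (integrable_gramSpectral_apply M hpn
          (fun k => integrable_one_div_gramEigenvalue M hpn2 k) i j)).congr (hinv i j).symm
    · rw [hmain, sub_eq_add_neg]
      congr 1
      ext i j
      rw [Matrix.neg_apply, Matrix.smul_apply, smul_eq_mul]
      change ∫ ω, (V (X ω) * riskDiagonal n c (gramEigenvalue (X ω)) * (V (X ω))ᵀ) i j ∂P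
        = -(((n : ℝ) - p - 1) ^ 2 * ∫ ω, ((X ω)ᵀ * X ω)⁻¹ i j ∂P)
      rw [← integral_const_mul, ← integral_neg]
      refine integral_congr_ae ((hD i j).trans ?_)
      filter_upwards [hinv i j] with ω hω
      rw [hω]
      simp only [gramSpectral, Matrix.sum_apply, Matrix.smul_apply, smul_eq_mul]
      rw [Finset.mul_sum, ← Finset.sum_sub_distrib, Finset.mul_sum, ← Finset.sum_neg_distrib]
      refine Finset.sum_congr rfl fun k _ => ?_
      -- With equal coefficients the gap terms vanish, and with `r = n - p - 1` what remains is `r²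
      -- / λ_k - 2 r² / λ_k = -r² / λ_k`.
      simp only [driftCoeff, hcc, sub_self, zero_div, Finset.sum_const_zero, add_zero]
      ring
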